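/- **Notation.** Let $\mathbb D$ be the open unit disc and $\mathbb T$ the unit circle with normalized Lebesgue measure $m$. The closed unit ball of $H^\infty$ is the set of analytic $b:\mathbb D\to\mathbb C$ with $|b|\le 1$. For such $b$, the de Branges–Rovnyak space $\mathscr H(b)$ is the reproducing kernel Hilbert space of functions on $\mathbb D$ with kernel $$k^b_\lambda(z)=\frac{1-\overline{b(\lambda)}\,b(z)}{1-\overline\lambda z},\qquad \lambda,z\in\mathbb D .$$ $H^2$ is the Hardy space of analytic functions $f$ on $\mathbb D$ with $\sup_{0\le\rho<1}\int_{\mathbb T}|f(\rho\xi)|^2\,dm(\xi)<\infty$. A function on $\mathbb D$ is outer if it has the form $c\exp\int_{\mathbb T}\frac{\xi+z}{\xi-z}u(\xi)\,dm(\xi)$ with $|c|=1$ and $u\in L^1(\mathbb T,m)$ real. A Pythagorean mate of $b$ is an outer function $a$ in the closed unit ball of $H^\infty$ with $a(0)>0$ and $|a|^2+|b|^2=1$ a.e. on $\mathbb T$ (for radial boundary values). If $q$ is outer and $r>0$, then $q^r=\exp(r\log q)$, where $\log q$ is any analytic logarithm of $q$ on $\mathbb D$. If $\zeta\in\mathbb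 T$ and $q^r$ continues analytically to a neighbourhood of $\zeta$, then for $\ell\ge 0$ $$v^\ell_{r,\zeta}(z)=\left.\frac{d^\ell}{d\overline\lambda^\ell}\left(\frac{1-\overline{q^r(\lambda)}\,q^r(z)}{1-\overline\lambda z}\right)\right|_{\lambda=\zeta},\qquad z\in\mathbb D,$$ where $q^r(\lambda)$ near $\zeta$ denotes that continuation. **Theorem.** Let $q$ be a rational outer function in the closed unit ball of $H^\infty$, let $r>0$, and fix an analytic logarithm of $q$ on $\mathbb D$. Then: 1. $\mathscr H(q^r)=\mathscr H(q)$ as sets. 2. Suppose that $a$ is the Pythagorean mate of $q$ and that $\zeta_1,\dots,\zeta_n$ ($n\ge 0$) are the distinct zeros on $\mathbb T$ of (the analytic continuation of) $a$, with multiplicities $m_1,\dots,m_n\ge 1$. Then: (a) for $1\le j\le n$ and $0\le\ell\le m_j-1$ the function $v^\ell_{r,\zeta_j}$ is well defined and belongs to $\mathscr H(q^r)$; moreover $$aH^2=\Big(\prod_{j=1}^n(z-\zeta_j)^{m_j}\Big)H^2\subset\mathscr H(q^r),$$ and every $v^\ell_{r,\zeta_j}$ is orthogonal to $aH^2$ in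 $\mathscr H(q^r)$; (b) $\mathscr H(q^r)$ is the orthogonal sum, with respect to the inner product of $\mathscr H(q^r)$, $$\mathscr H(q^r)=\Big(\prod_{j=1}^n(z-\zeta_j)^{m_j}\Big)H^2\ \oplus\ \operatorname{span}\{v^\ell_{r,\zeta_j}:1\le j\le n,\ 0\le\ell\le m_j-1\}.$$ -/

import Mathlib

open Complex Metric Filter Topology
open scoped ComplexConjugate UnitDisc InnerProductSpace

noncomputable section

namespace DBR

/-- The closed unit ball of `H^∞`: analytic functions on the open unit disc bounded by `1` there.
Only the values on the open unit disc matter. -/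
structure SchurFunction where
  toFun : ℂ → ℂ
  differentiableOn : DifferentiableOn ℂ toFun (ball 0 1)
  norm_le_one : ∀ z ∈ ball (0 : ℂ) 1, ‖toFun z‖ ≤ 1

instance : CoeFun SchurFunction fun _ => ℂ → ℂ := ⟨SchurFunction.toFun⟩

/-! ### The space `H(b)` -/

/-- The kernel `k^b_w(z) = (1 - conj (b w) * b z) / (1 - conj w * z)`. -/
def kernelFun (b : ℂ → ℂ) (w z : ℂ) : ℂ :=
  (1 - conj (b w) * b z) / (1 - conj w * z)

/-- The same kernel in the operator-valued form used by `RKHS`; rows are indexed by `z`, columns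
by `w`. -/
def kernelMatrix (b : SchurFunction) : Matrix 𝔻 𝔻 (ℂ →L[ℂ] ℂ) :=
  .of fun z w => kernelFun b w z • ContinuousLinearMap.id ℂ ℂ

theorem one_sub_conj_mul_ne_zero {w z : ℂ} (hw : ‖w‖ < 1) (hz : ‖z‖ ≤ 1) :
    1 - conj w * z ≠ 0 := by
  intro h
  have h1 : conj w * z = 1 := (sub_eq_zero.mp h).symm
  have h2 : ‖w‖ * ‖z‖ = 1 := by simpa using congrArg norm h1
  nlinarith [norm_nonneg w, norm_nonneg z]

/-- Cauchy's formula on the unit circle, through the Szegő kernel. -/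
theorem circleAverage_mul_szego {f : ℂ → ℂ} (hf : DiffContOnCl ℂ f (ball 0 1)) {w : ℂ}
    (hw : ‖w‖ < 1) :
    Real.circleAverage (fun z => f z * conj (1 / (1 - conj w * z))) 0 1 = f w := by
  have h := DiffContOnCl.circleAverage_smul_div (R := 1) (c := 0) (f := f) (w := w)
    (by simpa using hf) (by simpa using hw)
  rw [← h]
  apply Real.circleAverage_congr_sphere
  intro z hz
  have hz1 : ‖z‖ = 1 := by simpa using hz
  have hzz : z * conj z = 1 := by rw [Complex.mul_conj, Complex.normSq_eq_norm_sq, hz1]; simp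
  have hz0 : z ≠ 0 := by rintro rfl; simp at hz1
  have hd : z - w ≠ 0 := by
    intro h; rw [sub_eq_zero] at h; rw [h] at hz1; linarith
  have hd2 : 1 - w * conj z ≠ 0 := by
    intro h'
    apply hd
    have : z * (1 - w * conj z) = 0 := by rw [h', mul_zero]
    linear_combination this + w * hzz
  simp only [map_div₀, map_one, map_sub, map_mul, Complex.conj_conj, sub_zero, smul_eq_mul]
  field_simp
  linear_combination (f z) * w * hzz

theorem kernel_form_nonneg_aux {b : ℂ → ℂ} (hb : DiffContOnCl ℂ b (ball 0 1))
    (hb1 : ∀ z, ‖z‖ ≤ 1 → ‖b z‖ ≤ 1) (s : Finset 𝔻) (c : 𝔻 → ℂ) :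
    0 ≤ (∑ w ∈ s, ∑ z ∈ s, kernelFun b w z * c w * conj (c z)).re := by
  set k : 𝔻 → ℂ → ℂ := fun w z => 1 / (1 - conj (w : ℂ) * z) with hk
  have hkd : ∀ w : 𝔻, DiffContOnCl ℂ (k w) (ball 0 1) := by
    intro w
    have : DifferentiableOn ℂ (k w) (closedBall 0 1) := by
      intro z hz
      have hne : 1 - conj (w : ℂ) * z ≠ 0 :=
        one_sub_conj_mul_ne_zero w.norm_lt_one (by simpa using hz)
      simp only [hk]
      have h1 : DifferentiableAt ℂ (fun z : ℂ => 1 - conj (w : ℂ) * z) z := by fun_prop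
      exact (DifferentiableAt.fun_div (differentiableAt_const _) h1 hne).differentiableWithinAt
    exact DifferentiableOn.diffContOnCl (by rwa [closure_ball _ one_ne_zero])
  set h : ℂ → ℂ := fun z => ∑ w ∈ s, c w * k w z with hh
  set g : ℂ → ℂ := fun z => ∑ w ∈ s, conj (b w) * c w * k w z with hg
  have hsum : ∀ d : 𝔻 → ℂ, DiffContOnCl ℂ (fun z => ∑ w ∈ s, d w * k w z) (ball 0 1) := by
    intro d
    constructor
    · exact DifferentiableOn.fun_sum fun w _ => (hkd w).1.const_mul _
    · exact continuousOn_finsetSum _ fun w _ => (hkd w).2.const_mul _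
  have hhd : DiffContOnCl ℂ h (ball 0 1) := hsum c
  have hgd : DiffContOnCl ℂ g (ball 0 1) := hsum fun w => conj (b w) * c w
  have hbgd : DiffContOnCl ℂ (fun z => b z * g z) (ball 0 1) :=
    ⟨hb.1.mul hgd.1, hb.2.mul hgd.2⟩
  have hsph : sphere (0 : ℂ) |1| ⊆ closure (ball (0 : ℂ) 1) := by
    rw [closure_ball _ one_ne_zero]; simpa using sphere_subset_closedBall
  have hci : ∀ F : ℂ → ℂ, ContinuousOn F (closure (ball (0 : ℂ) 1)) → CircleIntegrable F 0 1 := by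
    intro F hF
    exact ContinuousOn.circleIntegrable' (hF.mono hsph)
  have hpair : ∀ (F : ℂ → ℂ) (d : 𝔻 → ℂ), DiffContOnCl ℂ F (ball 0 1) →
      Real.circleAverage (fun z => F z * conj (∑ w ∈ s, d w * k w z)) 0 1
        = ∑ w ∈ s, conj (d w) * F w := by
    intro F d hF
    have e : (fun z => F z * conj (∑ w ∈ s, d w * k w z))
        = fun z => ∑ w ∈ s, conj (d w) • (F z * conj (k w z)) := by
      funext z
      rw [map_sum, Finset.mul_sum]
      refine Finset.sum_congr rfl fun w _ => ?_
      simp only [map_mul, smul_eq_mul]; ring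
    rw [e, Real.circleAverage_fun_sum]
    · refine Finset.sum_congr rfl fun w _ => ?_
      rw [Real.circleAverage_fun_smul, circleAverage_mul_szego hF w.norm_lt_one, smul_eq_mul]
    · intro w _
      apply hci
      exact (hF.2.mul (Complex.continuous_conj.comp_continuousOn (hkd w).2)).fun_const_smul _
  have A1 := hpair h c hhd
  have A2 := hpair g (fun w => conj (b w) * c w) hgd
  have A3 := hpair (fun z => b z * g z) c hbgd
  have cc : ∀ {F G : ℂ → ℂ}, ContinuousOn F (closure (ball (0 : ℂ) 1)) →
      ContinuousOn G (closure (ball (0 : ℂ) 1)) →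
      ContinuousOn (fun z => F z * conj (G z)) (closure (ball (0 : ℂ) 1)) := fun hF hG =>
    hF.mul (Complex.continuous_conj.comp_continuousOn hG)
  have I1 := hci _ (cc hhd.2 hhd.2)
  have I2 := hci _ (cc hgd.2 hgd.2)
  have I3 := hci _ (cc hbgd.2 hhd.2)
  set Φ : ℂ → ℂ := fun z => h z * conj (h z) + g z * conj (g z)
    - (2 : ℂ) • (b z * g z * conj (h z)) with hΦ
  have IΦ : CircleIntegrable Φ 0 1 := hci _ (((cc hhd.2 hhd.2).add (cc hgd.2 hgd.2)).sub
    ((cc hbgd.2 hhd.2).fun_const_smul _))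
  have key : Real.circleAverage Φ 0 1
      = ∑ w ∈ s, ∑ z ∈ s, kernelFun b w z * c w * conj (c z) := by
    rw [hΦ, Real.circleAverage_fun_sub (hci _ ((cc hhd.2 hhd.2).fun_add (cc hgd.2 hgd.2)))
      (hci _ ((cc hbgd.2 hhd.2).fun_const_smul _)),
      Real.circleAverage_fun_add I1 I2, Real.circleAverage_fun_smul]
    rw [A1, A2, A3, Finset.sum_comm, smul_eq_mul, Finset.mul_sum, ← Finset.sum_add_distrib,
      ← Finset.sum_sub_distrib]
    refine Finset.sum_congr rfl fun z _ => ?_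
    simp only [map_mul, Complex.conj_conj, hh, hg, Finset.mul_sum]
    rw [← Finset.sum_add_distrib, ← Finset.sum_sub_distrib]
    refine Finset.sum_congr rfl fun w _ => ?_
    simp only [kernelFun, hk]
    ring
  rw [← key]
  have hre : (Real.circleAverage Φ 0 1).re = Real.circleAverage (fun z => (Φ z).re) 0 1 :=
    (Complex.reCLM.circleAverage_comp_comm IΦ).symm
  rw [hre]
  apply Real.circleAverage_nonneg_of_nonneg
  intro z hz
  have hz1 : ‖z‖ ≤ 1 := by simpa using (sphere_subset_closedBall hz)
  have hbz := hb1 z hz1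
  have hbz2 : normSq (b z) ≤ 1 := by
    rw [Complex.normSq_eq_norm_sq]; nlinarith [norm_nonneg (b z)]
  have e : (Φ z).re = normSq (h z - b z * g z) + (1 - normSq (b z)) * normSq (g z) := by
    rw [Complex.normSq_sub, Complex.normSq_mul]
    simp only [hΦ, Complex.sub_re, Complex.add_re, Complex.mul_conj, Complex.ofReal_re,
      smul_eq_mul]
    have : ((2 : ℂ) * (b z * g z * conj (h z))).re
        = 2 * (h z * conj (b z * g z)).re := by
      simp [Complex.mul_re, Complex.mul_im]; ring
    rw [this]; ring
  show 0 ≤ (Φ z).re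
  rw [e]
  have := normSq_nonneg (h z - b z * g z)
  have := normSq_nonneg (g z)
  nlinarith [mul_nonneg (sub_nonneg.mpr hbz2) this]

theorem kernel_form_nonneg (b : SchurFunction) (s : Finset 𝔻) (c : 𝔻 → ℂ) :
    0 ≤ (∑ w ∈ s, ∑ z ∈ s, kernelFun b w z * c w * conj (c z)).re := by
  have hmaps : ∀ {t : ℝ}, 0 < t → t < 1 → ∀ z : ℂ, ‖z‖ ≤ 1 → (t : ℂ) * z ∈ ball (0 : ℂ) 1 := by
    intro t h0 h1 z hz
    rw [mem_ball_zero_iff, norm_mul, Complex.norm_real, Real.norm_of_nonneg h0.le]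
    nlinarith [norm_nonneg z]
  have hpos : ∀ t : ℝ, 0 < t → t < 1 →
      0 ≤ (∑ w ∈ s, ∑ z ∈ s,
        kernelFun (fun x => b ((t : ℂ) * x)) w z * c w * conj (c z)).re := by
    intro t h0 h1
    apply kernel_form_nonneg_aux
    · apply DifferentiableOn.diffContOnCl
      rw [closure_ball _ one_ne_zero]
      exact b.differentiableOn.comp (by fun_prop) fun z hz => hmaps h0 h1 z (by simpa using hz)
    · exact fun z hz => b.norm_le_one _ (hmaps h0 h1 z hz)
  have hlimb : ∀ z : 𝔻, Tendsto (fun t : ℝ => b ((t : ℂ) * z)) (𝓝[<] 1) (𝓝 (b z)) := by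
    intro z
    have hc : ContinuousAt b.toFun (z : ℂ) :=
      (b.differentiableOn.differentiableAt (isOpen_ball.mem_nhds
        (mem_ball_zero_iff.2 z.norm_lt_one))).continuousAt
    have h1 : Tendsto (fun t : ℝ => (t : ℂ) * (z : ℂ)) (𝓝 1) (𝓝 (z : ℂ)) := by
      have : Continuous fun t : ℝ => (t : ℂ) * (z : ℂ) := by fun_prop
      simpa using this.tendsto 1
    exact hc.tendsto.comp (h1.mono_left nhdsWithin_le_nhds)
  have hlim : Tendsto (fun t : ℝ => (∑ w ∈ s, ∑ z ∈ s,
        kernelFun (fun x => b ((t : ℂ) * x)) w z * c w * conj (c z)).re) (𝓝[<] 1)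
      (𝓝 (∑ w ∈ s, ∑ z ∈ s, kernelFun b w z * c w * conj (c z)).re) := by
    refine (Complex.continuous_re.tendsto _).comp ?_
    refine tendsto_finsetSum _ fun w _ => tendsto_finsetSum _ fun z _ => ?_
    refine Tendsto.mul_const _ (Tendsto.mul_const _ ?_)
    unfold kernelFun
    refine Tendsto.div_const (Tendsto.const_sub _ (Tendsto.mul ?_ (hlimb z))) _
    exact (Complex.continuous_conj.tendsto _).comp (hlimb w)
  refine ge_of_tendsto hlim ?_
  have h0 : ∀ᶠ t : ℝ in 𝓝[<] 1, 0 < t :=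
    nhdsWithin_le_nhds (lt_mem_nhds one_pos)
  filter_upwards [h0, self_mem_nhdsWithin] with t h0 h1 using hpos t h0 h1

theorem kernelMatrix_posSemidef (b : SchurFunction) : (kernelMatrix b).PosSemidef := by
  have htfae := (RKHS.posSemidef_tfae (K := kernelMatrix b)).out 0 2
  rw [htfae]
  refine ⟨?_, fun v => ?_⟩
  · ext z w
    have hadj : ∀ x : ℂ, ContinuousLinearMap.adjoint (x • ContinuousLinearMap.id ℂ ℂ)
        = conj x • ContinuousLinearMap.id ℂ ℂ := by
      intro x
      rw [map_smulₛₗ, ContinuousLinearMap.adjoint_id]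
    simp only [Matrix.conjTranspose_apply, ContinuousLinearMap.star_eq_adjoint, kernelMatrix,
      Matrix.of_apply, hadj]
    simp [kernelFun, mul_comm]
  · have h := kernel_form_nonneg b v.support v
    have e : (v.sum fun x w => v.sum fun x' w' => ⟪kernelMatrix b x' x w, w'⟫_ℂ)
        = conj (∑ w ∈ v.support, ∑ z ∈ v.support, kernelFun b w z * v w * conj (v z)) := by
      simp only [Finsupp.sum, map_sum]
      refine Finset.sum_congr rfl fun w _ => Finset.sum_congr rfl fun z _ => ?_
      simp [kernelMatrix]
      ring
    rw [e, RCLike.conj_re]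
    exact h

instance (b : SchurFunction) : Fact (kernelMatrix b).PosSemidef := ⟨kernelMatrix_posSemidef b⟩

/-- The de Branges–Rovnyak space `H(b)`: the reproducing kernel Hilbert space of functions on the
unit disc with kernel `k^b`. -/
abbrev Space (b : SchurFunction) : Type := RKHS.OfKernel (kernelMatrix b)

/-- `H(b)` as a vector space of functions on the unit disc. -/
def spaceFunctions (b : SchurFunction) : Submodule ℂ (𝔻 → ℂ) :=
  (RKHS.coeCLM ℂ : Space b →L[ℂ] 𝔻 → ℂ).range

/-- The subspace of `H(b)` consisting of those elements that, as functions, belong to `M`. -/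
def subspaceOf (b : SchurFunction) (M : Submodule ℂ (𝔻 → ℂ)) : Submodule ℂ (Space b) :=
  M.comap (RKHS.coeCLM ℂ : Space b →L[ℂ] 𝔻 → ℂ).toLinearMap

/-! ### The Hardy space `H²` -/

/-- `F` is analytic on the unit disc with bounded quadratic means over the circles `|z| = ρ < 1`. -/
def IsHardyTwo (F : ℂ → ℂ) : Prop :=
  DifferentiableOn ℂ F (ball 0 1) ∧
    ∃ C : ℝ, ∀ ρ : ℝ, 0 ≤ ρ → ρ < 1 → Real.circleAverage (fun z => ‖F z‖ ^ 2) 0 ρ ≤ C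

theorem circleIntegrable_norm_sq {F : ℂ → ℂ} (hF : DifferentiableOn ℂ F (ball 0 1)) {ρ : ℝ}
    (h0 : 0 ≤ ρ) (h1 : ρ < 1) : CircleIntegrable (fun z => ‖F z‖ ^ 2) 0 ρ := by
  apply ContinuousOn.circleIntegrable h0
  refine ((hF.continuousOn.mono ?_).norm).pow 2
  intro z hz
  have : ‖z‖ = ρ := by simpa using hz
  rw [mem_ball_zero_iff]; linarith

theorem IsHardyTwo.add {F G : ℂ → ℂ} (hF : IsHardyTwo F) (hG : IsHardyTwo G) :
    IsHardyTwo (fun z => F z + G z) := by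
  obtain ⟨hF, C, hC⟩ := hF
  obtain ⟨hG, D, hD⟩ := hG
  refine ⟨hF.add hG, 2 * C + 2 * D, fun ρ h0 h1 => ?_⟩
  have iF : CircleIntegrable (fun z => (2 : ℝ) • ‖F z‖ ^ 2) 0 ρ :=
    (circleIntegrable_norm_sq hF h0 h1).const_smul
  have iG : CircleIntegrable (fun z => (2 : ℝ) • ‖G z‖ ^ 2) 0 ρ :=
    (circleIntegrable_norm_sq hG h0 h1).const_smul
  have hle : Real.circleAverage (fun z => ‖F z + G z‖ ^ 2) 0 ρ
      ≤ Real.circleAverage (fun z => (2 : ℝ) • ‖F z‖ ^ 2 + (2 : ℝ) • ‖G z‖ ^ 2) 0 ρ := by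
    apply Real.circleAverage_mono (circleIntegrable_norm_sq (hF.add hG) h0 h1)
    · exact iF.add iG
    · intro z _
      simp only [smul_eq_mul, Pi.add_apply]
      have := norm_add_le (F z) (G z)
      nlinarith [norm_nonneg (F z + G z), sq_nonneg (‖F z‖ - ‖G z‖), norm_nonneg (F z),
        norm_nonneg (G z)]
  rw [Real.circleAverage_fun_add iF iG, Real.circleAverage_fun_smul, Real.circleAverage_fun_smul] at hle
  have := hC ρ h0 h1
  have := hD ρ h0 h1
  simp only [smul_eq_mul] at hle
  linarith

theorem IsHardyTwo.const_mul {F : ℂ → ℂ} (c : ℂ) (hF : IsHardyTwo F) :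
    IsHardyTwo (fun z => c * F z) := by
  obtain ⟨hF, C, hC⟩ := hF
  refine ⟨hF.const_mul c, ‖c‖ ^ 2 * C, fun ρ h0 h1 => ?_⟩
  have e : (fun z => ‖c * F z‖ ^ 2) = fun z => (‖c‖ ^ 2) • ‖F z‖ ^ 2 := by
    funext z; rw [norm_mul, mul_pow, smul_eq_mul]
  rw [e, Real.circleAverage_fun_smul, smul_eq_mul]
  exact mul_le_mul_of_nonneg_left (hC ρ h0 h1) (by positivity)

/-- The Hardy space `H²`, as a vector space of functions on the unit disc. -/
def hardyTwo : Submodule ℂ (𝔻 → ℂ) where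
  carrier := {f | ∃ F : ℂ → ℂ, IsHardyTwo F ∧ ∀ z : 𝔻, f z = F z}
  add_mem' := by
    rintro f g ⟨F, hF, hf⟩ ⟨G, hG, hg⟩
    exact ⟨_, hF.add hG, fun z => by simp [hf, hg]⟩
  zero_mem' := ⟨0, ⟨differentiableOn_const 0, 0, fun ρ _ _ => by simp [Real.circleAverage_const]⟩,
    fun _ => rfl⟩
  smul_mem' := by
    rintro c f ⟨F, hF, hf⟩
    exact ⟨_, hF.const_mul c, fun z => by simp [hf]⟩

/-- The vector space `φ H²` of functions on the unit disc. -/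
def mulHardyTwo (φ : ℂ → ℂ) : Submodule ℂ (𝔻 → ℂ) :=
  hardyTwo.map (LinearMap.mulLeft ℂ fun z : 𝔻 => φ z)

/-! ### Rational and outer functions, Pythagorean mates -/

/-- `f` agrees on the unit disc with a rational function without poles there. -/
def IsRational (f : ℂ → ℂ) : Prop :=
  ∃ P Q : Polynomial ℂ, ∀ z ∈ ball (0 : ℂ) 1, Q.eval z ≠ 0 ∧ f z = P.eval z / Q.eval z

/-- `f(z) = c exp (∫ (ζ + z) / (ζ - z) u(ζ) dm(ζ))` on the unit disc, with `|c| = 1` and `u` real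
and integrable on the unit circle. -/
def IsOuter (f : ℂ → ℂ) : Prop :=
  ∃ (c : ℂ) (u : ℂ → ℝ), ‖c‖ = 1 ∧ CircleIntegrable u 0 1 ∧
    ∀ z ∈ ball (0 : ℂ) 1,
      f z = c * exp (Real.circleAverage (fun ζ => (ζ + z) / (ζ - z) * (u ζ : ℂ)) 0 1)

/-- `a` is outer, `a(0) > 0`, and `|a|² + |b|² = 1` almost everywhere on the unit circle in the
sense of radial boundary values. -/
def IsPythagoreanMate (a b : SchurFunction) : Prop :=
  IsOuter a ∧ (0 < (a 0).re ∧ (a 0).im = 0) ∧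
    ∀ᵐ t : ℝ, ∃ α β : ℂ,
      Tendsto (fun ρ : ℝ => a (circleMap 0 ρ t)) (𝓝[<] 1) (𝓝 α) ∧
      Tendsto (fun ρ : ℝ => b (circleMap 0 ρ t)) (𝓝[<] 1) (𝓝 β) ∧
      ‖α‖ ^ 2 + ‖β‖ ^ 2 = 1

/-! ### Powers -/

/-- An analytic logarithm of `q` on the unit disc. -/
structure LogBranch (q : SchurFunction) where
  toFun : ℂ → ℂ
  differentiableOn : DifferentiableOn ℂ toFun (ball 0 1)
  exp_eq : ∀ z ∈ ball (0 : ℂ) 1, exp (toFun z) = q z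

/-- The power `q^r = exp (r log q)` for a given analytic logarithm of `q`. -/
def SchurFunction.power (q : SchurFunction) (L : LogBranch q) (r : ℝ) (hr : 0 < r) :
    SchurFunction where
  toFun z := exp (r * L.toFun z)
  differentiableOn := (L.differentiableOn.const_mul (r : ℂ)).cexp
  norm_le_one z hz := by
    have h := q.norm_le_one z hz
    rw [← L.exp_eq z hz, Complex.norm_exp, Real.exp_le_one_iff] at h
    rw [Complex.norm_exp, Real.exp_le_one_iff, Complex.re_ofReal_mul]
    exact mul_nonpos_of_nonneg_of_nonpos hr.le h

/-- A nonvanishing `q` has an analytic logarithm. -/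
theorem nonempty_logBranch (q : SchurFunction) (hq : ∀ z ∈ ball (0 : ℂ) 1, q z ≠ 0) :
    Nonempty (LogBranch q) := by
  have hqd : ∀ z ∈ ball (0 : ℂ) 1, DifferentiableAt ℂ q.toFun z := fun z hz =>
    q.differentiableOn.differentiableAt (isOpen_ball.mem_nhds hz)
  have hd : DifferentiableOn ℂ (fun z => deriv q.toFun z / q z) (ball 0 1) :=
    (q.differentiableOn.deriv isOpen_ball).fun_div q.differentiableOn hq
  have h0 : (0 : ℂ) ∈ ball (0 : ℂ) 1 := by simp
  obtain ⟨P, hP0, hP⟩ := hd.isExactOn_ball.with_val_at 0 (log (q 0))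
  have hconst : ∀ z ∈ ball (0 : ℂ) 1, q z * exp (-P z) = q 0 * exp (-P 0) := by
    intro z hz
    have hder : ∀ w ∈ ball (0 : ℂ) 1, HasDerivAt (fun w => q w * exp (-P w)) 0 w := by
      intro w hw
      have h := (hqd w hw).hasDerivAt.fun_mul (hP w hw).fun_neg.cexp
      convert! h using 1
      have := hq w hw
      field_simp
      ring
    exact (convex_ball (0 : ℂ) 1).is_const_of_fderivWithin_eq_zero (𝕜 := ℂ)
      (f := fun w => q w * exp (-P w))
      (fun w hw => (hder w hw).differentiableAt.differentiableWithinAt)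
      (fun w hw => by
        rw [fderivWithin_of_isOpen isOpen_ball hw, (hder w hw).hasFDerivAt.fderiv]
        ext; simp) hz h0
  refine ⟨⟨P, fun z hz => (hP z hz).differentiableAt.differentiableWithinAt, fun z hz => ?_⟩⟩
  have h := hconst z hz
  have h2 : q 0 * exp (-P 0) = 1 := by
    rw [hP0, Complex.exp_neg, Complex.exp_log (hq 0 h0), mul_inv_cancel₀ (hq 0 h0)]
  rw [h2, Complex.exp_neg] at h
  field_simp at h
  exact h.symm

/-! ### Boundary behaviour -/

/-- `F` continues `f` analytically from the unit disc to a neighbourhood of `ζ`. -/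
def IsAnalyticExtensionAt (f : ℂ → ℂ) (ζ : ℂ) (F : ℂ → ℂ) : Prop :=
  AnalyticAt ℂ F ζ ∧ ∀ᶠ z in 𝓝[ball (0 : ℂ) 1] ζ, F z = f z

/-- `ζ` is a zero of (the analytic continuation of) `f` of multiplicity `k`. -/
def HasZeroOfMultiplicity (f : ℂ → ℂ) (ζ : ℂ) (k : ℕ) : Prop :=
  0 < k ∧ ∃ F, IsAnalyticExtensionAt f ζ F ∧ analyticOrderAt F ζ = k

/-- `ζ 1, …, ζ n` are the distinct zeros of `f` on the unit circle, with multiplicities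
`m 1, …, m n`. -/
def IsCircleZeros (f : ℂ → ℂ) {n : ℕ} (ζ : Fin n → ℂ) (m : Fin n → ℕ) : Prop :=
  Function.Injective ζ ∧ (∀ j, ‖ζ j‖ = 1) ∧ (∀ j, HasZeroOfMultiplicity f (ζ j) (m j)) ∧
    ∀ η : ℂ, ‖η‖ = 1 → ∀ k, HasZeroOfMultiplicity f η k → ∃ j, ζ j = η

/-- `v` is the derivative kernel `z ↦ (d/d(conj w))^ℓ k^b_w(z)` at `w = ζ`, where `ζ` lies in the
closed unit disc and `b` continues analytically to a neighbourhood of `ζ`. The variable `x` below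
stands for `conj w`. -/
def IsKernelDeriv (b : ℂ → ℂ) (ℓ : ℕ) (ζ : ℂ) (v : 𝔻 → ℂ) : Prop :=
  ∃ B : ℂ → ℂ, IsAnalyticExtensionAt b ζ B ∧ ∀ z : 𝔻,
    v z = iteratedDeriv ℓ (fun x : ℂ => (1 - conj (B (conj x)) * b z) / (1 - x * z)) (conj ζ)

end DBR

end

open DBR

/-!
The Fejér–Riesz theorem factors `1 - |q|²` on the circle as `|p e ^ g|²`, with `p` monic having its
roots `η` on the circle and `g` analytic on the closed disc; as `1 - x ^ r` is comparable to `1 - x`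
on `[0, 1]`, also `1 - |q ^ r|²` is comparable to `|p|²`. Let `h` be a linear combination of Szegő
kernels and `k` the combination of the kernels of `b = q ^ r` with the same coefficients. The norm
of `k` in `H(b)` is comparable to the `L²` norm of `p h`: the lower bound uses `1 - |b|² ≥ c |p|²`,
the upper bound also an analytic polynomial `κ` with `|conj b - κ| ≤ C |p|` on the circle. By
duality `H(b)` is the set of Cauchy transforms of `conj p ψ` for `ψ` in `L²`. This set depends only
on the weight `p`, so it is the same for `q ^ r` and `q`, and dividing by one factor `z - η` at a
time identifies it with `p H² + {polynomials of degree < deg p}`.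

The values at the roots of `p`, with derivatives up to the multiplicity, of the polynomial part are
bounded functionals on `H(b)`. They vanish jointly exactly on `p H²`, and since a function of `p H²`
is too small near a root to affect boundary derivatives, the vectors representing them are the
derivative kernels. Finally, a mate `a` of `q` has the same boundary modulus as `p e ^ g`; both are
outer, so the two differ by a constant factor and `a H² = p H²`.
-/

noncomputable section

namespace DBR

theorem exists_inner_eq_of_norm_le {V E : Type*} [AddCommGroup V] [Module ℂ V]
    [NormedAddCommGroup E] [InnerProductSpace ℂ E] [CompleteSpace E] (T : V →ₗ[ℂ] E)
    (φ : V →ₗ[ℂ] ℂ) {C : ℝ} (hC : 0 ≤ C) (h : ∀ x, ‖φ x‖ ≤ C * ‖T x‖) :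
    ∃ y : E, ‖y‖ ≤ C ∧ ∀ x, ⟪y, T x⟫_ℂ = φ x := by
  obtain ⟨g, hg⟩ := T.rangeRestrict.exists_rightInverse_of_surjective T.range_rangeRestrict
  have hTg (y : T.range) : T (g y) = y := congrArg Subtype.val (LinearMap.congr_fun hg y)
  have hφg (x : V) : φ (g (T.rangeRestrict x)) = φ x := by
    have hle := h (g (T.rangeRestrict x) - x)
    have hT : T (g (T.rangeRestrict x) - x) = 0 := by
      rw [map_sub, hTg]; exact sub_self _
    rw [hT, norm_zero, mul_zero, map_sub] at hle
    exact sub_eq_zero.1 (norm_le_zero_iff.1 hle)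
  let ψ : T.range →L[ℂ] ℂ := (φ ∘ₗ g).mkContinuous C fun y => (h (g y)).trans_eq (by rw [hTg]; rfl)
  obtain ⟨f, hf, hfn⟩ := exists_extension_norm_eq _ ψ
  refine ⟨(InnerProductSpace.toDual ℂ E).symm f, ?_, fun x => ?_⟩
  · rw [LinearIsometryEquiv.norm_map, hfn]
    exact LinearMap.mkContinuous_norm_le _ hC _
  · rw [InnerProductSpace.toDual_symm_apply, ← hφg]
    exact hf (T.rangeRestrict x)

theorem exists_inner_eq_of_norm_sum_le {ι E : Type*} [NormedAddCommGroup E]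
    [InnerProductSpace ℂ E] [CompleteSpace E] (e : ι → E) (f : ι → ℂ) {C : ℝ} (hC : 0 ≤ C)
    (h : ∀ c : ι →₀ ℂ,
      ‖c.sum fun i a => conj a * f i‖ ≤ C * ‖Finsupp.linearCombination ℂ e c‖) :
    ∃ y : E, ‖y‖ ≤ C ∧ ∀ i, ⟪e i, y⟫_ℂ = f i := by
  obtain ⟨y, hy, hye⟩ := exists_inner_eq_of_norm_le (Finsupp.linearCombination ℂ e)
    (Finsupp.linearCombination ℂ fun i => conj (f i)) hC fun c => by
      refine le_of_eq_of_le ?_ (h c)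
      rw [← RCLike.norm_conj, Finsupp.linearCombination_apply, Finsupp.sum, Finsupp.sum, map_sum]
      simp
  refine ⟨y, hy, fun i => ?_⟩
  simpa using congrArg conj (hye (Finsupp.single i 1))

instance fact_two_pi_pos : Fact (0 < 2 * Real.pi) := ⟨Real.two_pi_pos⟩

/-- The algebra of continuous functions on the unit circle `ℝ / 2πℤ`. -/
abbrev CircleFun := C(AddCircle (2 * Real.pi), ℂ)

/-- The `L²` space of the unit circle. -/
abbrev CircleL2 := MeasureTheory.Lp ℂ 2 (AddCircle.haarAddCircle (T := 2 * Real.pi))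

/-- The class of a continuous function in the `L²` space of the unit circle. -/
abbrev toL2 : CircleFun →L[ℂ] CircleL2 :=
  ContinuousMap.toLp 2 AddCircle.haarAddCircle ℂ

theorem norm_toL2_sq (F : CircleFun) :
    ‖toL2 F‖ ^ 2 = ∫ θ, ‖F θ‖ ^ 2 ∂AddCircle.haarAddCircle := by
  have h := MeasureTheory.ContinuousMap.inner_toLp (𝕜 := ℂ)
    (AddCircle.haarAddCircle (T := 2 * Real.pi)) F F
  simp only [inner_self_eq_norm_sq_to_K, Complex.mul_conj'] at h
  simp only [← Complex.ofReal_pow, ← RCLike.ofReal_pow, integral_complex_ofReal] at h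
  exact Complex.ofReal_injective h

theorem integrable_norm_sq (F : CircleFun) :
    MeasureTheory.Integrable (fun θ => ‖F θ‖ ^ 2) AddCircle.haarAddCircle :=
  Continuous.integrable_of_hasCompactSupport (by fun_prop) (HasCompactSupport.of_compactSpace _)

theorem norm_toL2_sq_le_add {F G H : CircleFun} {C D : ℝ}
    (h : ∀ θ, ‖F θ‖ ^ 2 ≤ C * ‖G θ‖ ^ 2 + D * ‖H θ‖ ^ 2) :
    ‖toL2 F‖ ^ 2 ≤ C * ‖toL2 G‖ ^ 2 + D * ‖toL2 H‖ ^ 2 := by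
  simp only [norm_toL2_sq, ← MeasureTheory.integral_const_mul]
  rw [← MeasureTheory.integral_add ((integrable_norm_sq G).const_mul C)
    ((integrable_norm_sq H).const_mul D)]
  exact MeasureTheory.integral_mono (integrable_norm_sq F)
    (((integrable_norm_sq G).const_mul C).add ((integrable_norm_sq H).const_mul D)) h

theorem norm_toL2_le_mul {F G : CircleFun} {C : ℝ} (hC : 0 ≤ C) (h : ∀ θ, ‖F θ‖ ≤ C * ‖G θ‖) :
    ‖toL2 F‖ ≤ C * ‖toL2 G‖ := by
  refine (sq_le_sq₀ (norm_nonneg _) (by positivity)).1 ?_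
  have := norm_toL2_sq_le_add (F := F) (G := G) (H := 0) (C := C ^ 2) (D := 0) fun θ => by
    simpa [mul_pow] using pow_le_pow_left₀ (norm_nonneg _) (h θ) 2
  simpa [mul_pow] using this

theorem inner_toL2_mul_right (F G H : CircleFun) :
    ⟪toL2 F, toL2 (G * H)⟫_ℂ = ⟪toL2 (star G * F), toL2 H⟫_ℂ := by
  simp only [MeasureTheory.ContinuousMap.inner_toLp]
  exact MeasureTheory.integral_congr_ae (.of_forall fun θ => by simp; ring)

theorem norm_toL2_star_mul (F G : CircleFun) : ‖toL2 (star F * G)‖ = ‖toL2 (F * G)‖ := by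
  refine (sq_eq_sq₀ (norm_nonneg _) (norm_nonneg _)).1 ?_
  simp [norm_toL2_sq]

/-- The disc algebra: functions analytic in the open unit disc and continuous on its closure. Only
the values on the closed disc matter. -/
def discAlgebra : Subalgebra ℂ (ℂ → ℂ) where
  carrier := {F | DiffContOnCl ℂ F (ball 0 1)}
  mul_mem' hF hG := ⟨hF.1.mul hG.1, hF.2.mul hG.2⟩
  add_mem' hF hG := hF.add hG
  algebraMap_mem' _ := diffContOnCl_const

theorem continuousOn_closedBall (F : discAlgebra) : ContinuousOn F.1 (closedBall 0 1) := by
  have h : ContinuousOn F.1 (closure (ball 0 1)) := F.2.2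
  rwa [closure_ball _ one_ne_zero] at h

theorem mem_discAlgebra_of_differentiableOn {F : ℂ → ℂ}
    (hF : DifferentiableOn ℂ F (closedBall 0 1)) : F ∈ discAlgebra :=
  DifferentiableOn.diffContOnCl (by rwa [closure_ball _ one_ne_zero])

/-- The boundary values of a function of the disc algebra. -/
def boundary : discAlgebra →ₐ[ℂ] CircleFun where
  toFun F := ⟨fun θ => F.1 θ.toCircle,
    (continuousOn_closedBall F).comp_continuous (by fun_prop) fun θ =>
      mem_closedBall_zero_iff.2 (Circle.norm_coe _).le⟩
  map_one' := rfl
  map_mul' _ _ := rfl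
  map_zero' := rfl
  map_add' _ _ := rfl
  commutes' _ := rfl

theorem boundary_apply (F : discAlgebra) (θ : AddCircle (2 * Real.pi)) :
    boundary F θ = F.1 θ.toCircle := rfl

theorem integral_toCircle {E : Type*} [NormedAddCommGroup E] [NormedSpace ℝ E] (f : ℂ → E) :
    ∫ θ : AddCircle (2 * Real.pi), f θ.toCircle ∂AddCircle.haarAddCircle
      = Real.circleAverage f 0 1 := by
  rw [AddCircle.integral_haarAddCircle, Real.circleAverage,
    ← AddCircle.intervalIntegral_preimage (2 * Real.pi) 0]
  simp [AddCircle.toCircle, circleMap]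

theorem norm_toL2_boundary_sq (F : discAlgebra) :
    ‖toL2 (boundary F)‖ ^ 2 = Real.circleAverage (fun z => ‖F.1 z‖ ^ 2) 0 1 :=
  (norm_toL2_sq _).trans (integral_toCircle fun z => ‖F.1 z‖ ^ 2)

/-- The Szegő kernel of the unit disc at `w`. -/
def szego (w : 𝔻) : discAlgebra := ⟨fun z => 1 / (1 - conj (w : ℂ) * z),
  mem_discAlgebra_of_differentiableOn fun z hz => by
    have hne := one_sub_conj_mul_ne_zero w.norm_lt_one (mem_closedBall_zero_iff.1 hz)
    have hd : DifferentiableAt ℂ (fun z : ℂ => 1 - conj (w : ℂ) * z) z := by fun_prop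
    exact ((differentiableAt_const (1 : ℂ)).fun_div hd hne).differentiableWithinAt⟩

theorem inner_szego (w : 𝔻) (F : discAlgebra) :
    ⟪toL2 (boundary (szego w)), toL2 (boundary F)⟫_ℂ = F.1 w := by
  rw [MeasureTheory.ContinuousMap.inner_toLp, ← circleAverage_mul_szego F.2 w.norm_lt_one,
    ← integral_toCircle]
  rfl

theorem szego_eq (w : 𝔻) {z : ℂ} (hz : ‖z‖ ≤ 1) :
    (szego w).1 z = 1 + conj (w : ℂ) * z * (szego w).1 z := by
  have := one_sub_conj_mul_ne_zero w.norm_lt_one hz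
  simp only [szego]
  field_simp
  ring

/-- The linear combination of Szegő kernels with coefficients `c`. -/
def szegoSum : (𝔻 →₀ ℂ) →ₗ[ℂ] discAlgebra := Finsupp.linearCombination ℂ szego

theorem inner_toL2_mul_szegoSum (G : CircleFun) (c : 𝔻 →₀ ℂ) (ψ : CircleL2) :
    ⟪toL2 (G * boundary (szegoSum c)), ψ⟫_ℂ
      = c.sum fun w a => conj a * ⟪toL2 (G * boundary (szego w)), ψ⟫_ℂ := by
  simp [szegoSum, Finsupp.linearCombination_apply, Finsupp.sum, Finset.mul_sum, sum_inner,
    inner_smul_left]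

theorem inner_szegoSum (c : 𝔻 →₀ ℂ) (F : discAlgebra) :
    ⟪toL2 (boundary (szegoSum c)), toL2 (boundary F)⟫_ℂ = c.sum fun w a => conj a * F.1 w := by
  simpa only [one_mul, inner_szego] using inner_toL2_mul_szegoSum 1 c (toL2 (boundary F))

/-- The kernel function of `H(b)` at `w`, as a vector of `H(b)`. -/
def kernelVec (b : SchurFunction) (w : 𝔻) : Space b := RKHS.kerFun (Space b) w 1

theorem kernelVec_apply (b : SchurFunction) (w z : 𝔻) : kernelVec b w z = kernelFun b w z := by
  rw [kernelVec, RKHS.kerFun_apply, RKHS.OfKernel.kernel_ofKernel]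
  simp [kernelMatrix]

theorem inner_kernelVec (b : SchurFunction) (w : 𝔻) (f : Space b) :
    ⟪kernelVec b w, f⟫_ℂ = f w := by
  rw [kernelVec, RKHS.kerFun_inner]
  simp

/-- The linear combination of kernel functions of `H(b)` with coefficients `c`. -/
def kernelSum (b : SchurFunction) : (𝔻 →₀ ℂ) →ₗ[ℂ] Space b :=
  Finsupp.linearCombination ℂ (kernelVec b)

/-- The image of `kernelSum b c` under `k_w^b ↦ conj (b w) k_w`, where `k_w` is the Szegő kernel. -/
def twistedSum (b : SchurFunction) : (𝔻 →₀ ℂ) →ₗ[ℂ] discAlgebra :=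
  Finsupp.linearCombination ℂ fun w => conj (b w) • szego w

theorem inner_twistedSum (b : SchurFunction) (c : 𝔻 →₀ ℂ) (F : discAlgebra) :
    ⟪toL2 (boundary (twistedSum b c)), toL2 (boundary F)⟫_ℂ
      = c.sum fun w a => conj a * (b w * F.1 w) := by
  simp only [twistedSum, Finsupp.linearCombination_apply, Finsupp.sum, map_sum, map_smul, sum_inner,
    inner_smul_left, inner_szego, Complex.conj_conj]

theorem inner_kernelVec_kernelVec (b : SchurFunction) (w z : 𝔻) :
    ⟪kernelVec b w, kernelVec b z⟫_ℂ
      = (szego z).1 w - b w * (conj (b z) * (szego z).1 w) := by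
  simp only [inner_kernelVec, kernelVec_apply, kernelFun, szego]
  ring

theorem norm_kernelSum_sq (b : SchurFunction) (c : 𝔻 →₀ ℂ) :
    ‖kernelSum b c‖ ^ 2
      = ‖toL2 (boundary (szegoSum c))‖ ^ 2 - ‖toL2 (boundary (twistedSum b c))‖ ^ 2 := by
  have h : ⟪kernelSum b c, kernelSum b c⟫_ℂ
      = ⟪toL2 (boundary (szegoSum c)), toL2 (boundary (szegoSum c))⟫_ℂ
        - ⟪toL2 (boundary (twistedSum b c)), toL2 (boundary (twistedSum b c))⟫_ℂ := by
    simp only [kernelSum, szegoSum, twistedSum, Finsupp.linearCombination_apply, Finsupp.sum,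
      map_sum, map_smul, sum_inner, inner_sum, inner_smul_left, inner_smul_right, inner_szego,
      inner_kernelVec_kernelVec, Finset.mul_sum, ← Finset.sum_sub_distrib, Complex.conj_conj]
    exact Finset.sum_congr rfl fun w _ => Finset.sum_congr rfl fun z _ => by ring
  simp only [inner_self_eq_norm_sq_to_K] at h
  exact_mod_cast h

/-- `B` extends `b` to a function of the disc algebra. -/
def IsDiscExtension (b : SchurFunction) (B : discAlgebra) : Prop := Set.EqOn B.1 b (ball 0 1)

namespace IsDiscExtension

variable {b : SchurFunction} {B : discAlgebra} (hB : IsDiscExtension b B)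
include hB

theorem norm_le_one {z : ℂ} (hz : ‖z‖ ≤ 1) : ‖B.1 z‖ ≤ 1 := by
  refine le_on_closure (f := fun z => ‖B.1 z‖) (g := fun _ => (1 : ℝ)) (s := ball 0 1)
    (fun w hw => ?_) B.2.2.norm continuousOn_const ?_
  · rw [hB hw]
    exact b.norm_le_one w hw
  · rwa [closure_ball _ one_ne_zero, mem_closedBall_zero_iff]

theorem norm_boundary_le_one (θ : AddCircle (2 * Real.pi)) : ‖boundary B θ‖ ≤ 1 :=
  hB.norm_le_one (Circle.norm_coe _).le

theorem inner_twistedSum_eq (c : 𝔻 →₀ ℂ) (F : discAlgebra) :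
    ⟪toL2 (boundary (twistedSum b c)), toL2 (boundary F)⟫_ℂ
      = ⟪toL2 (boundary (szegoSum c)), toL2 (boundary (B * F))⟫_ℂ := by
  rw [inner_twistedSum, inner_szegoSum]
  refine Finset.sum_congr rfl fun w _ => ?_
  beta_reduce
  rw [← hB (mem_ball_zero_iff.2 w.norm_lt_one)]
  rfl

theorem norm_kernelSum_sq_eq_norm_sub_sq (c : 𝔻 →₀ ℂ) :
    ‖kernelSum b c‖ ^ 2 = ‖toL2 (boundary (szegoSum c - B * twistedSum b c))‖ ^ 2
      + (‖toL2 (boundary (twistedSum b c))‖ ^ 2 - ‖toL2 (boundary (B * twistedSum b c))‖ ^ 2) := by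
  rw [norm_kernelSum_sq, map_sub, map_sub, norm_sub_sq (𝕜 := ℂ), ← hB.inner_twistedSum_eq,
    inner_self_eq_norm_sq]
  ring

theorem norm_kernelSum_sq_eq_norm_star_sub_sq (c : 𝔻 →₀ ℂ) :
    ‖kernelSum b c‖ ^ 2 =
      ‖toL2 (boundary (szegoSum c))‖ ^ 2 - ‖toL2 (boundary (B * szegoSum c))‖ ^ 2
      + ‖toL2 (star (boundary B) * boundary (szegoSum c) - boundary (twistedSum b c))‖ ^ 2 := by
  rw [norm_kernelSum_sq, map_sub, norm_sub_sq (𝕜 := ℂ), ← inner_toL2_mul_right, ← map_mul,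
    ← hB.inner_twistedSum_eq, inner_self_eq_norm_sq, norm_toL2_star_mul, map_mul]
  ring

theorem inner_star_mul_sub_twistedSum (c : 𝔻 →₀ ℂ) (F : discAlgebra) :
    ⟪toL2 (star (boundary B) * boundary (szegoSum c) - boundary (twistedSum b c)),
      toL2 (boundary F)⟫_ℂ = 0 := by
  rw [map_sub, inner_sub_left, ← inner_toL2_mul_right, hB.inner_twistedSum_eq,
    map_mul boundary, sub_self]

theorem norm_star_mul_sub_twistedSum_le (κ : discAlgebra) (c : 𝔻 →₀ ℂ) :
    ‖toL2 (star (boundary B) * boundary (szegoSum c) - boundary (twistedSum b c))‖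
      ≤ ‖toL2 ((star (boundary B) - boundary κ) * boundary (szegoSum c))‖ := by
  set u := toL2 (star (boundary B) * boundary (szegoSum c) - boundary (twistedSum b c))
  set v := toL2 (boundary (twistedSum b c - κ * szegoSum c))
  have huv : ⟪u, v⟫_ℂ = 0 := hB.inner_star_mul_sub_twistedSum c _
  have hadd : toL2 ((star (boundary B) - boundary κ) * boundary (szegoSum c)) = u + v := by
    rw [← map_add toL2, map_sub boundary, map_mul boundary]
    congr 1
    ring
  rw [hadd]
  refine (mul_self_le_mul_self_iff (norm_nonneg _) (norm_nonneg _)).2 ?_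
  rw [norm_add_sq_eq_norm_sq_add_norm_sq_of_inner_eq_zero u v huv]
  exact le_add_of_nonneg_right (mul_self_nonneg _)

theorem norm_mul_szegoSum_le {p : CircleFun} {C : ℝ} (hC : 0 ≤ C)
    (hp : ∀ θ, ‖p θ‖ ^ 2 ≤ C * (1 - ‖boundary B θ‖ ^ 2)) (c : 𝔻 →₀ ℂ) :
    ‖toL2 (p * boundary (szegoSum c))‖ ≤ (‖p‖ + √C) * ‖kernelSum b c‖ := by
  set h := szegoSum c
  set g := twistedSum b c
  have hk := hB.norm_kernelSum_sq_eq_norm_sub_sq c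
  have hBg : ‖toL2 (boundary (B * g))‖ ≤ ‖toL2 (boundary g)‖ := by
    refine (norm_toL2_le_mul zero_le_one fun θ => ?_).trans_eq (one_mul _)
    rw [map_mul, ContinuousMap.mul_apply, norm_mul]
    exact mul_le_mul_of_nonneg_right (hB.norm_boundary_le_one θ) (norm_nonneg _)
  have hsub : ‖toL2 (p * boundary (h - B * g))‖ ≤ ‖p‖ * ‖kernelSum b c‖ := by
    refine (norm_toL2_le_mul (G := boundary (h - B * g)) (norm_nonneg p) fun θ => ?_).trans
      (mul_le_mul_of_nonneg_left ?_ (norm_nonneg p))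
    · rw [ContinuousMap.mul_apply, norm_mul]
      exact mul_le_mul_of_nonneg_right (p.norm_coe_le_norm θ) (norm_nonneg _)
    · refine (sq_le_sq₀ (norm_nonneg _) (norm_nonneg _)).1 ?_
      linarith [pow_le_pow_left₀ (norm_nonneg _) hBg 2]
  have hpBg : ‖toL2 (p * boundary (B * g))‖ ≤ √C * ‖kernelSum b c‖ := by
    have hsq := norm_toL2_sq_le_add (F := p * boundary (B * g)) (G := boundary g)
      (H := boundary (B * g)) (C := C) (D := -C) fun θ => by
        have h1 := hp θ
        have h2 := hB.norm_boundary_le_one θ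
        simp only [map_mul, ContinuousMap.mul_apply, norm_mul, mul_pow]
        have h3 : ‖boundary B θ‖ ^ 2 ≤ 1 := pow_le_one₀ (norm_nonneg _) h2
        nlinarith [mul_nonneg (sq_nonneg ‖p θ‖) (sub_nonneg.2 h3), sq_nonneg ‖boundary g θ‖]
    refine (sq_le_sq₀ (norm_nonneg _) (by positivity)).1 ?_
    rw [mul_pow, Real.sq_sqrt hC]
    nlinarith [sq_nonneg ‖toL2 (boundary (h - B * g))‖]
  calc ‖toL2 (p * boundary h)‖
      = ‖toL2 (p * boundary (h - B * g)) + toL2 (p * boundary (B * g))‖ := by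
        rw [← map_add toL2, ← mul_add, ← map_add, sub_add_cancel]
    _ ≤ (‖p‖ + √C) * ‖kernelSum b c‖ := by
        rw [add_mul]; exact (norm_add_le _ _).trans (add_le_add hsub hpBg)

theorem norm_kernelSum_le {p : CircleFun} {κ : discAlgebra} {C D : ℝ}
    (hp : ∀ θ, 1 - ‖boundary B θ‖ ^ 2 ≤ C * ‖p θ‖ ^ 2) (hD : 0 ≤ D)
    (hκ : ∀ θ, ‖conj (boundary B θ) - boundary κ θ‖ ≤ D * ‖p θ‖) (c : 𝔻 →₀ ℂ) :
    ‖kernelSum b c‖ ≤ √(C + D ^ 2) * ‖toL2 (p * boundary (szegoSum c))‖ := by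
  have hh := norm_toL2_sq_le_add (F := boundary (szegoSum c)) (G := p * boundary (szegoSum c))
    (H := boundary (B * szegoSum c)) (C := C) (D := 1) fun θ => by
      simp only [map_mul, ContinuousMap.mul_apply, norm_mul, mul_pow]
      nlinarith [hp θ, sq_nonneg ‖boundary (szegoSum c) θ‖]
  have hu := (hB.norm_star_mul_sub_twistedSum_le κ c).trans <|
    norm_toL2_le_mul (G := p * boundary (szegoSum c)) hD fun θ => by
      simp only [ContinuousMap.mul_apply, norm_mul, ← mul_assoc]
      exact mul_le_mul_of_nonneg_right (hκ θ) (norm_nonneg _)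
  have hsq : ‖kernelSum b c‖ ^ 2 ≤ (C + D ^ 2) * ‖toL2 (p * boundary (szegoSum c))‖ ^ 2 := by
    have := pow_le_pow_left₀ (norm_nonneg _) hu 2
    rw [hB.norm_kernelSum_sq_eq_norm_star_sub_sq]
    nlinarith
  calc ‖kernelSum b c‖ = √(‖kernelSum b c‖ ^ 2) := (Real.sqrt_sq (norm_nonneg _)).symm
    _ ≤ √((C + D ^ 2) * ‖toL2 (p * boundary (szegoSum c))‖ ^ 2) := Real.sqrt_le_sqrt hsq
    _ = √(C + D ^ 2) * ‖toL2 (p * boundary (szegoSum c))‖ := by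
        rw [Real.sqrt_mul' _ (sq_nonneg _), Real.sqrt_sq (norm_nonneg _)]

end IsDiscExtension

/-- The polynomial functions, as elements of the disc algebra. -/
def polynomialFun : Polynomial ℂ →ₐ[ℂ] discAlgebra :=
  Polynomial.aeval ⟨id, differentiable_id.diffContOnCl⟩

theorem polynomialFun_apply (P : Polynomial ℂ) (z : ℂ) : (polynomialFun P).1 z = P.eval z := by
  have h := Polynomial.aeval_algHom_apply
    ((Pi.evalAlgHom ℂ (fun _ : ℂ => ℂ) z).comp discAlgebra.val)
    (⟨id, differentiable_id.diffContOnCl⟩ : discAlgebra) P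
  exact h.symm.trans (Polynomial.coe_aeval_eq_eval z ▸ rfl)

/-- The class in `L²` of the monomial `z ↦ z ^ n`. -/
def monomialL2 (n : ℕ) : CircleL2 := toL2 (boundary (polynomialFun (Polynomial.X ^ n)))

theorem orthonormal_monomialL2 : Orthonormal ℂ monomialL2 := by
  have h : monomialL2 = fourierLp 2 ∘ ((↑) : ℕ → ℤ) := by
    funext n
    refine congrArg toL2 (ContinuousMap.ext fun θ => ?_)
    simp [boundary_apply, polynomialFun_apply, AddCircle.toCircle_nsmul]
  exact h ▸ orthonormal_fourier.comp _ Nat.cast_injective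

theorem hasSum_smul_monomialL2 {a : ℕ → ℂ} (ha : Summable fun n => ‖a n‖) {F : discAlgebra}
    (hF : ∀ z : ℂ, ‖z‖ = 1 → HasSum (fun n => a n * z ^ n) (F.1 z)) :
    HasSum (fun n => a n • monomialL2 n) (toL2 (boundary F)) := by
  set f : ℕ → CircleFun := fun n => a n • boundary (polynomialFun (Polynomial.X ^ n))
  have hf : Summable f := ha.of_norm_bounded fun n => by
    rw [ContinuousMap.norm_le _ (norm_nonneg _)]
    intro θ
    simp [f, boundary_apply, polynomialFun_apply, Circle.norm_coe θ.toCircle]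
  have hsum : ∑' n, f n = boundary F := ContinuousMap.ext fun θ => by
    rw [← ContinuousMap.tsum_apply hf, boundary_apply, ← (hF _ (Circle.norm_coe _)).tsum_eq]
    simp [f, boundary_apply, polynomialFun_apply]
  simpa only [f, monomialL2, map_smul] using (hsum ▸ hf.hasSum).mapL toL2

theorem hasSum_szego (w : 𝔻) :
    HasSum (fun n => conj (w : ℂ) ^ n • monomialL2 n) (toL2 (boundary (szego w))) := by
  have hw : ‖conj (w : ℂ)‖ < 1 := by rw [RCLike.norm_conj]; exact w.norm_lt_one
  refine hasSum_smul_monomialL2 ?_ fun z hz => ?_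
  · simpa only [norm_pow] using summable_geometric_of_lt_one (norm_nonneg _) hw
  · simpa only [mul_pow, szego, one_div] using hasSum_geometric_of_norm_lt_one
      (ξ := conj (w : ℂ) * z) (by rwa [norm_mul, hz, mul_one])

theorem mul_mem_ball {t : ℝ} (ht : t ∈ Set.Ico 0 1) {z : ℂ} (hz : z ∈ closedBall (0 : ℂ) 1) :
    t * z ∈ ball (0 : ℂ) 1 := by
  rw [mem_closedBall_zero_iff] at hz
  rw [mem_ball_zero_iff, norm_mul, Complex.norm_of_nonneg ht.1]
  exact mul_lt_one_of_nonneg_of_lt_one_left ht.1 ht.2 hz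

/-- The dilation `z ↦ F (t z)` of a function analytic in the open disc. -/
def dilate {F : ℂ → ℂ} (hF : DifferentiableOn ℂ F (ball 0 1)) {t : ℝ} (ht : t ∈ Set.Ico 0 1) :
    discAlgebra :=
  ⟨fun z => F (t * z), mem_discAlgebra_of_differentiableOn <|
    hF.comp (by fun_prop) fun _ hz => mul_mem_ball ht hz⟩

theorem norm_toL2_dilate_sq {F : ℂ → ℂ} (hF : DifferentiableOn ℂ F (ball 0 1)) {t : ℝ}
    (ht : t ∈ Set.Ico 0 1) :
    ‖toL2 (boundary (dilate hF ht))‖ ^ 2 = Real.circleAverage (fun z => ‖F z‖ ^ 2) 0 t := by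
  rw [norm_toL2_boundary_sq, Real.circleAverage_eq_circleAverage_zero_one (R := t)]
  simp [dilate]

theorem tendsto_dilate {F : ℂ → ℂ} (hF : DifferentiableOn ℂ F (ball 0 1)) {z : ℂ}
    (hz : z ∈ ball (0 : ℂ) 1) : Tendsto (fun t : ℝ => F (t * z)) (𝓝[<] 1) (𝓝 (F z)) := by
  have hc : ContinuousAt F z := (hF.differentiableAt (isOpen_ball.mem_nhds hz)).continuousAt
  have ht : Tendsto (fun t : ℝ => (t : ℂ) * z) (𝓝 1) (𝓝 z) := by
    have : Continuous fun t : ℝ => (t : ℂ) * z := by fun_prop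
    simpa using this.tendsto 1
  exact hc.tendsto.comp (ht.mono_left nhdsWithin_le_nhds)

/-- The map sending `ψ` to the Cauchy transform `w ↦ ⟪p k_w, ψ⟫ = ∫ conj p ψ / (1 - w conj z)` of
`conj p ψ`. -/
def cauchyTransform (p : CircleFun) : CircleL2 →ₗ[ℂ] 𝔻 → ℂ :=
  LinearMap.pi fun w => innerₛₗ ℂ (toL2 (p * boundary (szego w)))

theorem cauchyTransform_apply (p : CircleFun) (ψ : CircleL2) (w : 𝔻) :
    cauchyTransform p ψ w = ⟪toL2 (p * boundary (szego w)), ψ⟫_ℂ := rfl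

theorem exists_cauchyTransform_eq (p : CircleFun) (f : 𝔻 → ℂ) {C : ℝ} (hC : 0 ≤ C)
    (h : ∀ c : 𝔻 →₀ ℂ,
      ‖c.sum fun w a => conj a * f w‖ ≤ C * ‖toL2 (p * boundary (szegoSum c))‖) :
    ∃ ψ, ‖ψ‖ ≤ C ∧ cauchyTransform p ψ = f := by
  obtain ⟨ψ, hψ, hf⟩ := exists_inner_eq_of_norm_sum_le
    (fun w => toL2 (p * boundary (szego w))) f hC fun c => by
      simpa [szegoSum, Finsupp.linearCombination_apply, Finsupp.sum, Finset.mul_sum] using h c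
  exact ⟨ψ, hψ, funext hf⟩

/-- The power series whose coefficients are the Fourier coefficients of `ψ` of index `n ≥ 0`. -/
def analyticPart (ψ : CircleL2) (z : ℂ) : ℂ := ∑' n : ℕ, ⟪monomialL2 n, ψ⟫_ℂ * z ^ n

theorem analyticPart_eq_cauchyTransform (ψ : CircleL2) (w : 𝔻) :
    analyticPart ψ w = cauchyTransform 1 ψ w := by
  have h := Complex.hasSum_conj'.2 ((hasSum_szego w).mapL (innerSL ℂ ψ))
  simp only [innerSL_apply_apply, inner_conj_symm, inner_smul_right, map_mul, map_pow,
    Complex.conj_conj] at h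
  rw [cauchyTransform_apply, one_mul, ← h.tsum_eq]
  exact tsum_congr fun n => mul_comm _ _

theorem norm_inner_monomialL2_le (ψ : CircleL2) (n : ℕ) : ‖⟪monomialL2 n, ψ⟫_ℂ‖ ≤ ‖ψ‖ := by
  simpa [orthonormal_monomialL2.1 n] using norm_inner_le_norm (𝕜 := ℂ) (monomialL2 n) ψ

theorem differentiableOn_analyticPart (ψ : CircleL2) :
    DifferentiableOn ℂ (analyticPart ψ) (ball 0 1) := by
  intro z hz
  obtain ⟨ρ, hzρ, hρ⟩ := exists_between (mem_ball_zero_iff.1 hz)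
  have hρ0 : 0 ≤ ρ := (norm_nonneg z).trans hzρ.le
  have h := Complex.differentiableOn_tsum_of_summable_norm
    (F := fun n (z : ℂ) => ⟪monomialL2 n, ψ⟫_ℂ * z ^ n)
    ((summable_geometric_of_lt_one hρ0 hρ).mul_left ‖ψ‖)
    (fun n => (differentiableOn_id.pow n).const_mul _)
    (isOpen_ball (x := (0 : ℂ)) (ε := ρ)) fun n w hw => by
      rw [norm_mul, norm_pow]
      exact mul_le_mul (norm_inner_monomialL2_le ψ n)
        (pow_le_pow_left₀ (norm_nonneg _) (mem_ball_zero_iff.1 hw).le n) (by positivity)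
        (norm_nonneg _)
  exact (h.differentiableAt
    (isOpen_ball.mem_nhds (mem_ball_zero_iff.2 hzρ))).differentiableWithinAt

theorem norm_toL2_dilate_analyticPart_le (ψ : CircleL2) {t : ℝ} (ht : t ∈ Set.Ico 0 1) :
    ‖toL2 (boundary (dilate (differentiableOn_analyticPart ψ) ht))‖ ≤ ‖ψ‖ := by
  have hsummable : Summable fun n : ℕ => ‖⟪monomialL2 n, ψ⟫_ℂ * (t : ℂ) ^ n‖ := by
    refine ((summable_geometric_of_lt_one ht.1 ht.2).mul_left ‖ψ‖).of_nonneg_of_le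
      (fun _ => norm_nonneg _) fun n => ?_
    rw [norm_mul, norm_pow, Complex.norm_of_nonneg ht.1]
    exact mul_le_mul_of_nonneg_right (norm_inner_monomialL2_le ψ n) (pow_nonneg ht.1 n)
  have hsum := hasSum_smul_monomialL2 hsummable
    (F := dilate (differentiableOn_analyticPart ψ) ht) fun z hz => by
      have : Summable fun n : ℕ => ⟪monomialL2 n, ψ⟫_ℂ * (t * z) ^ n := by
        refine hsummable.of_norm_bounded fun n => ?_
        simp [mul_pow, hz]
      simpa only [dilate, analyticPart, mul_pow, mul_assoc] using this.hasSum
  refine le_of_tendsto hsum.norm (.of_forall fun s => ?_)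
  refine (sq_le_sq₀ (norm_nonneg _) (norm_nonneg _)).1 ?_
  calc ‖∑ n ∈ s, (⟪monomialL2 n, ψ⟫_ℂ * (t : ℂ) ^ n) • monomialL2 n‖ ^ 2
      = ∑ n ∈ s, ‖⟪monomialL2 n, ψ⟫_ℂ * (t : ℂ) ^ n‖ ^ 2 := by
        rw [← inner_self_eq_norm_sq (𝕜 := ℂ), orthonormal_monomialL2.inner_sum]
        simp only [map_sum, Complex.conj_mul', ← Complex.ofReal_pow, RCLike.re_eq_complex_re,
          Complex.ofReal_re]
    _ ≤ ∑ n ∈ s, ‖⟪monomialL2 n, ψ⟫_ℂ‖ ^ 2 := Finset.sum_le_sum fun n _ => by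
        rw [norm_mul, norm_pow, Complex.norm_of_nonneg ht.1]
        exact pow_le_pow_left₀ (mul_nonneg (norm_nonneg _) (pow_nonneg ht.1 n))
          (mul_le_of_le_one_right (norm_nonneg _) (pow_le_one₀ ht.1 ht.2.le)) 2
    _ ≤ ‖ψ‖ ^ 2 := Orthonormal.sum_inner_products_le ψ orthonormal_monomialL2

theorem isHardyTwo_analyticPart (ψ : CircleL2) : IsHardyTwo (analyticPart ψ) :=
  ⟨differentiableOn_analyticPart ψ, ‖ψ‖ ^ 2, fun _ h0 h1 => by
    rw [← norm_toL2_dilate_sq (differentiableOn_analyticPart ψ) ⟨h0, h1⟩]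
    gcongr
    exact norm_toL2_dilate_analyticPart_le ψ ⟨h0, h1⟩⟩

theorem IsHardyTwo.exists_cauchyTransform_eq_mul {φ : ℂ → ℂ} (hφ : IsHardyTwo φ)
    (P : discAlgebra) : ∃ ψ, cauchyTransform (boundary P) ψ = fun w : 𝔻 => P.1 w * φ w := by
  obtain ⟨hd, C, hC⟩ := hφ
  have hdilate (c : 𝔻 →₀ ℂ) {t : ℝ} (ht : t ∈ Set.Ico 0 1) :
      ‖c.sum fun w a => conj a * (P.1 w * φ (t * w))‖
        ≤ √C * ‖toL2 (boundary P * boundary (szegoSum c))‖ := by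
    have hnorm : ‖toL2 (boundary (dilate hd ht))‖ ≤ √C :=
      Real.le_sqrt_of_sq_le ((norm_toL2_dilate_sq hd ht).trans_le (hC t ht.1 ht.2))
    have hinner := inner_szegoSum c (P * dilate hd ht)
    rw [map_mul, inner_toL2_mul_right] at hinner
    calc _ ≤ _ := (congrArg norm hinner).symm.trans_le (norm_inner_le_norm _ _)
      _ ≤ _ := by
        rw [mul_comm, norm_toL2_star_mul]
        gcongr
  obtain ⟨ψ, -, hψ⟩ := exists_cauchyTransform_eq (boundary P) (fun w : 𝔻 => P.1 w * φ w)
    (Real.sqrt_nonneg C) fun c => by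
      have hlim : Tendsto (fun t : ℝ => c.sum fun w a => conj a * (P.1 w * φ (t * w))) (𝓝[<] 1)
          (𝓝 (c.sum fun w a => conj a * (P.1 w * φ w))) :=
        tendsto_finsetSum _ fun w _ =>
          ((tendsto_dilate hd (mem_ball_zero_iff.2 w.norm_lt_one)).const_mul _).const_mul _
      refine le_of_tendsto hlim.norm ?_
      filter_upwards [Ico_mem_nhdsLT (zero_lt_one (α := ℝ))] with t ht using hdilate c ht
  exact ⟨ψ, hψ⟩

theorem cauchyTransform_eq_inner_add (p : CircleFun) (ψ : CircleL2) (w : 𝔻) :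
    cauchyTransform p ψ w = ⟪toL2 p, ψ⟫_ℂ
      + w * cauchyTransform (boundary (polynomialFun Polynomial.X) * p) ψ w := by
  have h : p * boundary (szego w) = p + conj (w : ℂ) •
      (boundary (polynomialFun Polynomial.X) * p * boundary (szego w)) := by
    ext θ
    have := szego_eq w (Circle.norm_coe θ.toCircle).le
    simp only [ContinuousMap.mul_apply, ContinuousMap.add_apply, ContinuousMap.smul_apply,
      boundary_apply, polynomialFun_apply, Polynomial.eval_X, smul_eq_mul]
    linear_combination p θ * this
  rw [cauchyTransform_apply, h, map_add, inner_add_left, map_smul, inner_smul_left,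
    Complex.conj_conj, cauchyTransform_apply]

theorem exists_cauchyTransform_eq_X_mul (p : CircleFun) (ψ : CircleL2) :
    ∃ ψ', ‖ψ'‖ ≤ ‖ψ‖ ∧
      cauchyTransform p ψ' = cauchyTransform (boundary (polynomialFun Polynomial.X) * p) ψ := by
  refine exists_cauchyTransform_eq p _ (norm_nonneg ψ) fun c => ?_
  simp only [cauchyTransform_apply, ← inner_toL2_mul_szegoSum]
  refine (norm_inner_le_norm _ _).trans ?_
  rw [mul_comm]
  gcongr
  refine (norm_toL2_le_mul zero_le_one fun θ => ?_).trans_eq (one_mul _)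
  simp [boundary_apply, polynomialFun_apply, Circle.norm_coe θ.toCircle]

theorem exists_cauchyTransform_X_sub_C_mul {η : ℂ} (hη : ‖η‖ = 1) (p : CircleFun)
    (ψ : CircleL2) :
    ∃ ψ', ‖ψ'‖ ≤ ‖ψ‖ ∧ ∀ w : 𝔻,
      cauchyTransform (boundary (polynomialFun (Polynomial.X - Polynomial.C η)) * p) ψ w
        = -conj η * ((w - η) * cauchyTransform p ψ' w + ⟪toL2 p, ψ⟫_ℂ) := by
  obtain ⟨ψ', hψ', h⟩ := exists_cauchyTransform_eq_X_mul p ψ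
  refine ⟨ψ', hψ', fun w => ?_⟩
  have hC : boundary (polynomialFun (Polynomial.C η)) = algebraMap ℂ CircleFun η := by
    rw [← Polynomial.algebraMap_eq, AlgHom.commutes, AlgHom.commutes]
  have hsub : cauchyTransform (boundary (polynomialFun (Polynomial.X - Polynomial.C η)) * p) ψ w
      = cauchyTransform p ψ' w - conj η * cauchyTransform p ψ w := by
    rw [h]
    simp only [cauchyTransform_apply]
    rw [map_sub, map_sub, hC, sub_mul, sub_mul, map_sub, inner_sub_left,
      mul_assoc (algebraMap _ _ η), ← Algebra.smul_def, map_smul, inner_smul_left]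
  have hη' : conj η * η = 1 := by rw [Complex.conj_mul', hη]; norm_num
  rw [hsub, cauchyTransform_eq_inner_add p ψ w, ← h]
  linear_combination -cauchyTransform p ψ' w * hη'

/-- The monic polynomial with the points of `s` as its roots. -/
def nodePoly (s : Multiset ℂ) : Polynomial ℂ := (s.map fun η => Polynomial.X - Polynomial.C η).prod

theorem nodePoly_cons (η : ℂ) (s : Multiset ℂ) :
    nodePoly (η ::ₘ s) = (Polynomial.X - Polynomial.C η) * nodePoly s := by simp [nodePoly]

theorem nodePoly_ne_zero (s : Multiset ℂ) : nodePoly s ≠ 0 :=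
  (Polynomial.monic_multisetProd_X_sub_C s).ne_zero

theorem rootMultiplicity_nodePoly (s : Multiset ℂ) (η : ℂ) :
    (nodePoly s).rootMultiplicity η = s.count η := by
  rw [← Polynomial.count_roots, nodePoly, Polynomial.roots_multiset_prod_X_sub_C]

/-- The weight `θ ↦ ∏ (e^{iθ} - η)`, `η` running through `s`. -/
def nodeWeight (s : Multiset ℂ) : CircleFun := boundary (polynomialFun (nodePoly s))

theorem nodeWeight_apply (s : Multiset ℂ) (θ : AddCircle (2 * Real.pi)) :
    nodeWeight s θ = (nodePoly s).eval (θ.toCircle : ℂ) := by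
  rw [nodeWeight, boundary_apply, polynomialFun_apply]

theorem nodeWeight_cons (η : ℂ) (s : Multiset ℂ) :
    nodeWeight (η ::ₘ s)
      = boundary (polynomialFun (Polynomial.X - Polynomial.C η)) * nodeWeight s := by
  rw [nodeWeight, nodePoly_cons, map_mul, map_mul, nodeWeight]

/-- `f = p φ + S` in the disc, where `p` is the monic polynomial with roots `s`, `φ` is in `H²` and
`S` is a polynomial of degree less than that of `p`. -/
structure IsNodeDecomposition (s : Multiset ℂ) (f : 𝔻 → ℂ) (φ : ℂ → ℂ) (S : Polynomial ℂ) :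
    Prop where
  isHardyTwo : IsHardyTwo φ
  degree_lt : S.degree < s.card
  eq_add : ∀ w : 𝔻, f w = (nodePoly s).eval (w : ℂ) * φ w + S.eval (w : ℂ)

theorem IsNodeDecomposition.cons {s : Multiset ℂ} {f : 𝔻 → ℂ} {φ : ℂ → ℂ} {S : Polynomial ℂ}
    (h : IsNodeDecomposition s f φ S) (η a b : ℂ) :
    IsNodeDecomposition (η ::ₘ s) (fun w => a * ((w - η) * f w + b)) (fun w => a * φ w)
      (Polynomial.C a * ((Polynomial.X - Polynomial.C η) * S + Polynomial.C b)) where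
  isHardyTwo := h.isHardyTwo.const_mul a
  degree_lt := by
    have hmul : ((Polynomial.X - Polynomial.C η) * S).degree < ((s.card + 1 : ℕ) : WithBot ℕ) := by
      rw [Polynomial.degree_mul, Polynomial.degree_X_sub_C, add_comm, Nat.cast_add]
      exact WithBot.add_lt_add_right WithBot.one_ne_bot h.degree_lt
    rw [Multiset.card_cons]
    rw [← Polynomial.smul_eq_C_mul]
    refine (Polynomial.degree_smul_le _ _).trans_lt ((Polynomial.degree_add_le _ _).trans_lt ?_)
    exact max_lt hmul (Polynomial.degree_C_le.trans_lt (by exact_mod_cast s.card.succ_pos))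
  eq_add w := by
    rw [h.eq_add w, nodePoly_cons]
    simp only [Polynomial.eval_mul, Polynomial.eval_add, Polynomial.eval_sub, Polynomial.eval_X,
      Polynomial.eval_C]
    ring

theorem norm_coeff_X_sub_C_mul_add_C_le {η : ℂ} (hη : ‖η‖ = 1) {S : Polynomial ℂ} {C : ℝ}
    (h : ∀ i, ‖S.coeff i‖ ≤ C) (b : ℂ) (i : ℕ) :
    ‖((Polynomial.X - Polynomial.C η) * S + Polynomial.C b).coeff i‖ ≤ 2 * C + ‖b‖ := by
  have hηS : ‖η * S.coeff i‖ ≤ C := by rw [norm_mul, hη, one_mul]; exact h i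
  rw [sub_mul, Polynomial.coeff_add, Polynomial.coeff_sub, Polynomial.coeff_C_mul]
  cases i with
  | zero =>
    rw [Polynomial.coeff_X_mul_zero, zero_sub, Polynomial.coeff_C_zero]
    refine (norm_add_le _ _).trans ?_
    rw [norm_neg]
    linarith [(norm_nonneg _).trans hηS]
  | succ i =>
    rw [Polynomial.coeff_X_mul, Polynomial.coeff_C_succ, add_zero]
    linarith [norm_sub_le (S.coeff i) (η * S.coeff (i + 1)), h i, norm_nonneg b]

theorem exists_isNodeDecomposition_cauchyTransform {s : Multiset ℂ} (hs : ∀ η ∈ s, ‖η‖ = 1) :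
    ∃ C, 0 ≤ C ∧ ∀ ψ, ∃ φ S, IsNodeDecomposition s (cauchyTransform (nodeWeight s) ψ) φ S ∧
      ∀ i, ‖S.coeff i‖ ≤ C * ‖ψ‖ := by
  induction s using Multiset.induction with
  | empty =>
    refine ⟨0, le_rfl, fun ψ => ⟨analyticPart ψ, 0, ⟨isHardyTwo_analyticPart ψ, ?_, fun w => ?_⟩,
      by simp⟩⟩
    · simp
    · simp [nodeWeight, nodePoly, analyticPart_eq_cauchyTransform]
  | cons η s ih =>
    obtain ⟨C, hC, ih⟩ := ih fun η hη => hs η (Multiset.mem_cons_of_mem hη)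
    have hη := hs η (Multiset.mem_cons_self η s)
    refine ⟨2 * C + ‖toL2 (nodeWeight s)‖, by positivity, fun ψ => ?_⟩
    obtain ⟨ψ', hψ', hcons⟩ := exists_cauchyTransform_X_sub_C_mul hη (nodeWeight s) ψ
    obtain ⟨φ, S, hdec, hS⟩ := ih ψ'
    have hdec' := hdec.cons η (-conj η) ⟪toL2 (nodeWeight s), ψ⟫_ℂ
    rw [← funext hcons, ← nodeWeight_cons] at hdec'
    refine ⟨_, _, hdec', fun i => ?_⟩
    · have hcoeff := norm_coeff_X_sub_C_mul_add_C_le hη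
        (fun i => (hS i).trans (mul_le_mul_of_nonneg_left hψ' hC)) ⟪toL2 (nodeWeight s), ψ⟫_ℂ i
      rw [Polynomial.coeff_C_mul, norm_mul, norm_neg, RCLike.norm_conj, hη, one_mul]
      linarith [norm_inner_le_norm (𝕜 := ℂ) (toL2 (nodeWeight s)) ψ]

theorem norm_toL2_szego_sq (w : 𝔻) : ‖toL2 (boundary (szego w))‖ ^ 2 = 1 / (1 - ‖(w : ℂ)‖ ^ 2) := by
  have h : _ = 1 / (1 - conj (w : ℂ) * w) := inner_szego w (szego w)
  rw [inner_self_eq_norm_sq_to_K, Complex.conj_mul'] at h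
  exact Complex.ofReal_injective (by push_cast; exact h)

theorem IsHardyTwo.exists_norm_sq_mul_le {φ : ℂ → ℂ} (hφ : IsHardyTwo φ) :
    ∃ D, ∀ w : 𝔻, ‖φ w‖ ^ 2 * (1 - ‖(w : ℂ)‖ ^ 2) ≤ D := by
  obtain ⟨ψ, hψ⟩ := hφ.exists_cauchyTransform_eq_mul 1
  refine ⟨‖ψ‖ ^ 2, fun w => ?_⟩
  have hw : 0 < 1 - ‖(w : ℂ)‖ ^ 2 :=
    sub_pos.2 (pow_lt_one₀ (norm_nonneg _) w.norm_lt_one two_ne_zero)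
  have hφw : φ w = ⟪toL2 (boundary (szego w)), ψ⟫_ℂ := by
    simpa [cauchyTransform_apply] using (congrFun hψ w).symm
  rw [← le_div_iff₀ hw, div_eq_mul_one_div, ← norm_toL2_szego_sq, mul_comm, ← mul_pow, hφw]
  exact pow_le_pow_left₀ (norm_nonneg _) (norm_inner_le_norm _ _) 2

/-- On the linear combinations of kernel functions of `H(b)`, the norm of `H(b)` is equivalent to
the norm of `L²(|p|² dm)`, where `p` is the monic polynomial with roots `s`, all on the unit circle;
moreover `b` continues analytically across the points of `s`. -/
structure IsBoundaryWeight (b : SchurFunction) (s : Multiset ℂ) : Prop where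
  norm_eq_one : ∀ η ∈ s, ‖η‖ = 1
  exists_norm_kernelSum_le : ∃ K, 0 ≤ K ∧ ∀ c : 𝔻 →₀ ℂ,
    ‖kernelSum b c‖ ≤ K * ‖toL2 (nodeWeight s * boundary (szegoSum c))‖
  exists_norm_mul_szegoSum_le : ∃ K, 0 ≤ K ∧ ∀ c : 𝔻 →₀ ℂ,
    ‖toL2 (nodeWeight s * boundary (szegoSum c))‖ ≤ K * ‖kernelSum b c‖
  exists_extension : ∀ η ∈ s, ∃ F, IsAnalyticExtensionAt b η F

theorem inner_kernelSum (b : SchurFunction) (c : 𝔻 →₀ ℂ) (f : Space b) :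
    ⟪kernelSum b c, f⟫_ℂ = c.sum fun w a => conj a * f w := by
  simp only [kernelSum, Finsupp.linearCombination_apply, Finsupp.sum, sum_inner, inner_smul_left,
    inner_kernelVec]

namespace IsBoundaryWeight

variable {b : SchurFunction} {s : Multiset ℂ} (h : IsBoundaryWeight b s)
include h

theorem exists_cauchyTransform_eq :
    ∃ K, ∀ f : Space b, ∃ ψ, ‖ψ‖ ≤ K * ‖f‖ ∧ cauchyTransform (nodeWeight s) ψ = f := by
  obtain ⟨K, hK, hle⟩ := h.exists_norm_kernelSum_le
  refine ⟨K, fun f => DBR.exists_cauchyTransform_eq _ f (by positivity) fun c => ?_⟩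
  rw [← inner_kernelSum]
  calc _ ≤ ‖kernelSum b c‖ * ‖f‖ := norm_inner_le_norm _ _
    _ ≤ K * ‖toL2 (nodeWeight s * boundary (szegoSum c))‖ * ‖f‖ := by gcongr; exact hle c
    _ = _ := by ring

theorem spaceFunctions_eq_range :
    spaceFunctions b = LinearMap.range (cauchyTransform (nodeWeight s)) := by
  apply le_antisymm
  · rintro _ ⟨f, rfl⟩
    obtain ⟨K, hK⟩ := h.exists_cauchyTransform_eq
    obtain ⟨ψ, -, hψ⟩ := hK f
    exact ⟨ψ, hψ⟩
  · rintro _ ⟨ψ, rfl⟩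
    obtain ⟨K, hK, hle⟩ := h.exists_norm_mul_szegoSum_le
    obtain ⟨f, -, hf⟩ := exists_inner_eq_of_norm_sum_le (kernelVec b)
      (cauchyTransform (nodeWeight s) ψ) (C := K * ‖ψ‖) (by positivity) fun c => by
        simp only [cauchyTransform_apply, ← inner_toL2_mul_szegoSum]
        calc _ ≤ ‖toL2 (nodeWeight s * boundary (szegoSum c))‖ * ‖ψ‖ := norm_inner_le_norm _ _
          _ ≤ K * ‖kernelSum b c‖ * ‖ψ‖ := by gcongr; exact hle c
          _ = _ := by rw [kernelSum]; ring
    exact ⟨f, funext fun w => (inner_kernelVec b w f).symm.trans (hf w)⟩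

theorem mulHardyTwo_le_spaceFunctions :
    mulHardyTwo (fun z => (nodePoly s).eval z) ≤ spaceFunctions b := by
  rintro _ ⟨f, ⟨φ, hφ, hf⟩, rfl⟩
  obtain ⟨ψ, hψ⟩ := hφ.exists_cauchyTransform_eq_mul (polynomialFun (nodePoly s))
  rw [h.spaceFunctions_eq_range]
  refine ⟨ψ, hψ.trans (funext fun w => ?_)⟩
  simp [polynomialFun_apply, hf]

theorem exists_isNodeDecomposition :
    ∃ K, ∀ f : Space b, ∃ φ S, IsNodeDecomposition s f φ S ∧
      ∀ i, ‖S.coeff i‖ ≤ K * ‖f‖ := by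
  obtain ⟨K, hf⟩ := h.exists_cauchyTransform_eq
  obtain ⟨C, hC, hψ⟩ := exists_isNodeDecomposition_cauchyTransform h.norm_eq_one
  refine ⟨C * K, fun f => ?_⟩
  obtain ⟨ψ, hψf, hψe⟩ := hf f
  obtain ⟨φ, S, hdec, hS⟩ := hψ ψ
  refine ⟨φ, S, hψe ▸ hdec, fun i => (hS i).trans ?_⟩
  rw [mul_assoc]
  gcongr

end IsBoundaryWeight

theorem nhdsWithin_ball_neBot {ζ : ℂ} (hζ : ‖ζ‖ = 1) : (𝓝[ball (0 : ℂ) 1] ζ).NeBot := by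
  rw [← mem_closure_iff_nhdsWithin_neBot, closure_ball _ one_ne_zero]
  simp [hζ]

theorem tendsto_ofReal_mul_nhdsWithin_ball {ζ : ℂ} (hζ : ‖ζ‖ = 1) :
    Tendsto (fun t : ℝ => (t : ℂ) * ζ) (𝓝[<] 1) (𝓝[ball (0 : ℂ) 1] ζ) := by
  refine tendsto_nhdsWithin_iff.2 ⟨?_, ?_⟩
  · have : Continuous fun t : ℝ => (t : ℂ) * ζ := by fun_prop
    exact tendsto_nhdsWithin_of_tendsto_nhds (by simpa using this.tendsto 1)
  · filter_upwards [Ioo_mem_nhdsLT (zero_lt_one (α := ℝ))] with t ht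
    rw [mem_ball_zero_iff, norm_mul, hζ, mul_one, Complex.norm_of_nonneg ht.1.le]
    exact ht.2

theorem eventuallyEq_of_eventuallyEq_ball {F G : ℂ → ℂ} {ζ : ℂ} (hζ : ‖ζ‖ = 1)
    (hF : AnalyticAt ℂ F ζ) (hG : AnalyticAt ℂ G ζ)
    (h : ∀ᶠ z in 𝓝[ball (0 : ℂ) 1] ζ, F z = G z) : F =ᶠ[𝓝 ζ] G := by
  have := nhdsWithin_ball_neBot hζ
  refine (hF.frequently_eq_iff_eventually_eq hG).1
    (h.frequently.filter_mono (nhdsWithin_mono _ fun z hz => ?_))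
  rintro rfl
  exact (mem_ball_zero_iff.1 hz).ne hζ

theorem IsHardyTwo.tendsto_sub_mul {φ : ℂ → ℂ} (hφ : IsHardyTwo φ) {ζ : ℂ} (hζ : ‖ζ‖ = 1) :
    Tendsto (fun t : ℝ => (t * ζ - ζ) * φ (t * ζ)) (𝓝[<] 1) (𝓝 0) := by
  obtain ⟨D, hD⟩ := hφ.exists_norm_sq_mul_le
  have hlim : Tendsto (fun t : ℝ => √((1 - t) * D)) (𝓝[<] 1) (𝓝 0) := by
    have : Continuous fun t : ℝ => √((1 - t) * D) := by fun_prop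
    exact tendsto_nhdsWithin_of_tendsto_nhds (by simpa using this.tendsto 1)
  refine squeeze_zero_norm' ?_ hlim
  filter_upwards [Ioo_mem_nhdsLT (zero_lt_one (α := ℝ))] with t ht
  have hnorm : ‖(t : ℂ) * ζ‖ = t := by rw [norm_mul, hζ, mul_one, Complex.norm_of_nonneg ht.1.le]
  have hφt : ‖φ (t * ζ)‖ ^ 2 * (1 - t ^ 2) ≤ D := by
    have := hD (Complex.UnitDisc.mk (t * ζ) (hnorm.trans_lt ht.2))
    rwa [Complex.UnitDisc.coe_mk, hnorm] at this
  have hsub : ‖(t : ℂ) * ζ - ζ‖ = 1 - t := by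
    rw [← sub_one_mul, norm_mul, hζ, mul_one, norm_sub_rev, ← Complex.ofReal_one,
      ← Complex.ofReal_sub, Complex.norm_of_nonneg (sub_nonneg.2 ht.2.le)]
  refine Real.le_sqrt_of_sq_le ?_
  rw [norm_mul, hsub]
  nlinarith [mul_nonneg (mul_nonneg ht.1.le (sub_nonneg.2 ht.2.le)) (sq_nonneg ‖φ (t * ζ)‖),
    sub_pos.2 ht.2]

theorem IsHardyTwo.natCast_le_analyticOrderAt {φ : ℂ → ℂ} (hφ : IsHardyTwo φ) {ζ : ℂ}
    (hζ : ‖ζ‖ = 1) {F p : ℂ → ℂ} (hF : AnalyticAt ℂ F ζ) (hp : ContinuousAt p ζ) {m : ℕ}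
    (h : ∀ᶠ z in 𝓝[ball (0 : ℂ) 1] ζ, F z = (z - ζ) ^ m * p z * φ z) :
    (m : ℕ∞) ≤ analyticOrderAt F ζ := by
  by_contra! hlt
  obtain ⟨k, hk⟩ := ENat.ne_top_iff_exists.1 (ne_top_of_lt hlt)
  obtain ⟨j, rfl⟩ := Nat.exists_eq_add_of_lt (ENat.natCast_lt_natCast.1 (hk ▸ hlt))
  obtain ⟨G, hG, hG0, hFG⟩ := hF.analyticOrderAt_eq_natCast.1 hk.symm
  have hlim := tendsto_ofReal_mul_nhdsWithin_ball hζ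
  have hlim' := hlim.mono_right nhdsWithin_le_nhds
  have hsub : Tendsto (fun z : ℂ => (z - ζ) ^ j * p z) (𝓝 ζ) (𝓝 ((ζ - ζ) ^ j * p ζ)) :=
    (((continuous_id.sub continuous_const).pow j).continuousAt.mul hp).tendsto
  have hzero := (hsub.comp hlim').mul (hφ.tendsto_sub_mul hζ)
  rw [mul_zero] at hzero
  refine hG0 (tendsto_nhds_unique ((hG.continuousAt.tendsto.comp hlim').congr' ?_) hzero)
  filter_upwards [Ioo_mem_nhdsLT (zero_lt_one (α := ℝ)), hlim.eventually h,
    hlim'.eventually hFG] with t ht hmul hpow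
  have hne : (t : ℂ) * ζ - ζ ≠ 0 := by
    rw [← sub_one_mul]
    exact mul_ne_zero (sub_ne_zero.2 (mod_cast ht.2.ne)) (norm_ne_zero_iff.1 (by simp [hζ]))
  refine mul_left_cancel₀ (pow_ne_zero k hne) ?_
  simp only [Function.comp_apply]
  rw [← smul_eq_mul, ← hpow, hmul]
  ring

theorem analyticAt_eval (T : Polynomial ℂ) (ζ : ℂ) : AnalyticAt ℂ (fun z => T.eval z) ζ :=
  T.differentiable.analyticAt ζ

theorem exists_eval_eq_pow_rootMultiplicity_mul {T : Polynomial ℂ} (hT : T ≠ 0) (ζ : ℂ) :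
    ∃ T₁ : Polynomial ℂ, T₁.eval ζ ≠ 0 ∧
      ∀ z, T.eval z = (z - ζ) ^ T.rootMultiplicity ζ * T₁.eval z := by
  obtain ⟨T₁, hT₁, hdvd⟩ := Polynomial.exists_eq_pow_rootMultiplicity_mul_and_not_dvd T hT ζ
  refine ⟨T₁, fun h0 => hdvd (Polynomial.dvd_iff_isRoot.2 h0), fun z => ?_⟩
  simpa using congrArg (Polynomial.eval z) hT₁

theorem analyticOrderAt_eval {T : Polynomial ℂ} (hT : T ≠ 0) (ζ : ℂ) :
    analyticOrderAt (fun z => T.eval z) ζ = T.rootMultiplicity ζ := by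
  obtain ⟨T₁, hT₁, h⟩ := exists_eval_eq_pow_rootMultiplicity_mul hT ζ
  exact (analyticAt_eval T ζ).analyticOrderAt_eq_natCast.2
    ⟨fun z => T₁.eval z, analyticAt_eval T₁ ζ, hT₁, .of_forall h⟩

theorem IsHardyTwo.count_le_analyticOrderAt {φ : ℂ → ℂ} (hφ : IsHardyTwo φ) {ζ : ℂ}
    (hζ : ‖ζ‖ = 1) {F : ℂ → ℂ} (hF : AnalyticAt ℂ F ζ) {s : Multiset ℂ}
    (h : ∀ᶠ z in 𝓝[ball (0 : ℂ) 1] ζ, F z = (nodePoly s).eval z * φ z) :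
    (s.count ζ : ℕ∞) ≤ analyticOrderAt F ζ := by
  obtain ⟨T₁, -, hT₁⟩ := exists_eval_eq_pow_rootMultiplicity_mul (nodePoly_ne_zero s) ζ
  rw [rootMultiplicity_nodePoly] at hT₁
  exact hφ.natCast_le_analyticOrderAt hζ hF T₁.continuous.continuousAt
    (h.mono fun z hz => by rw [hz, hT₁])

theorem eq_zero_of_count_le_analyticOrderAt {T : Polynomial ℂ} {s : Multiset ℂ}
    (hd : T.degree < s.card)
    (h : ∀ ζ ∈ s, (s.count ζ : ℕ∞) ≤ analyticOrderAt (fun z => T.eval z) ζ) : T = 0 := by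
  by_contra hT
  have hle : s ≤ T.roots := Multiset.le_iff_count.2 fun ζ => by
    by_cases hζ : ζ ∈ s
    · rw [Polynomial.count_roots]
      exact_mod_cast analyticOrderAt_eval hT ζ ▸ h ζ hζ
    · simp [hζ]
  have hcard := (Multiset.card_le_card hle).trans (Polynomial.card_roots' T)
  rw [Polynomial.degree_eq_natDegree hT] at hd
  exact hcard.not_gt (by exact_mod_cast hd)

namespace IsNodeDecomposition

variable {s : Multiset ℂ} {f g : 𝔻 → ℂ} {φ χ : ℂ → ℂ} {S T : Polynomial ℂ}

theorem add (hf : IsNodeDecomposition s f φ S) (hg : IsNodeDecomposition s g χ T) :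
    IsNodeDecomposition s (f + g) (fun z => φ z + χ z) (S + T) where
  isHardyTwo := hf.isHardyTwo.add hg.isHardyTwo
  degree_lt := (Polynomial.degree_add_le _ _).trans_lt (max_lt hf.degree_lt hg.degree_lt)
  eq_add w := by
    rw [Pi.add_apply, hf.eq_add, hg.eq_add, Polynomial.eval_add]
    ring

theorem smul (hf : IsNodeDecomposition s f φ S) (c : ℂ) :
    IsNodeDecomposition s (c • f) (fun z => c * φ z) (c • S) where
  isHardyTwo := hf.isHardyTwo.const_mul c
  degree_lt := (Polynomial.degree_smul_le _ _).trans_lt hf.degree_lt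
  eq_add w := by
    rw [Pi.smul_apply, hf.eq_add, Polynomial.eval_smul, smul_eq_mul, smul_eq_mul]
    ring

theorem count_le_analyticOrderAt_sub (hf : IsNodeDecomposition s f φ S) {ζ : ℂ} (hζ : ‖ζ‖ = 1)
    {F : ℂ → ℂ} (hF : AnalyticAt ℂ F ζ)
    (hFf : ∀ᶠ z in 𝓝[ball (0 : ℂ) 1] ζ, ∀ w : 𝔻, (w : ℂ) = z → F z = f w) :
    (s.count ζ : ℕ∞) ≤ analyticOrderAt (fun z => F z - S.eval z) ζ := by
  refine hf.isHardyTwo.count_le_analyticOrderAt hζ (hF.fun_sub (analyticAt_eval S ζ)) ?_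
  filter_upwards [hFf, self_mem_nhdsWithin] with z hz hzb
  rw [hz (Complex.UnitDisc.mk z (mem_ball_zero_iff.1 hzb)) rfl, hf.eq_add]
  simp

theorem unique (hs : ∀ η ∈ s, ‖η‖ = 1) (hS : IsNodeDecomposition s f φ S)
    (hT : IsNodeDecomposition s f χ T) : S = T := by
  have h := hT.add (hS.smul (-1))
  have h0 : -(T + (-1 : ℂ) • S) = 0 := eq_zero_of_count_le_analyticOrderAt
    ((Polynomial.degree_neg _).trans_lt h.degree_lt) fun ζ hζ => by
      simp only [Polynomial.eval_neg, ← zero_sub (Polynomial.eval _ _)]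
      exact h.count_le_analyticOrderAt_sub (hs ζ hζ) analyticAt_const (by simp)
  rwa [neg_one_smul, ← sub_eq_add_neg, neg_sub, sub_eq_zero] at h0

end IsNodeDecomposition

/-- The functional `S ↦ S^(ℓ)(ζ)` on polynomials. -/
def evalDerivative (ζ : ℂ) (ℓ : ℕ) : Polynomial ℂ →ₗ[ℂ] ℂ :=
  Polynomial.leval ζ ∘ₗ Polynomial.derivative ^ ℓ

theorem evalDerivative_eq_iteratedDeriv (ζ : ℂ) (ℓ : ℕ) (S : Polynomial ℂ) :
    evalDerivative ζ ℓ S = iteratedDeriv ℓ (fun z => S.eval z) ζ := by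
  induction ℓ generalizing S with
  | zero => simp [evalDerivative]
  | succ ℓ ih =>
    have hderiv : deriv (fun z => S.eval z) = fun z => S.derivative.eval z :=
      funext fun _ => S.deriv
    rw [iteratedDeriv_succ', hderiv, ← ih, evalDerivative, evalDerivative, pow_succ]
    rfl

theorem exists_norm_apply_le_mul (E : Polynomial ℂ →ₗ[ℂ] ℂ) (n : ℕ) :
    ∃ C, ∀ (S : Polynomial ℂ) (K : ℝ), S.degree < n → (∀ i, ‖S.coeff i‖ ≤ K) →
      ‖E S‖ ≤ C * K := by
  refine ⟨∑ i ∈ Finset.range n, ‖E (Polynomial.X ^ i)‖, fun S K hS hK => ?_⟩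
  have hsum : S = ∑ i ∈ Finset.range n, S.coeff i • Polynomial.X ^ i := by
    rcases eq_or_ne S 0 with rfl | hS0
    · simp
    · simpa only [Polynomial.smul_eq_C_mul] using
        S.as_sum_range_C_mul_X_pow' ((Polynomial.natDegree_lt_iff_degree_lt hS0).2 hS)
  conv_lhs => rw [hsum, map_sum]
  rw [Finset.sum_mul]
  refine norm_sum_le_of_le _ fun i _ => ?_
  rw [map_smul, norm_smul, mul_comm]
  gcongr
  exact hK i

theorem IsBoundaryWeight.exists_remainder {b : SchurFunction} {s : Multiset ℂ}
    (h : IsBoundaryWeight b s) :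
    ∃ (T : Space b →ₗ[ℂ] Polynomial ℂ) (K : ℝ),
      (∀ f : Space b, ∃ φ, IsNodeDecomposition s f φ (T f)) ∧
      ∀ (f : Space b) i, ‖(T f).coeff i‖ ≤ K * ‖f‖ := by
  obtain ⟨K, hK⟩ := h.exists_isNodeDecomposition
  choose φ S hdec hS using hK
  let T : Space b →ₗ[ℂ] Polynomial ℂ :=
    { toFun := S
      map_add' := fun (f g : Space b) => (hdec (f + g)).unique h.norm_eq_one <| by
        rw [RKHS.coe_add]
        exact (hdec f).add (hdec g)
      map_smul' := fun (c : ℂ) (f : Space b) => (hdec (c • f)).unique h.norm_eq_one <| by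
        rw [RKHS.coe_smul]
        exact (hdec f).smul c }
  exact ⟨T, K, fun f => ⟨φ f, hdec f⟩, hS⟩

/-- `v` represents the functional `p φ + S ↦ S^(ℓ)(ζ)` on `H(b)`. -/
def IsEvalRepresenter (b : SchurFunction) (s : Multiset ℂ) (ζ : ℂ) (ℓ : ℕ) (v : Space b) : Prop :=
  ∀ (f : Space b) (φ : ℂ → ℂ) (S : Polynomial ℂ), IsNodeDecomposition s f φ S →
    ⟪v, f⟫_ℂ = evalDerivative ζ ℓ S

theorem IsBoundaryWeight.exists_isEvalRepresenter {b : SchurFunction} {s : Multiset ℂ}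
    (h : IsBoundaryWeight b s) (ζ : ℂ) (ℓ : ℕ) : ∃ v, IsEvalRepresenter b s ζ ℓ v := by
  obtain ⟨T, K, hT, hK⟩ := h.exists_remainder
  obtain ⟨C, hC⟩ := exists_norm_apply_le_mul (evalDerivative ζ ℓ) s.card
  let Λ : Space b →L[ℂ] ℂ := (evalDerivative ζ ℓ ∘ₗ T).mkContinuous (C * K) fun f => by
    obtain ⟨φ, hf⟩ := hT f
    rw [mul_assoc]
    exact hC (T f) _ hf.degree_lt (hK f)
  refine ⟨(InnerProductSpace.toDual ℂ (Space b)).symm Λ, fun f φ S hf => ?_⟩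
  obtain ⟨χ, hχ⟩ := hT f
  rw [InnerProductSpace.toDual_symm_apply, hf.unique h.norm_eq_one hχ]
  rfl

theorem IsAnalyticExtensionAt.eventuallyEq {f F G : ℂ → ℂ} {ζ : ℂ} (hζ : ‖ζ‖ = 1)
    (hF : IsAnalyticExtensionAt f ζ F) (hG : IsAnalyticExtensionAt f ζ G) : F =ᶠ[𝓝 ζ] G :=
  eventuallyEq_of_eventuallyEq_ball hζ hF.1 hG.1 <| by
    filter_upwards [hF.2, hG.2] with z hFz hGz using hFz.trans hGz.symm

theorem IsKernelDeriv.unique {b : ℂ → ℂ} {ℓ : ℕ} {ζ : ℂ} (hζ : ‖ζ‖ = 1) {v v' : 𝔻 → ℂ}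
    (h : IsKernelDeriv b ℓ ζ v) (h' : IsKernelDeriv b ℓ ζ v') : v = v' := by
  obtain ⟨F, hF, hv⟩ := h
  obtain ⟨G, hG, hv'⟩ := h'
  funext z
  rw [hv, hv']
  refine Filter.EventuallyEq.iteratedDeriv_eq ℓ ?_
  have hconj : Tendsto (fun x : ℂ => conj x) (𝓝 (conj ζ)) (𝓝 ζ) := by
    simpa using Complex.continuous_conj.tendsto (conj ζ)
  filter_upwards [hconj.eventually (hF.eventuallyEq hζ hG)] with x hx
  rw [hx]

theorem iteratedDeriv_conj_conj (f : ℂ → ℂ) (ℓ : ℕ) :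
    iteratedDeriv ℓ (fun x => conj (f (conj x))) = fun x => conj (iteratedDeriv ℓ f (conj x)) := by
  induction ℓ with
  | zero => simp
  | succ ℓ ih =>
    rw [iteratedDeriv_succ, ih, iteratedDeriv_succ]
    exact deriv_conj_conj (f := iteratedDeriv ℓ f)

theorem IsNodeDecomposition.iteratedDeriv_eq {s : Multiset ℂ} {f : 𝔻 → ℂ} {φ : ℂ → ℂ}
    {S : Polynomial ℂ} (hf : IsNodeDecomposition s f φ S) {ζ : ℂ} (hζ : ‖ζ‖ = 1) {F : ℂ → ℂ}
    (hF : AnalyticAt ℂ F ζ)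
    (hFf : ∀ᶠ z in 𝓝[ball (0 : ℂ) 1] ζ, ∀ w : 𝔻, (w : ℂ) = z → F z = f w) {ℓ : ℕ}
    (hℓ : ℓ < s.count ζ) : iteratedDeriv ℓ F ζ = evalDerivative ζ ℓ S := by
  have hS := analyticAt_eval S ζ
  have h := (natCast_le_analyticOrderAt_iff_iteratedDeriv_eq_zero (hF.fun_sub hS)).1
    (hf.count_le_analyticOrderAt_sub hζ hF hFf) ℓ hℓ
  rw [iteratedDeriv_fun_sub hF.contDiffAt hS.contDiffAt] at h
  rw [evalDerivative_eq_iteratedDeriv, sub_eq_zero.1 h]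

theorem IsEvalRepresenter.isKernelDeriv {b : SchurFunction} {s : Multiset ℂ} {ζ : ℂ} {ℓ : ℕ}
    {v : Space b} (hv : IsEvalRepresenter b s ζ ℓ v) (h : IsBoundaryWeight b s)
    (hℓ : ℓ < s.count ζ) : IsKernelDeriv b ℓ ζ v := by
  have hζs : ζ ∈ s := Multiset.count_pos.1 (Nat.zero_lt_of_lt hℓ)
  have hζ := h.norm_eq_one ζ hζs
  obtain ⟨F, hF⟩ := h.exists_extension ζ hζs
  refine ⟨F, hF, fun z => ?_⟩
  set k : ℂ → ℂ := fun w => (1 - conj (b z) * F w) / (1 - conj (z : ℂ) * w) with hk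
  have hka : AnalyticAt ℂ k ζ :=
    (analyticAt_const.sub (analyticAt_const.mul hF.1)).div
      (analyticAt_const.sub (analyticAt_const.mul analyticAt_id))
      (one_sub_conj_mul_ne_zero z.norm_lt_one hζ.le)
  obtain ⟨_, hdec⟩ := h.exists_isNodeDecomposition
  obtain ⟨φ, S, hS, -⟩ := hdec (kernelVec b z)
  have hderiv := hS.iteratedDeriv_eq hζ hka
    (hF.2.mono fun w hFw w' hw => by rw [kernelVec_apply, kernelFun, hw, ← hFw]) hℓ
  have hconj : (fun x : ℂ => (1 - conj (F (conj x)) * b z) / (1 - x * (z : ℂ)))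
      = fun x => conj (k (conj x)) := by
    funext x
    simp only [hk, map_div₀, map_sub, map_one, map_mul, Complex.conj_conj]
    ring
  simp only [hconj, iteratedDeriv_conj_conj, Complex.conj_conj]
  rw [hderiv, ← hv _ φ S hS, inner_conj_symm, inner_kernelVec]

theorem mem_mulHardyTwo {φ : ℂ → ℂ} {f : 𝔻 → ℂ} :
    f ∈ mulHardyTwo φ ↔ ∃ F : ℂ → ℂ, IsHardyTwo F ∧ ∀ z : 𝔻, f z = φ z * F z := by
  constructor
  · rintro ⟨g, ⟨F, hF, hg⟩, rfl⟩
    exact ⟨F, hF, fun z => by simp [hg]⟩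
  · rintro ⟨F, hF, hf⟩
    exact ⟨fun z => F z, ⟨F, hF, fun z => rfl⟩, funext fun z => by simp [hf]⟩

theorem isNodeDecomposition_zero_iff {s : Multiset ℂ} {f : 𝔻 → ℂ} :
    (∃ φ, IsNodeDecomposition s f φ 0) ↔ f ∈ mulHardyTwo fun z => (nodePoly s).eval z := by
  rw [mem_mulHardyTwo]
  refine ⟨fun ⟨φ, hφ⟩ => ⟨φ, hφ.isHardyTwo, by simpa using hφ.eq_add⟩,
    fun ⟨φ, hφ, hf⟩ => ⟨φ, hφ, ?_, by simpa using hf⟩⟩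
  rw [Polynomial.degree_zero]
  exact WithBot.bot_lt_coe _

theorem IsBoundaryWeight.orthogonal_span_eq {b : SchurFunction} {s : Multiset ℂ}
    (h : IsBoundaryWeight b s) {ι : Type*} {v : ι → Space b} {ζ : ι → ℂ} {ℓ : ι → ℕ}
    (hv : ∀ i, IsEvalRepresenter b s (ζ i) (ℓ i) (v i))
    (hs : ∀ η ∈ s, ∀ k < s.count η, ∃ i, ζ i = η ∧ ℓ i = k) :
    (Submodule.span ℂ (Set.range v))ᗮ
      = subspaceOf b (mulHardyTwo fun z => (nodePoly s).eval z) := by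
  ext f
  have hspan : f ∈ (Submodule.span ℂ (Set.range v))ᗮ ↔ ∀ i, ⟪v i, f⟫_ℂ = 0 := by
    rw [← Submodule.span_singleton_le_iff_mem]
    exact Submodule.isOrtho_span.trans (by simp [inner_eq_zero_symm])
  rw [hspan, subspaceOf, Submodule.mem_comap]
  refine Iff.trans ⟨fun hf => ?_, ?_⟩ isNodeDecomposition_zero_iff
  · obtain ⟨_, hdec⟩ := h.exists_isNodeDecomposition
    obtain ⟨φ, S, hS, -⟩ := hdec f
    suffices S = 0 from ⟨φ, this ▸ hS⟩
    refine eq_zero_of_count_le_analyticOrderAt hS.degree_lt fun η hη =>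
      (natCast_le_analyticOrderAt_iff_iteratedDeriv_eq_zero (analyticAt_eval S η)).2 fun k hk => ?_
    obtain ⟨i, rfl, rfl⟩ := hs η hη k hk
    rw [← evalDerivative_eq_iteratedDeriv, ← hv i f φ S hS, hf i]
  · rintro ⟨φ, hφ⟩ i
    rw [hv i f φ 0 hφ, map_zero]

theorem IsBoundaryWeight.orthogonal_decomposition {b : SchurFunction} {s : Multiset ℂ}
    (h : IsBoundaryWeight b s) {n : ℕ} {ζ : Fin n → ℂ} {m : Fin n → ℕ}
    (hcount : ∀ j, s.count (ζ j) = m j) (hmem : ∀ η ∈ s, ∃ j, ζ j = η) :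
    ∃ v : (j : Fin n) → Fin (m j) → Space b,
      (∀ (j : Fin n) (ℓ : Fin (m j)), IsKernelDeriv b ℓ (ζ j) (v j ℓ)) ∧
      (∀ (j : Fin n) (ℓ : Fin (m j)),
        ∀ f ∈ subspaceOf b (mulHardyTwo fun z => (nodePoly s).eval z), ⟪f, v j ℓ⟫_ℂ = 0) ∧
      (subspaceOf b (mulHardyTwo fun z => (nodePoly s).eval z) ⟂
        Submodule.span ℂ (Set.range fun p : (j : Fin n) × Fin (m j) => v p.1 p.2)) ∧
      subspaceOf b (mulHardyTwo fun z => (nodePoly s).eval z) ⊔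
        Submodule.span ℂ (Set.range fun p : (j : Fin n) × Fin (m j) => v p.1 p.2) = ⊤ := by
  choose v hv using fun (j : Fin n) (ℓ : Fin (m j)) => h.exists_isEvalRepresenter (ζ j) ℓ
  have : FiniteDimensional ℂ
      (Submodule.span ℂ (Set.range fun p : (j : Fin n) × Fin (m j) => v p.1 p.2)) :=
    FiniteDimensional.span_of_finite ℂ (Set.finite_range _)
  rw [← h.orthogonal_span_eq (v := fun p : (j : Fin n) × Fin (m j) => v p.1 p.2)
    (fun p => hv p.1 p.2) fun η hη k hk => by
      obtain ⟨j, rfl⟩ := hmem η hη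
      exact ⟨⟨j, k, hcount j ▸ hk⟩, rfl, rfl⟩]
  refine ⟨v, fun j ℓ => (hv j ℓ).isKernelDeriv h (by rw [hcount]; exact ℓ.2), fun j ℓ f hf => ?_,
    (Submodule.isOrtho_orthogonal_right _).symm, ?_⟩
  · exact Submodule.inner_left_of_mem_orthogonal
      (Submodule.subset_span (Set.mem_range.2 ⟨⟨j, ℓ⟩, rfl⟩)) hf
  · rw [sup_comm]
    exact Submodule.sup_orthogonal_of_hasOrthogonalProjection

theorem conj_mul_self_of_norm_eq_one {z : ℂ} (hz : ‖z‖ = 1) : conj z * z = 1 := by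
  rw [mul_comm, Complex.mul_conj, Complex.normSq_eq_norm_sq, hz, one_pow, Complex.ofReal_one]

theorem exists_isCoprime_eq_div {q : ℂ → ℂ} (hrat : IsRational q) :
    ∃ P Q : Polynomial ℂ, IsCoprime P Q ∧
      ∀ z ∈ ball (0 : ℂ) 1, Q.eval z ≠ 0 ∧ q z = P.eval z / Q.eval z := by
  classical
  obtain ⟨P, Q, hPQ⟩ := hrat
  have hQ : Q ≠ 0 := by
    rintro rfl
    exact (hPQ 0 (mem_ball_self one_pos)).1 Polynomial.eval_zero
  have hg : gcd P Q ≠ 0 := fun h => hQ (zero_dvd_iff.1 (h ▸ gcd_dvd_right P Q))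
  refine ⟨P / gcd P Q, Q / gcd P Q, isCoprime_div_gcd_div_gcd hQ, fun z hz => ?_⟩
  obtain ⟨hne, hq⟩ := hPQ z hz
  have hP := congrArg (Polynomial.eval z) (EuclideanDomain.mul_div_cancel' hg (gcd_dvd_left P Q))
  have hQ := congrArg (Polynomial.eval z) (EuclideanDomain.mul_div_cancel' hg (gcd_dvd_right P Q))
  rw [Polynomial.eval_mul] at hP hQ
  rw [← hQ] at hne
  rw [← hP, ← hQ, mul_div_mul_left _ _ (left_ne_zero_of_mul hne)] at hq
  exact ⟨right_ne_zero_of_mul hne, hq⟩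

theorem exists_eq_div_ne_zero_closedBall (q : SchurFunction) (hrat : IsRational q) :
    ∃ P Q : Polynomial ℂ, (∀ z ∈ closedBall (0 : ℂ) 1, Q.eval z ≠ 0) ∧
      ∀ z ∈ ball (0 : ℂ) 1, q z = P.eval z / Q.eval z := by
  obtain ⟨P, Q, ⟨u, v, hcop⟩, hball⟩ := exists_isCoprime_eq_div hrat
  have hle : ∀ z ∈ closedBall (0 : ℂ) 1, ‖P.eval z‖ ≤ ‖Q.eval z‖ := by
    rw [← closure_ball _ one_ne_zero]
    refine fun z hz => le_on_closure (fun w hw => ?_) P.continuous.norm.continuousOn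
      Q.continuous.norm.continuousOn hz
    obtain ⟨hne, hq⟩ := hball w hw
    rw [← div_le_one (norm_pos_iff.2 hne), ← norm_div, ← hq]
    exact q.norm_le_one w hw
  refine ⟨P, Q, fun z hz hQ0 => ?_, fun z hz => (hball z hz).2⟩
  have hP0 : P.eval z = 0 := norm_le_zero_iff.1 ((hle z hz).trans_eq (by rw [hQ0, norm_zero]))
  simpa [hP0, hQ0] using congrArg (Polynomial.eval z) hcop

theorem eval_reflect_map_conj {P : Polynomial ℂ} {d : ℕ} (hP : P.natDegree ≤ d) {z : ℂ}
    (hz : ‖z‖ = 1) :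
    ((P.map (starRingEnd ℂ)).reflect d).eval z * conj z ^ d = conj (P.eval z) := by
  have hzz := conj_mul_self_of_norm_eq_one hz
  let _ : Invertible (conj z) := ⟨z, (mul_comm _ _).trans hzz, hzz⟩
  have h := Polynomial.eval₂_reflect_mul_pow (RingHom.id ℂ) (conj z) d
    (P.map (starRingEnd ℂ)) (Polynomial.natDegree_map_le.trans hP)
  rwa [show ⅟(conj z) = z from rfl, Polynomial.eval₂_id, Polynomial.eval₂_id,
    Polynomial.eval_map_apply] at h

theorem exists_eval_mul_conj_pow (P Q : Polynomial ℂ) :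
    ∃ (W : Polynomial ℂ) (d : ℕ), ∀ z : ℂ, ‖z‖ = 1 →
      W.eval z * conj z ^ d = ((‖Q.eval z‖ ^ 2 - ‖P.eval z‖ ^ 2 : ℝ) : ℂ) := by
  set d := max P.natDegree Q.natDegree
  refine ⟨Q * (Q.map (starRingEnd ℂ)).reflect d - P * (P.map (starRingEnd ℂ)).reflect d, d,
    fun z hz => ?_⟩
  rw [Polynomial.eval_sub, Polynomial.eval_mul, Polynomial.eval_mul, sub_mul, mul_assoc, mul_assoc,
    eval_reflect_map_conj (le_max_left _ _) hz, eval_reflect_map_conj (le_max_right _ _) hz,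
    Complex.mul_conj, Complex.mul_conj, Complex.normSq_eq_norm_sq, Complex.normSq_eq_norm_sq,
    Complex.ofReal_sub]

theorem sub_sq_eq_of_norm_eq_one {z η : ℂ} (hz : ‖z‖ = 1) (hη : ‖η‖ = 1) :
    (z - η) ^ 2 = -(z * η) * ((‖z - η‖ ^ 2 : ℝ) : ℂ) := by
  rw [← Complex.normSq_eq_norm_sq, ← Complex.mul_conj, map_sub]
  linear_combination (z - η) * (η * conj_mul_self_of_norm_eq_one hz
    - z * conj_mul_self_of_norm_eq_one hη)

open scoped ComplexOrder in
theorem deriv_eq_zero_of_nonneg_on_circle {G : ℂ → ℂ} {η : ℂ} (hη : ‖η‖ = 1)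
    (hG : DifferentiableAt ℂ G η) (hGη : G η = 0) (h : ∀ z, ‖z‖ = 1 → 0 ≤ G z) :
    deriv G η = 0 := by
  have hmem (t : ℝ) : ‖η * exp (t * I)‖ = 1 := by
    rw [norm_mul, hη, one_mul, Complex.norm_exp_ofReal_mul_I]
  have hcurve : HasDerivAt (fun t : ℝ => η * exp (t * I)) (η * I) 0 := by
    simpa using ((Complex.ofRealCLM.hasDerivAt (x := 0)).mul_const I).cexp.const_mul η
  have hf : HasDerivAt (fun t : ℝ => G (η * exp (t * I))) (deriv G η * (η * I)) 0 := by
    refine HasDerivAt.comp (h₂ := G) 0 ?_ hcurve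
    simpa using hG.hasDerivAt
  have hre := Complex.reCLM.hasFDerivAt.comp_hasDerivAt 0 hf
  have him := (Complex.imCLM.hasFDerivAt.comp_hasDerivAt 0 hf).congr_of_eventuallyEq
    (.of_forall fun t => (Complex.nonneg_iff.1 (h _ (hmem t))).2)
  have hmin : IsLocalMin (Complex.reCLM ∘ fun t : ℝ => G (η * exp (t * I))) 0 :=
    .of_forall fun t => by simpa [hGη] using (Complex.nonneg_iff.1 (h _ (hmem t))).1
  have hzero : deriv G η * (η * I) = 0 :=
    Complex.ext (hmin.hasDerivAt_eq_zero hre) (him.unique (hasDerivAt_const 0 0))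
  exact (mul_eq_zero.1 hzero).resolve_right
    (mul_ne_zero (norm_ne_zero_iff.1 (hη ▸ one_ne_zero)) I_ne_zero)

open scoped ComplexOrder in
theorem even_rootMultiplicity {W : Polynomial ℂ} (hW : W ≠ 0) {d : ℕ}
    (h : ∀ z : ℂ, ‖z‖ = 1 → 0 ≤ W.eval z * conj z ^ d) {η : ℂ} (hη : ‖η‖ = 1) :
    Even (W.rootMultiplicity η) := by
  by_contra hodd
  obtain ⟨i, hi⟩ := Nat.not_even_iff_odd.1 hodd
  obtain ⟨T, hT0, hT⟩ := exists_eval_eq_pow_rootMultiplicity_mul hW η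
  rw [hi] at hT
  have hη0 : η ≠ 0 := norm_ne_zero_iff.1 (hη ▸ one_ne_zero)
  -- On the circle `W z * conj z ^ d = ‖z - η‖ ^ (2 * i) * (H z * (z - η))`.
  set H : ℂ → ℂ := fun z => (-(z * η)) ^ i * T.eval z / z ^ d with hH
  have hHη : H η ≠ 0 := by simp [hH, hη0, hT0]
  have hHd : DifferentiableAt ℂ H η := by
    refine DifferentiableAt.fun_div ?_ (by fun_prop) (pow_ne_zero d hη0)
    exact DifferentiableAt.fun_mul (by fun_prop) T.differentiable.differentiableAt
  have hderiv : HasDerivAt (fun z => H z * (z - η)) (H η) η := by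
    simpa using hHd.hasDerivAt.fun_mul ((hasDerivAt_id η).sub_const η)
  refine hHη (hderiv.deriv.symm.trans
    (deriv_eq_zero_of_nonneg_on_circle hη hderiv.differentiableAt (by simp) fun z hz => ?_))
  rcases eq_or_ne z η with rfl | hzη
  · simp
  have hpos : 0 < ‖z - η‖ := norm_pos_iff.2 (sub_ne_zero.2 hzη)
  have hinv : (0 : ℂ) ≤ (((‖z - η‖ ^ 2) ^ i)⁻¹ : ℝ) := Complex.zero_le_real.2 (by positivity)
  refine (mul_nonneg hinv (h z hz)).trans_eq ?_
  rw [hT, pow_succ (z - η), pow_mul (z - η), sub_sq_eq_of_norm_eq_one hz hη, mul_pow, hH,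
    Complex.ofReal_inv, Complex.ofReal_pow,
    eq_inv_of_mul_eq_one_left (conj_mul_self_of_norm_eq_one hz), inv_pow]
  have hne : ((‖z - η‖ ^ 2 : ℝ) : ℂ) ^ i ≠ 0 := mod_cast (pow_pos (pow_pos hpos 2) i).ne'
  field_simp

theorem nodePoly_add (s t : Multiset ℂ) : nodePoly (s + t) = nodePoly s * nodePoly t := by
  simp [nodePoly]

theorem exists_add_self_eq_of_even_count {α : Type*} [DecidableEq α] {r : Multiset α}
    (h : ∀ a, Even (r.count a)) : ∃ s, s + s = r := by
  refine ⟨((Multiset.toFinsupp r).mapRange (· / 2) (Nat.zero_div 2)).toMultiset,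
    Multiset.ext.2 fun a => ?_⟩
  rw [Multiset.count_add, Finsupp.count_toMultiset, Finsupp.mapRange_apply,
    Multiset.toFinsupp_apply, ← mul_two, Nat.div_mul_cancel (h a).two_dvd]

theorem exists_eq_nodePoly_sq_mul {W : Polynomial ℂ} (hW : W ≠ 0)
    (h : ∀ η : ℂ, ‖η‖ = 1 → Even (W.rootMultiplicity η)) :
    ∃ (s : Multiset ℂ) (V : Polynomial ℂ), (∀ η ∈ s, ‖η‖ = 1) ∧ W = nodePoly s ^ 2 * V ∧
      ∀ z : ℂ, ‖z‖ = 1 → V.eval z ≠ 0 := by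
  classical
  obtain ⟨s, hs⟩ : ∃ s, s + s = W.roots.filter fun η => ‖η‖ = 1 :=
    exists_add_self_eq_of_even_count fun η => by
      rw [Multiset.count_filter, Polynomial.count_roots]
      split_ifs with hη
      exacts [h η hη, Even.zero]
  obtain ⟨V, hV⟩ := (Multiset.prod_X_sub_C_dvd_iff_le_roots hW (s + s)).2
    (hs ▸ Multiset.filter_le _ _)
  refine ⟨s, V, fun η hη => ?_, by rw [sq, ← nodePoly_add]; exact hV, fun z hz hz0 => ?_⟩
  · have hη' : η ∈ s + s := Multiset.mem_add.2 (Or.inl hη)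
    rw [hs] at hη'
    exact (Multiset.mem_filter.1 hη').2
  · have hWV : nodePoly (s + s) * V ≠ 0 := ne_of_eq_of_ne hV.symm hW
    have hpos := (Polynomial.rootMultiplicity_pos (right_ne_zero_of_mul hWV)).2 hz0
    have hadd := Polynomial.rootMultiplicity_mul (x := z) hWV
    rw [rootMultiplicity_nodePoly, hs, Multiset.count_filter, if_pos hz, Polynomial.count_roots,
      ← hs, show nodePoly (s + s) * V = W from hV.symm] at hadd
    lia

theorem exists_norm_eq_X_sub_C_of_norm_ne_one {α : ℂ} (hα : ‖α‖ ≠ 1) :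
    ∃ A : Polynomial ℂ, (∀ z ∈ closedBall (0 : ℂ) 1, A.eval z ≠ 0) ∧
      ∀ z : ℂ, ‖z‖ = 1 → ‖A.eval z‖ = ‖z - α‖ := by
  rcases lt_or_gt_of_ne hα with hα | hα
  · refine ⟨1 - Polynomial.C (conj α) * Polynomial.X, fun z hz => ?_, fun z hz => ?_⟩
    · simpa using one_sub_conj_mul_ne_zero hα (mem_closedBall_zero_iff.1 hz)
    · have hrefl : 1 - conj α * z = z * conj (z - α) := by
        rw [map_sub]
        linear_combination -conj_mul_self_of_norm_eq_one hz
      simp only [Polynomial.eval_sub, Polynomial.eval_one, Polynomial.eval_mul, Polynomial.eval_C,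
        Polynomial.eval_X, hrefl, norm_mul, hz, one_mul, RCLike.norm_conj]
  · refine ⟨Polynomial.X - Polynomial.C α, fun z hz => ?_, fun z _ => by simp⟩
    rw [Polynomial.eval_sub, Polynomial.eval_X, Polynomial.eval_C, sub_ne_zero]
    rintro rfl
    exact hα.not_ge (mem_closedBall_zero_iff.1 hz)

theorem norm_eval_multiset_prod {α : Type*} (r : Multiset α) (B : α → Polynomial ℂ) (z : ℂ) :
    ‖(r.map B).prod.eval z‖ = (r.map fun a => ‖(B a).eval z‖).prod := by
  induction r using Multiset.induction with
  | empty => simp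
  | cons a r ih => simp [ih]

theorem exists_norm_eq_ne_zero_closedBall {W : Polynomial ℂ}
    (h : ∀ z : ℂ, ‖z‖ = 1 → W.eval z ≠ 0) :
    ∃ A : Polynomial ℂ, (∀ z ∈ closedBall (0 : ℂ) 1, A.eval z ≠ 0) ∧
      ∀ z : ℂ, ‖z‖ = 1 → ‖A.eval z‖ = ‖W.eval z‖ := by
  have hW : W ≠ 0 := by
    rintro rfl
    exact h 1 norm_one Polynomial.eval_zero
  choose! B hB hBα using fun α => exists_norm_eq_X_sub_C_of_norm_ne_one (α := α)
  have hroots : ∀ α ∈ W.roots, ‖α‖ ≠ 1 := fun α hα hα1 =>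
    h α hα1 (Polynomial.isRoot_of_mem_roots hα)
  refine ⟨Polynomial.C W.leadingCoeff * (W.roots.map B).prod, fun z hz => ?_, fun z hz => ?_⟩
  · rw [Polynomial.eval_mul, Polynomial.eval_C, Polynomial.eval_multiset_prod, Multiset.map_map]
    refine mul_ne_zero (Polynomial.leadingCoeff_ne_zero.2 hW) (Multiset.prod_ne_zero fun h0 => ?_)
    obtain ⟨α, hα, h0⟩ := Multiset.mem_map.1 h0
    exact hB α (hroots α hα) z hz h0
  · conv_rhs => rw [(IsAlgClosed.splits W).eq_prod_roots]
    rw [Polynomial.eval_mul, Polynomial.eval_mul, norm_mul, norm_mul, norm_eval_multiset_prod,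
      norm_eval_multiset_prod]
    congr 2
    refine Multiset.map_congr rfl fun α hα => ?_
    rw [hBα α (hroots α hα) z hz, Polynomial.eval_sub, Polynomial.eval_X, Polynomial.eval_C]

open scoped ComplexOrder in
theorem exists_norm_sq_sub_norm_sq_eq {P Q : Polynomial ℂ}
    (hle : ∀ z : ℂ, ‖z‖ = 1 → ‖P.eval z‖ ≤ ‖Q.eval z‖)
    (hne : ∃ z : ℂ, ‖z‖ = 1 ∧ ‖P.eval z‖ ≠ ‖Q.eval z‖) :
    ∃ (s : Multiset ℂ) (A : Polynomial ℂ), (∀ η ∈ s, ‖η‖ = 1) ∧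
      (∀ z ∈ closedBall (0 : ℂ) 1, A.eval z ≠ 0) ∧ ∀ z : ℂ, ‖z‖ = 1 →
        ‖Q.eval z‖ ^ 2 - ‖P.eval z‖ ^ 2 = ‖(nodePoly s).eval z‖ ^ 2 * ‖A.eval z‖ := by
  obtain ⟨W, d, hWd⟩ := exists_eval_mul_conj_pow P Q
  have hnonneg : ∀ z : ℂ, ‖z‖ = 1 → 0 ≤ ‖Q.eval z‖ ^ 2 - ‖P.eval z‖ ^ 2 := fun z hz =>
    sub_nonneg.2 (pow_le_pow_left₀ (norm_nonneg _) (hle z hz) 2)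
  have hW : W ≠ 0 := by
    rintro rfl
    obtain ⟨z, hz, hPQ⟩ := hne
    have h := hWd z hz
    rw [Polynomial.eval_zero, zero_mul, eq_comm, Complex.ofReal_eq_zero, sub_eq_zero,
      sq_eq_sq₀ (norm_nonneg _) (norm_nonneg _)] at h
    exact hPQ h.symm
  obtain ⟨s, V, hs, hWV, hV⟩ := exists_eq_nodePoly_sq_mul hW fun η hη =>
    even_rootMultiplicity hW (d := d)
      (fun z hz => (Complex.zero_le_real.2 (hnonneg z hz)).trans_eq (hWd z hz).symm) hη
  obtain ⟨A, hA, hAV⟩ := exists_norm_eq_ne_zero_closedBall hV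
  refine ⟨s, A, hs, hA, fun z hz => ?_⟩
  have h := congrArg norm (hWd z hz)
  rw [Complex.norm_real, Real.norm_of_nonneg (hnonneg z hz), norm_mul, norm_pow, RCLike.norm_conj,
    hz, one_pow, mul_one, hWV, Polynomial.eval_mul, Polynomial.eval_pow, norm_mul, norm_pow] at h
  rw [← h, hAV z hz]

theorem exists_log_on_ball {f : ℂ → ℂ} {c : ℂ} {R : ℝ}
    (hf : DifferentiableOn ℂ f (ball c R)) (h0 : ∀ z ∈ ball c R, f z ≠ 0) :
    ∃ g : ℂ → ℂ, DifferentiableOn ℂ g (ball c R) ∧ ∀ z ∈ ball c R, exp (g z) = f z := by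
  obtain ⟨g, hgc, hg⟩ :=
    ((hf.deriv isOpen_ball).fun_div hf h0).isExactOn_ball.with_val_at c (log (f c))
  refine ⟨g, fun z hz => (hg z hz).differentiableAt.differentiableWithinAt, fun z hz => ?_⟩
  have hc : c ∈ ball c R := mem_ball_self (pos_of_mem_ball hz)
  have hderiv : ∀ w ∈ ball c R, HasDerivAt (fun w => f w * exp (-g w)) 0 w := fun w hw => by
    have h := (hf.differentiableAt (isOpen_ball.mem_nhds hw)).hasDerivAt.fun_mul
      (hg w hw).fun_neg.cexp
    convert! h using 1
    have := h0 w hw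
    field_simp
    ring
  have hconst : f z * exp (-g z) = f c * exp (-g c) :=
    isOpen_ball.is_const_of_deriv_eq_zero (convex_ball c R).isPreconnected
      (fun w hw => (hderiv w hw).differentiableAt.differentiableWithinAt)
      (fun w hw => (hderiv w hw).deriv) hz hc
  rw [hgc, Complex.exp_neg, Complex.exp_neg, Complex.exp_log (h0 c hc), mul_inv_cancel₀ (h0 c hc),
    mul_inv_eq_one₀ (Complex.exp_ne_zero _)] at hconst
  exact hconst.symm

theorem exists_ball_subset_of_closedBall_subset {U : Set ℂ} (hU : IsOpen U)
    (h : closedBall (0 : ℂ) 1 ⊆ U) : ∃ R : ℝ, 1 < R ∧ ball (0 : ℂ) R ⊆ U := by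
  obtain ⟨δ, hδ, hδU⟩ := (isCompact_closedBall (0 : ℂ) 1).exists_thickening_subset_open hU h
  rw [thickening_closedBall hδ zero_le_one] at hδU
  exact ⟨δ + 1, lt_add_of_pos_left 1 hδ, hδU⟩

/-- A Fejér–Riesz type factorisation `1 - |f|² = |p e ^ g|²` on the unit circle, where `p` is the
monic polynomial with roots `s`, all on the circle. -/
structure IsSpectralFactor (f : ℂ → ℂ) (s : Multiset ℂ) (g : ℂ → ℂ) : Prop where
  norm_eq_one : ∀ η ∈ s, ‖η‖ = 1
  analyticAt : ∀ z ∈ closedBall (0 : ℂ) 1, AnalyticAt ℂ g z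
  one_sub_norm_sq_eq {z : ℂ} : ‖z‖ = 1 → 1 - ‖f z‖ ^ 2 = ‖(nodePoly s).eval z * exp (g z)‖ ^ 2

theorem exists_isSpectralFactor {P Q : Polynomial ℂ}
    (hQ : ∀ z ∈ closedBall (0 : ℂ) 1, Q.eval z ≠ 0)
    (hle : ∀ z : ℂ, ‖z‖ = 1 → ‖P.eval z / Q.eval z‖ ≤ 1)
    (hne : ∃ z : ℂ, ‖z‖ = 1 ∧ ‖P.eval z / Q.eval z‖ ≠ 1) :
    ∃ s g, IsSpectralFactor (fun z => P.eval z / Q.eval z) s g := by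
  have hQpos : ∀ z : ℂ, ‖z‖ = 1 → 0 < ‖Q.eval z‖ := fun z hz =>
    norm_pos_iff.2 (hQ z (mem_closedBall_zero_iff.2 hz.le))
  obtain ⟨s, A, hs, hA, hPQ⟩ := exists_norm_sq_sub_norm_sq_eq (P := P) (Q := Q)
    (fun z hz => by simpa only [norm_div, div_le_one (hQpos z hz)] using hle z hz)
    (hne.imp fun z ⟨hz, hz1⟩ => ⟨hz, fun h => hz1 (by rw [norm_div, h, div_self (hQpos z hz).ne'])⟩)
  have hopen : IsOpen {z : ℂ | (A * Q).eval z ≠ 0} :=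
    isOpen_ne_fun (A * Q).continuous continuous_const
  obtain ⟨R, hR, hball⟩ := exists_ball_subset_of_closedBall_subset hopen
    fun z hz => by simpa using And.intro (hA z hz) (hQ z hz)
  have hAQ : ∀ z ∈ ball (0 : ℂ) R, A.eval z ≠ 0 ∧ Q.eval z ≠ 0 := fun z hz => by
    simpa using hball hz
  obtain ⟨g, hg, hgexp⟩ := exists_log_on_ball (f := fun z => A.eval z / Q.eval z ^ 2)
    (A.differentiable.differentiableOn.fun_div (Q.differentiable.pow 2).differentiableOn
      fun z hz => pow_ne_zero 2 (hAQ z hz).2)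
    fun z hz => div_ne_zero (hAQ z hz).1 (pow_ne_zero 2 (hAQ z hz).2)
  refine ⟨s, fun z => g z / 2, hs, fun z hz => (hg.div_const 2).analyticAt
    (isOpen_ball.mem_nhds (closedBall_subset_ball hR hz)), fun {z} hz => ?_⟩
  have hexp : ‖exp (g z / 2)‖ ^ 2 = ‖A.eval z‖ / ‖Q.eval z‖ ^ 2 := by
    rw [← norm_pow, ← Complex.exp_nat_mul, Nat.cast_ofNat, mul_div_cancel₀ _ two_ne_zero,
      hgexp z (mem_ball_zero_iff.2 (hz.trans_lt hR)), norm_div, norm_pow]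
  rw [norm_mul, mul_pow, hexp, norm_div, div_pow, ← mul_div_assoc, ← hPQ z hz, sub_div,
    div_self (pow_ne_zero 2 (hQpos z hz).ne')]

namespace IsSpectralFactor

variable {f : ℂ → ℂ} {s : Multiset ℂ} {g : ℂ → ℂ} (h : IsSpectralFactor f s g)
include h

theorem norm_sq_le_one {z : ℂ} (hz : ‖z‖ = 1) : ‖f z‖ ^ 2 ≤ 1 :=
  sub_nonneg.1 ((sq_nonneg _).trans_eq (h.one_sub_norm_sq_eq hz).symm)

theorem continuousOn : ContinuousOn g (closedBall 0 1) := fun z hz =>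
  (h.analyticAt z hz).continuousAt.continuousWithinAt

theorem exists_norm_sq_comparable : ∃ M : ℝ, 0 ≤ M ∧ ∀ z : ℂ, ‖z‖ = 1 →
    1 - ‖f z‖ ^ 2 ≤ M * ‖(nodePoly s).eval z‖ ^ 2 ∧
      ‖(nodePoly s).eval z‖ ^ 2 ≤ M * (1 - ‖f z‖ ^ 2) := by
  obtain ⟨K, hK⟩ := (isCompact_closedBall (0 : ℂ) 1).exists_bound_of_continuousOn h.continuousOn
  refine ⟨Real.exp K ^ 2, by positivity, fun z hz => ?_⟩
  have hgz := abs_le.1 ((Complex.abs_re_le_norm _).trans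
    (hK z (mem_closedBall_zero_iff.2 hz.le)))
  rw [h.one_sub_norm_sq_eq hz, ← mul_pow, ← mul_pow, norm_mul, Complex.norm_exp]
  constructor
  · rw [mul_comm]
    gcongr
    exact hgz.2
  · refine pow_le_pow_left₀ (norm_nonneg _) ?_ 2
    rw [mul_left_comm, ← Real.exp_add]
    exact le_mul_of_one_le_right (norm_nonneg _) (Real.one_le_exp (by linarith [hgz.1]))

end IsSpectralFactor

theorem nodePoly_eval_eq_zero {s : Multiset ℂ} {η : ℂ} : (nodePoly s).eval η = 0 ↔ η ∈ s := by
  classical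
  rw [← Multiset.count_pos, ← rootMultiplicity_nodePoly,
    Polynomial.rootMultiplicity_pos (nodePoly_ne_zero s), Polynomial.IsRoot]

theorem exists_forall_norm_le_mul_of_isCompact {X 𝕜 : Type*} [TopologicalSpace X] [NormedField 𝕜]
    {K : Set X} (hK : IsCompact K) {u v : X → 𝕜}
    (h : ∀ x ∈ K, ∃ G, ContinuousWithinAt G K x ∧ ∀ᶠ z in 𝓝[K] x, u z = v z * G z) :
    ∃ D : ℝ, 0 ≤ D ∧ ∀ z ∈ K, ‖u z‖ ≤ D * ‖v z‖ := by
  refine hK.induction_on (p := fun t => ∃ D : ℝ, 0 ≤ D ∧ ∀ z ∈ t, ‖u z‖ ≤ D * ‖v z‖)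
    ⟨0, le_rfl, by simp⟩ (fun t t' ht ⟨D, hD0, hD⟩ => ⟨D, hD0, fun z hz => hD z (ht hz)⟩)
    (fun t t' ⟨D, hD0, hD⟩ ⟨D', _, hD'⟩ => ?_) fun x hx => ?_
  · refine ⟨max D D', le_max_of_le_left hD0, fun z hz => ?_⟩
    rcases hz with hz | hz
    · exact (hD z hz).trans (by gcongr; exact le_max_left _ _)
    · exact (hD' z hz).trans (by gcongr; exact le_max_right _ _)
  · obtain ⟨G, hG, hu⟩ := h x hx
    have hbound : ∀ᶠ z in 𝓝[K] x, ‖u z‖ ≤ (‖G x‖ + 1) * ‖v z‖ := by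
      filter_upwards [hu, hG.norm.eventually_lt_const (lt_add_one _)] with z huz hGz
      rw [huz, norm_mul, mul_comm]
      gcongr
    exact ⟨_, hbound, _, by positivity, fun z hz => hz⟩

theorem exists_eq_add_eval_mul_of_eval_ne_zero {F : ℂ → ℂ} {η : ℂ} (hF : AnalyticAt ℂ F η)
    (c : Polynomial ℂ) {P : Polynomial ℂ} (hP : P.eval η ≠ 0) :
    ∃ G, AnalyticAt ℂ G η ∧ ∀ᶠ z in 𝓝 η, F z = c.eval z + P.eval z * G z := by
  refine ⟨fun z => (F z - c.eval z) / P.eval z,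
    (hF.sub (analyticAt_eval c η)).div (analyticAt_eval P η) hP, ?_⟩
  filter_upwards [P.continuous.continuousAt.eventually_ne hP] with z hz
  rw [mul_div_cancel₀ _ hz, add_sub_cancel]

theorem exists_eq_add_sub_mul {F : ℂ → ℂ} {η : ℂ} (hF : AnalyticAt ℂ F η) :
    ∃ G, AnalyticAt ℂ G η ∧ ∀ z, F z = F η + (z - η) * G z := by
  obtain ⟨p, hp⟩ := hF
  refine ⟨dslope F η, ⟨_, hp.has_fpower_series_dslope_fslope⟩, fun z => ?_⟩
  rw [← smul_eq_mul, sub_smul_dslope, add_sub_cancel]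

theorem exists_hermite_interpolation (s : Multiset ℂ) (F : ℂ → ℂ → ℂ)
    (hF : ∀ η ∈ s, AnalyticAt ℂ (F η) η) :
    ∃ c : Polynomial ℂ, ∀ η ∈ s, ∃ G, AnalyticAt ℂ G η ∧
      ∀ᶠ z in 𝓝 η, F η z = c.eval z + (nodePoly s).eval z * G z := by
  induction s using Multiset.induction generalizing F with
  | empty => exact ⟨0, by simp⟩
  | cons ζ s ih =>
    have hdiv : ∀ η ∈ ζ ::ₘ s, ∃ F', AnalyticAt ℂ F' η ∧
        ∀ᶠ z in 𝓝 η, F η z = F ζ ζ + (z - ζ) * F' z := fun η hη => by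
      by_cases hηζ : η = ζ
      · subst hηζ
        exact (exists_eq_add_sub_mul (hF η hη)).imp fun G hG => ⟨hG.1, .of_forall hG.2⟩
      · obtain ⟨G, hG, hFG⟩ := exists_eq_add_eval_mul_of_eval_ne_zero (hF η hη) (.C (F ζ ζ))
          (P := Polynomial.X - .C ζ) (by simpa [sub_eq_zero] using hηζ)
        exact ⟨G, hG, hFG.mono fun z hz => by simpa using hz⟩
    choose! F' hF' hFF' using hdiv
    obtain ⟨c, hc⟩ := ih F' fun η hη => hF' η (Multiset.mem_cons_of_mem hη)
    refine ⟨.C (F ζ ζ) + (Polynomial.X - .C ζ) * c, fun η hη => ?_⟩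
    obtain ⟨G, hG, hF'G⟩ : ∃ G, AnalyticAt ℂ G η ∧
        ∀ᶠ z in 𝓝 η, F' η z = c.eval z + (nodePoly s).eval z * G z := by
      by_cases hηs : η ∈ s
      · exact hc η hηs
      · exact exists_eq_add_eval_mul_of_eval_ne_zero (hF' η hη) c (mt nodePoly_eval_eq_zero.1 hηs)
    refine ⟨G, hG, ?_⟩
    filter_upwards [hF'G, hFF' η hη] with z hz hz'
    rw [hz', hz, nodePoly_cons]
    simp only [Polynomial.eval_add, Polynomial.eval_mul, Polynomial.eval_sub, Polynomial.eval_C,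
      Polynomial.eval_X]
    ring

theorem sub_eq_sub_of_exp_eq_exp {U : Set ℂ} (hU : IsOpen U) (hU' : IsPreconnected U) {L ℓ : ℂ → ℂ}
    (hL : DifferentiableOn ℂ L U) (hℓ : DifferentiableOn ℂ ℓ U)
    (h : ∀ z ∈ U, exp (L z) = exp (ℓ z)) {z w : ℂ} (hz : z ∈ U) (hw : w ∈ U) :
    L z - ℓ z = L w - ℓ w := by
  refine hU.is_const_of_deriv_eq_zero hU' (hL.sub hℓ) (fun x hx => ?_) hz hw
  have hexp : (fun y => exp ((L - ℓ) y)) =ᶠ[𝓝 x] fun _ => 1 := by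
    filter_upwards [hU.mem_nhds hx] with y hy
    rw [Pi.sub_apply, Complex.exp_sub, h y hy, div_self (exp_ne_zero _)]
  have hderiv := (((hL.sub hℓ).differentiableAt (hU.mem_nhds hx)).hasDerivAt.cexp).unique
    ((hasDerivAt_const x 1).congr_of_eventuallyEq hexp)
  exact (mul_eq_zero.1 hderiv).resolve_left (exp_ne_zero _)

theorem exists_log_extension {L f : ℂ → ℂ} {η : ℂ} (hη : ‖η‖ = 1)
    (hL : DifferentiableOn ℂ L (ball 0 1)) (hf : AnalyticAt ℂ f η) (hf0 : f η ≠ 0)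
    (h : ∀ z ∈ ball (0 : ℂ) 1, exp (L z) = f z) :
    ∃ ℓ, AnalyticAt ℂ ℓ η ∧ ∀ᶠ z in 𝓝[ball 0 1] η, ℓ z = L z := by
  obtain ⟨ε, hε, hball⟩ := Metric.eventually_nhds_iff_ball.1
    (hf.eventually_analyticAt.and (hf.continuousAt.eventually_ne hf0))
  obtain ⟨ℓ, hℓ, hℓf⟩ := exists_log_on_ball
    (fun z hz => (hball z hz).1.differentiableAt.differentiableWithinAt) fun z hz => (hball z hz).2
  have hUη : ball η ε ∩ ball (0 : ℂ) 1 ∈ 𝓝[ball (0 : ℂ) 1] η :=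
    inter_mem (mem_nhdsWithin_of_mem_nhds (ball_mem_nhds η hε)) self_mem_nhdsWithin
  have := nhdsWithin_ball_neBot hη
  obtain ⟨z₀, hz₀⟩ := nonempty_of_mem hUη
  refine ⟨fun z => ℓ z + (L z₀ - ℓ z₀),
    (hℓ.analyticAt (ball_mem_nhds η hε)).add analyticAt_const, ?_⟩
  filter_upwards [hUη] with z hz
  rw [← sub_eq_sub_of_exp_eq_exp (isOpen_ball.inter isOpen_ball)
    ((convex_ball η ε).inter (convex_ball 0 1)).isPreconnected (hL.mono Set.inter_subset_right)
    (hℓ.mono Set.inter_subset_left) (fun w hw => (h w hw.2).trans (hℓf w hw.1).symm) hz hz₀,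
    add_sub_cancel]

theorem one_sub_rpow_le_and_of_one_le {r y : ℝ} (hr : 1 ≤ r) (h0 : 0 ≤ y) (h1 : y ≤ 1) :
    1 - y ^ r ≤ r * (1 - y) ∧ 1 - y ≤ r * (1 - y ^ r) := by
  have bernoulli := one_add_mul_self_le_rpow_one_add (s := y - 1) (by linarith) hr
  rw [add_sub_cancel] at bernoulli
  have hle : y ^ r ≤ y := by
    simpa using Real.rpow_le_rpow_of_exponent_ge' h0 h1 zero_le_one hr
  exact ⟨by linarith, by nlinarith⟩

theorem exists_one_sub_rpow_le {r : ℝ} (hr : 0 < r) :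
    ∃ C : ℝ, 0 ≤ C ∧ ∀ y : ℝ, 0 ≤ y → y ≤ 1 →
      1 - y ^ r ≤ C * (1 - y) ∧ 1 - y ≤ C * (1 - y ^ r) := by
  rcases le_total 1 r with h | h
  · exact ⟨r, hr.le, fun y => one_sub_rpow_le_and_of_one_le h⟩
  · refine ⟨r⁻¹, (inv_pos.2 hr).le, fun y h0 h1 => ?_⟩
    have hinv := one_sub_rpow_le_and_of_one_le ((one_le_inv₀ hr).2 h) (Real.rpow_nonneg h0 r)
      (Real.rpow_le_one h0 h1 hr.le)
    rw [Real.rpow_rpow_inv h0 hr.ne'] at hinv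
    exact hinv.symm

theorem conj_inv_of_norm_eq_one {z : ℂ} (hz : ‖z‖ = 1) : conj z⁻¹ = z := by
  rw [map_inv₀]
  exact inv_eq_of_mul_eq_one_right (conj_mul_self_of_norm_eq_one hz)

theorem analyticAt_conj_conj_inv {F : ℂ → ℂ} {η : ℂ} (hη : ‖η‖ = 1) (hF : AnalyticAt ℂ F η) :
    AnalyticAt ℂ (fun z => conj (F (conj z⁻¹))) η := by
  have hη0 : η ≠ 0 := norm_ne_zero_iff.1 (hη ▸ one_ne_zero)
  have hcont : Tendsto (fun z : ℂ => conj z⁻¹) (𝓝 η) (𝓝 η) := by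
    have hc := (Complex.continuous_conj.continuousAt.comp (continuousAt_inv₀ hη0)).tendsto
    rwa [Function.comp_apply, conj_inv_of_norm_eq_one hη] at hc
  rw [analyticAt_iff_eventually_differentiableAt]
  filter_upwards [hcont.eventually hF.eventually_analyticAt, isOpen_ne.mem_nhds hη0] with z hz hz0
  have hconj : DifferentiableAt ℂ (fun w => conj (F (conj w))) z⁻¹ := by
    have hcc := hz.differentiableAt.conj_conj
    rwa [Complex.conj_conj] at hcc
  exact hconj.comp z (differentiableAt_inv hz0)

namespace IsDiscExtension

variable {b : SchurFunction} {B : discAlgebra} (hB : IsDiscExtension b B)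
include hB

theorem eventually_eq_sphere {η : ℂ} {F : ℂ → ℂ} (hF : IsAnalyticExtensionAt b η F) :
    ∀ᶠ z in 𝓝[sphere (0 : ℂ) 1] η, B.1 z = F z := by
  have hFb : ∀ᶠ z in 𝓝 η, ∀ᶠ w in 𝓝 z, w ∈ ball (0 : ℂ) 1 → F w = b w :=
    eventually_eventually_nhds.2 (eventually_nhdsWithin_iff.1 hF.2)
  filter_upwards [mem_nhdsWithin_of_mem_nhds hFb,
    mem_nhdsWithin_of_mem_nhds hF.1.eventually_analyticAt, self_mem_nhdsWithin] with z hz hFz hz1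
  have := nhdsWithin_ball_neBot (mem_sphere_zero_iff_norm.1 hz1)
  have hBz : Tendsto B.1 (𝓝[ball 0 1] z) (𝓝 (B.1 z)) :=
    (continuousOn_closedBall B z (sphere_subset_closedBall hz1)).mono ball_subset_closedBall
  refine tendsto_nhds_unique hBz
    ((hFz.continuousAt.tendsto.mono_left nhdsWithin_le_nhds).congr' ?_)
  filter_upwards [eventually_nhdsWithin_iff.2 hz, self_mem_nhdsWithin] with w hw hwb
  rw [hw, hB hwb]

theorem norm_eq_of_norm_eq {u : ℂ → ℝ} (hu : ContinuousOn u (closedBall 0 1))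
    (hbu : ∀ z ∈ ball (0 : ℂ) 1, ‖b z‖ = u z) {z : ℂ} (hz : ‖z‖ ≤ 1) : ‖B.1 z‖ = u z :=
  Set.EqOn.of_subset_closure (s := ball 0 1) (fun w hw => by simp only [hB hw, hbu w hw])
    (continuousOn_closedBall B).norm hu ball_subset_closedBall (closure_ball _ one_ne_zero).ge
    (mem_closedBall_zero_iff.2 hz)

/-- Interpolating the germs of `conj (b (1 / conj z))`, which is `conj b` on the circle, gives a
polynomial that agrees with `conj b` on the circle up to a multiple of the node polynomial. -/
theorem exists_norm_conj_sub_eval_le {s : Multiset ℂ} (hs : ∀ η ∈ s, ‖η‖ = 1)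
    (hext : ∀ η ∈ s, ∃ F, IsAnalyticExtensionAt b η F) :
    ∃ (c : Polynomial ℂ) (D : ℝ), 0 ≤ D ∧ ∀ z ∈ sphere (0 : ℂ) 1,
      ‖conj (B.1 z) - c.eval z‖ ≤ D * ‖(nodePoly s).eval z‖ := by
  choose! F hF using hext
  obtain ⟨c, hc⟩ := exists_hermite_interpolation s (fun η z => conj (F η (conj z⁻¹))) fun η hη =>
    analyticAt_conj_conj_inv (hs η hη) (hF η hη).1
  have hBc : ContinuousOn (fun z => conj (B.1 z) - c.eval z) (sphere 0 1) :=
    (Complex.continuous_conj.comp_continuousOn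
      ((continuousOn_closedBall B).mono sphere_subset_closedBall)).sub c.continuous.continuousOn
  refine ⟨c, exists_forall_norm_le_mul_of_isCompact (isCompact_sphere 0 1) fun x hx => ?_⟩
  by_cases hxs : x ∈ s
  · obtain ⟨G, hG, hFG⟩ := hc x hxs
    refine ⟨G, hG.continuousAt.continuousWithinAt, ?_⟩
    filter_upwards [hB.eventually_eq_sphere (hF x hxs), mem_nhdsWithin_of_mem_nhds hFG,
      self_mem_nhdsWithin] with z hBz hz hz1
    rw [conj_inv_of_norm_eq_one (mem_sphere_zero_iff_norm.1 hz1)] at hz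
    rw [hBz, hz, add_sub_cancel_left]
  · have hx0 := mt nodePoly_eval_eq_zero.1 hxs
    refine ⟨_, (hBc x hx).div (nodePoly s).continuous.continuousWithinAt hx0, ?_⟩
    filter_upwards [mem_nhdsWithin_of_mem_nhds
      ((nodePoly s).continuous.continuousAt.eventually_ne hx0)] with z hz
    exact (mul_div_cancel₀ _ hz).symm

theorem isBoundaryWeight {s : Multiset ℂ} (hs : ∀ η ∈ s, ‖η‖ = 1)
    (hext : ∀ η ∈ s, ∃ F, IsAnalyticExtensionAt b η F) {C : ℝ} (hC : 0 ≤ C)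
    (hle : ∀ z : ℂ, ‖z‖ = 1 → 1 - ‖B.1 z‖ ^ 2 ≤ C * ‖(nodePoly s).eval z‖ ^ 2)
    (hge : ∀ z : ℂ, ‖z‖ = 1 → ‖(nodePoly s).eval z‖ ^ 2 ≤ C * (1 - ‖B.1 z‖ ^ 2)) :
    IsBoundaryWeight b s := by
  obtain ⟨c, D, hD, hc⟩ := hB.exists_norm_conj_sub_eval_le hs hext
  refine ⟨hs, ⟨_, Real.sqrt_nonneg _, hB.norm_kernelSum_le (p := nodeWeight s)
    (κ := polynomialFun c) (C := C) (fun θ => ?_) hD fun θ => ?_⟩,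
    ⟨_, by positivity, hB.norm_mul_szegoSum_le (p := nodeWeight s) hC fun θ => ?_⟩, hext⟩
  · simpa only [boundary_apply, nodeWeight_apply] using hle _ (Circle.norm_coe _)
  · simpa only [boundary_apply, nodeWeight_apply, polynomialFun_apply]
      using hc _ (mem_sphere_zero_iff_norm.2 (Circle.norm_coe _))
  · simpa only [boundary_apply, nodeWeight_apply] using hge _ (Circle.norm_coe _)

end IsDiscExtension

/-- `b = f ^ r`, where the power is computed with the logarithm `L` of `f` and `f` is analytic
across the unit circle. -/
structure IsPower (b : SchurFunction) (f L : ℂ → ℂ) (r : ℝ) : Prop where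
  pos : 0 < r
  differentiableOn_log : DifferentiableOn ℂ L (ball 0 1)
  exp_log : ∀ z ∈ ball (0 : ℂ) 1, exp (L z) = f z
  eq_exp : ∀ z ∈ ball (0 : ℂ) 1, b z = exp (r * L z)
  analyticAt : ∀ z ∈ closedBall (0 : ℂ) 1, AnalyticAt ℂ f z

namespace IsPower

variable {b : SchurFunction} {f L : ℂ → ℂ} {r : ℝ} (h : IsPower b f L r)
include h

theorem norm_eq {z : ℂ} (hz : z ∈ ball (0 : ℂ) 1) : ‖b z‖ = ‖f z‖ ^ r := by
  rw [h.eq_exp z hz, ← h.exp_log z hz, Complex.norm_exp, Complex.norm_exp, Complex.re_ofReal_mul,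
    mul_comm, Real.exp_mul]

theorem continuousOn_norm_rpow : ContinuousOn (fun z => ‖f z‖ ^ r) (closedBall 0 1) := fun z hz =>
  ((h.analyticAt z hz).continuousAt.norm.rpow_const (Or.inr h.pos.le)).continuousWithinAt

theorem exists_extension {η : ℂ} (hη : ‖η‖ = 1) (hf : f η ≠ 0) :
    ∃ F, IsAnalyticExtensionAt b η F := by
  obtain ⟨ℓ, hℓ, hℓL⟩ := exists_log_extension hη h.differentiableOn_log
    (h.analyticAt η (mem_closedBall_zero_iff.2 hη.le)) hf h.exp_log
  refine ⟨fun z => exp (r * ℓ z), (analyticAt_const.mul hℓ).cexp, ?_⟩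
  filter_upwards [hℓL, self_mem_nhdsWithin] with z hℓz hz
  rw [hℓz, h.eq_exp z hz]

theorem exists_tendsto {z : ℂ} (hz : z ∈ closedBall (0 : ℂ) 1) :
    ∃ y, Tendsto b.toFun (𝓝[ball 0 1] z) (𝓝 y) := by
  by_cases hfz : f z = 0
  · refine ⟨0, tendsto_zero_iff_norm_tendsto_zero.2 ?_⟩
    have hlim := ((h.continuousOn_norm_rpow z hz).mono ball_subset_closedBall).tendsto
    rw [hfz, norm_zero, Real.zero_rpow h.pos.ne'] at hlim
    refine hlim.congr' ?_
    filter_upwards [self_mem_nhdsWithin] with w hw using (h.norm_eq hw).symm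
  · by_cases hzb : z ∈ ball (0 : ℂ) 1
    · exact ⟨_, b.differentiableOn.continuousOn z hzb⟩
    · have hz1 : ‖z‖ = 1 := le_antisymm (by simpa using hz) (by simpa using hzb)
      obtain ⟨F, hF, hFb⟩ := h.exists_extension hz1 hfz
      exact ⟨_, (hF.continuousAt.tendsto.mono_left nhdsWithin_le_nhds).congr' hFb⟩

theorem exists_isDiscExtension : ∃ B, IsDiscExtension b B := by
  have hcl : closure (ball (0 : ℂ) 1) = closedBall 0 1 := closure_ball _ one_ne_zero
  have hEq : Set.EqOn (extendFrom (ball (0 : ℂ) 1) b.toFun) b (ball 0 1) := fun z hz =>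
    extendFrom_eq (subset_closure hz) (b.differentiableOn.continuousOn z hz)
  have hcont : ContinuousOn (extendFrom (ball (0 : ℂ) 1) b.toFun) (closedBall 0 1) :=
    continuousOn_extendFrom hcl.ge fun z hz => h.exists_tendsto hz
  exact ⟨⟨_, b.differentiableOn.congr hEq, hcl ▸ hcont⟩, hEq⟩

theorem isBoundaryWeight {s : Multiset ℂ} {g : ℂ → ℂ} (hfg : IsSpectralFactor f s g) :
    IsBoundaryWeight b s := by
  obtain ⟨B, hB⟩ := h.exists_isDiscExtension
  have hfs : ∀ η ∈ s, f η ≠ 0 := fun η hη hfη => by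
    simpa [hfη, nodePoly_eval_eq_zero.2 hη] using hfg.one_sub_norm_sq_eq (hfg.norm_eq_one η hη)
  have hBf : ∀ z : ℂ, ‖z‖ = 1 → ‖B.1 z‖ ^ 2 = (‖f z‖ ^ 2) ^ r := fun z hz => by
    rw [hB.norm_eq_of_norm_eq h.continuousOn_norm_rpow (fun w => h.norm_eq) hz.le,
      ← Real.rpow_natCast_mul (norm_nonneg _), ← Real.rpow_mul_natCast (norm_nonneg _), mul_comm]
  obtain ⟨C, hC, hrpow⟩ := exists_one_sub_rpow_le h.pos
  obtain ⟨M, hM, hfM⟩ := hfg.exists_norm_sq_comparable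
  have hcomp := fun z hz => hrpow (‖f z‖ ^ 2) (sq_nonneg _) (hfg.norm_sq_le_one (z := z) hz)
  refine hB.isBoundaryWeight hfg.norm_eq_one
    (fun η hη => h.exists_extension (hfg.norm_eq_one η hη) (hfs η hη)) (mul_nonneg hC hM)
    (fun z hz => ?_) fun z hz => ?_
  · rw [hBf z hz, mul_assoc]
    exact (hcomp z hz).1.trans (mul_le_mul_of_nonneg_left (hfM z hz).1 hC)
  · rw [hBf z hz, mul_comm C M, mul_assoc]
    exact (hfM z hz).2.trans (mul_le_mul_of_nonneg_left (hcomp z hz).2 hM)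

end IsPower

theorem norm_eq_one_of_norm_eq_one_on_sphere {f : ℂ → ℂ} (hf : DiffContOnCl ℂ f (ball 0 1))
    (h0 : ∀ z ∈ ball (0 : ℂ) 1, f z ≠ 0) (h1 : ∀ z : ℂ, ‖z‖ = 1 → ‖f z‖ = 1) {z : ℂ}
    (hz : z ∈ ball (0 : ℂ) 1) : ‖f z‖ = 1 := by
  have hfr : ∀ w ∈ frontier (ball (0 : ℂ) 1), ‖f w‖ = 1 := fun w hw =>
    h1 w (mem_sphere_zero_iff_norm.1 (frontier_ball (0 : ℂ) one_ne_zero ▸ hw))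
  have hne : ∀ w ∈ closure (ball (0 : ℂ) 1), f w ≠ 0 := fun w hw => by
    rw [closure_ball _ one_ne_zero, ← ball_union_sphere] at hw
    rcases hw with hw | hw
    · exact h0 w hw
    · exact norm_ne_zero_iff.1 (h1 w (mem_sphere_zero_iff_norm.1 hw) ▸ one_ne_zero)
  have hinv : ‖(f z)⁻¹‖ ≤ 1 := Complex.norm_le_of_forall_mem_frontier_norm_le isBounded_ball
    (hf.inv hne) (fun w hw => by rw [Pi.inv_apply, norm_inv, hfr w hw, inv_one]) (subset_closure hz)
  rw [norm_inv] at hinv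
  exact le_antisymm (Complex.norm_le_of_forall_mem_frontier_norm_le isBounded_ball hf
    (fun w hw => (hfr w hw).le) (subset_closure hz))
    ((inv_le_one₀ (norm_pos_iff.2 (h0 z hz))).1 hinv)

theorem spaceFunctions_eq_bot {b : SchurFunction} (h : ∀ z ∈ ball (0 : ℂ) 1, ‖b z‖ = 1) :
    spaceFunctions b = ⊥ := by
  rw [eq_bot_iff]
  rintro _ ⟨f, rfl⟩
  rw [Submodule.mem_bot]
  funext z
  have hk : kernelVec b z = 0 := by
    rw [← inner_self_eq_zero (𝕜 := ℂ), inner_kernelVec, kernelVec_apply, kernelFun,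
      Complex.conj_mul', h z (mem_ball_zero_iff.2 z.norm_lt_one)]
    simp
  exact (inner_kernelVec b z f).symm.trans (by rw [hk, inner_zero_left, Pi.zero_apply])

/-- An analytic continuation `f` of `q` across the unit circle, either unimodular on the circle or
with a spectral factor of `1 - |f|²`. -/
structure IsContinuation (q : SchurFunction) (f : ℂ → ℂ) : Prop where
  analyticAt : ∀ z ∈ closedBall (0 : ℂ) 1, AnalyticAt ℂ f z
  eq : Set.EqOn q f (ball 0 1)
  norm_eq_one_or : (∀ z : ℂ, ‖z‖ = 1 → ‖f z‖ = 1) ∨ ∃ s g, IsSpectralFactor f s g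

theorem exists_isContinuation (q : SchurFunction) (hrat : IsRational q) :
    ∃ f, IsContinuation q f := by
  obtain ⟨P, Q, hQ, hq⟩ := exists_eq_div_ne_zero_closedBall q hrat
  have hf : ∀ z ∈ closedBall (0 : ℂ) 1, AnalyticAt ℂ (fun z => P.eval z / Q.eval z) z :=
    fun z hz => (analyticAt_eval P z).div (analyticAt_eval Q z) (hQ z hz)
  have hcl : closure (ball (0 : ℂ) 1) = closedBall 0 1 := closure_ball _ one_ne_zero
  have hle : ∀ z ∈ closedBall (0 : ℂ) 1, ‖P.eval z / Q.eval z‖ ≤ 1 := fun z hz =>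
    le_on_closure (s := ball 0 1) (fun w hw => hq w hw ▸ q.norm_le_one w hw)
      (fun w hw => (hf w (hcl.subset hw)).continuousAt.norm.continuousWithinAt)
      continuousOn_const (hcl.superset hz)
  refine ⟨_, hf, hq, or_iff_not_imp_left.2 fun hne => exists_isSpectralFactor hQ
    (fun z hz => hle z (mem_closedBall_zero_iff.2 hz.le)) (by push Not at hne; exact hne)⟩

namespace IsContinuation

variable {q : SchurFunction} {f : ℂ → ℂ} (h : IsContinuation q f)
include h

theorem continuousOn : ContinuousOn f (closedBall 0 1) := fun z hz =>
  (h.analyticAt z hz).continuousAt.continuousWithinAt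

theorem diffContOnCl : DiffContOnCl ℂ f (ball 0 1) :=
  DifferentiableOn.diffContOnCl fun z hz => (h.analyticAt z
    (closure_ball (0 : ℂ) one_ne_zero ▸ hz)).differentiableAt.differentiableWithinAt

theorem isPower_power (L : LogBranch q) {r : ℝ} (hr : 0 < r) :
    IsPower (q.power L r hr) f L.toFun r where
  pos := hr
  differentiableOn_log := L.differentiableOn
  exp_log z hz := (L.exp_eq z hz).trans (h.eq hz)
  eq_exp _ _ := rfl
  analyticAt := h.analyticAt

theorem isPower_self (L : LogBranch q) : IsPower q f L.toFun 1 where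
  pos := one_pos
  differentiableOn_log := L.differentiableOn
  exp_log z hz := (L.exp_eq z hz).trans (h.eq hz)
  eq_exp z hz := by rw [Complex.ofReal_one, one_mul, L.exp_eq z hz]
  analyticAt := h.analyticAt

theorem spaceFunctions_power_eq (L : LogBranch q) {r : ℝ} (hr : 0 < r) :
    spaceFunctions (q.power L r hr) = spaceFunctions q := by
  have hpow := h.isPower_power L hr
  rcases h.norm_eq_one_or with hf1 | ⟨s, g, hfg⟩
  · have hf : ∀ z ∈ ball (0 : ℂ) 1, ‖f z‖ = 1 := fun z =>
      norm_eq_one_of_norm_eq_one_on_sphere h.diffContOnCl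
        (fun w hw => hpow.exp_log w hw ▸ exp_ne_zero _) hf1
    rw [spaceFunctions_eq_bot fun z hz => by rw [hpow.norm_eq hz, hf z hz, Real.one_rpow],
      spaceFunctions_eq_bot fun z hz => by rw [h.eq hz, hf z hz]]
  · rw [(hpow.isBoundaryWeight hfg).spaceFunctions_eq_range,
      ((h.isPower_self L).isBoundaryWeight hfg).spaceFunctions_eq_range]

end IsContinuation

theorem tendsto_circleAverage_of_dominated {ι E : Type*} [NormedAddCommGroup E] [NormedSpace ℝ E]
    {F : ι → ℂ → E} {G : ℂ → E} {l : Filter ι} [l.IsCountablyGenerated] {c : ℂ} {R : ℝ}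
    {bound : ℂ → ℝ} (hF : ∀ᶠ t in l, CircleIntegrable (F t) c R)
    (hle : ∀ᶠ t in l, ∀ ζ ∈ sphere c |R|, ‖F t ζ‖ ≤ bound ζ) (hbound : CircleIntegrable bound c R)
    (hlim : ∀ᵐ θ : ℝ, Tendsto (fun t => F t (circleMap c R θ)) l (𝓝 (G (circleMap c R θ)))) :
    Tendsto (fun t => Real.circleAverage (F t) c R) l (𝓝 (Real.circleAverage G c R)) :=
  (intervalIntegral.tendsto_integral_filter_of_dominated_convergence
    (fun θ => bound (circleMap c R θ))
    (hF.mono fun _ ht => (intervalIntegrable_iff.1 ht).aestronglyMeasurable)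
    (hle.mono fun _ ht => Eventually.of_forall fun θ _ => ht _ (circleMap_mem_sphere' c R θ))
    hbound (hlim.mono fun _ hθ _ => hθ)).const_smul (2 * Real.pi)⁻¹

theorem poissonKernel_nonneg {z ζ : ℂ} (hz : z ∈ ball (0 : ℂ) 1) (hζ : ζ ∈ sphere (0 : ℂ) |1|) :
    0 ≤ poissonKernel 0 z ζ := by
  rw [abs_one, mem_sphere_zero_iff_norm] at hζ
  rw [poissonKernel_def, sub_zero, sub_zero, hζ, one_pow]
  exact div_nonneg (sub_nonneg.2 <| pow_le_one₀ (norm_nonneg z) (mem_ball_zero_iff.1 hz).le)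
    (sq_nonneg _)

theorem continuousOn_poissonKernel {z : ℂ} (hz : z ∈ ball (0 : ℂ) 1) :
    ContinuousOn (poissonKernel 0 z) (sphere 0 |1|) := by
  rw [poissonKernel_eq_re_herglotzRieszKernel]
  exact Complex.continuous_re.comp_continuousOn (continuousOn_herglotzRieszKernel_sphere hz)

theorem circleIntegrable_poissonKernel_mul {z : ℂ} (hz : z ∈ ball (0 : ℂ) 1) {u : ℂ → ℝ}
    (hu : CircleIntegrable u 0 1) : CircleIntegrable (fun ζ => poissonKernel 0 z ζ * u ζ) 0 1 :=
  hu.continuousOn_mul (continuousOn_poissonKernel hz)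

theorem circleAverage_poissonKernel_mul_const {z : ℂ} (hz : z ∈ ball (0 : ℂ) 1) (c : ℝ) :
    Real.circleAverage (fun ζ => poissonKernel 0 z ζ * c) 0 1 = c := by
  have h := DiffContOnCl.circleAverage_poissonKernel_smul
    (diffContOnCl_const (c := (c : ℂ))) hz
  have hint : CircleIntegrable (poissonKernel 0 z • fun _ : ℂ => (c : ℂ)) 0 1 :=
    CircleIntegrable.continuousOn_smul (circleIntegrable_const _ 0 1)
      (continuousOn_poissonKernel hz)
  simpa [h, Function.comp_def] using Complex.reCLM.circleAverage_comp_comm hint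

theorem circleAverage_poissonKernel_mul_mono {z : ℂ} (hz : z ∈ ball (0 : ℂ) 1) {u v : ℂ → ℝ}
    (hu : CircleIntegrable u 0 1) (hv : CircleIntegrable v 0 1) (h : ∀ ζ, u ζ ≤ v ζ) :
    Real.circleAverage (fun ζ => poissonKernel 0 z ζ * u ζ) 0 1
      ≤ Real.circleAverage (fun ζ => poissonKernel 0 z ζ * v ζ) 0 1 :=
  Real.circleAverage_mono (circleIntegrable_poissonKernel_mul hz hu)
    (circleIntegrable_poissonKernel_mul hz hv) fun ζ hζ =>
    mul_le_mul_of_nonneg_left (h ζ) (poissonKernel_nonneg hz hζ)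

theorem norm_circleAverage_le {E : Type*} [NormedAddCommGroup E] [NormedSpace ℝ E] (f : ℂ → E)
    (c : ℂ) (R : ℝ) :
    ‖Real.circleAverage f c R‖ ≤ Real.circleAverage (fun ζ => ‖f ζ‖) c R := by
  rw [Real.circleAverage, Real.circleAverage, norm_smul, smul_eq_mul,
    Real.norm_of_nonneg (by positivity)]
  exact mul_le_mul_of_nonneg_left
    (intervalIntegral.norm_integral_le_integral_norm Real.two_pi_pos.le) (by positivity)

theorem norm_le_one_add_circleAverage_poissonKernel_mul {F : ℂ → ℂ}
    (hF : DiffContOnCl ℂ F (ball 0 1)) {z : ℂ} (hz : z ∈ ball (0 : ℂ) 1) :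
    ‖F z‖ ≤ 1 + Real.circleAverage (fun ζ => poissonKernel 0 z ζ * max (‖F ζ‖ - 1) 0) 0 1 := by
  have hc : ContinuousOn F (sphere 0 1) := hF.2.mono
    (closure_ball (0 : ℂ) one_ne_zero ▸ sphere_subset_closedBall)
  have h1 : CircleIntegrable (fun _ => (1 : ℝ)) 0 1 := circleIntegrable_const 1 0 1
  have hmax : CircleIntegrable (fun ζ => max (‖F ζ‖ - 1) 0) 0 1 :=
    ((hc.norm.sub continuousOn_const).sup continuousOn_const).circleIntegrable zero_le_one
  calc ‖F z‖ = ‖Real.circleAverage (poissonKernel 0 z • F) 0 1‖ := by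
        rw [hF.circleAverage_poissonKernel_smul hz]
    _ ≤ Real.circleAverage (fun ζ => ‖poissonKernel 0 z ζ • F ζ‖) 0 1 := norm_circleAverage_le _ 0 1
    _ = Real.circleAverage (fun ζ => poissonKernel 0 z ζ * ‖F ζ‖) 0 1 :=
        Real.circleAverage_congr_sphere fun ζ hζ => by
          simp [abs_of_nonneg (poissonKernel_nonneg hz hζ)]
    _ ≤ Real.circleAverage (fun ζ => poissonKernel 0 z ζ * (1 + max (‖F ζ‖ - 1) 0)) 0 1 :=
        circleAverage_poissonKernel_mul_mono hz (hc.norm.circleIntegrable zero_le_one)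
          (h1.add hmax) fun ζ => sub_le_iff_le_add'.1 (le_max_left _ _)
    _ = _ := by
        simp only [mul_add]
        rw [Real.circleAverage_fun_add (circleIntegrable_poissonKernel_mul hz h1)
          (circleIntegrable_poissonKernel_mul hz hmax), circleAverage_poissonKernel_mul_const hz]

/-- The domination `‖h‖ ≤ ‖k‖` of radial limits at almost every point of the unit circle, in a form
that makes sense when the limits do not exist. -/
def RadiallyDominated (h k : ℂ → ℂ) : Prop :=
  ∀ᵐ θ : ℝ, ∀ M > 1, ∀ᶠ t in 𝓝[<] 1, ‖h (circleMap 0 t θ)‖ ≤ M * ‖k (circleMap 0 t θ)‖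

theorem radiallyDominated_of_tendsto {h k : ℂ → ℂ} (H : ∀ᵐ θ : ℝ, ∃ α β : ℂ,
    Tendsto (fun t => h (circleMap 0 t θ)) (𝓝[<] 1) (𝓝 α) ∧
    Tendsto (fun t => k (circleMap 0 t θ)) (𝓝[<] 1) (𝓝 β) ∧ ‖α‖ ≤ ‖β‖ ∧ β ≠ 0) :
    RadiallyDominated h k := by
  filter_upwards [H] with θ ⟨α, β, hα, hβ, hle, hβ0⟩ M hM
  exact (hα.norm.eventually_lt (hβ.norm.const_mul M) <|
    hle.trans_lt (lt_mul_of_one_lt_left (norm_pos_iff.2 hβ0) hM)).mono fun _ => le_of_lt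

theorem circleMap_zero_eq_mul (t θ : ℝ) : circleMap 0 t θ = t * circleMap 0 1 θ := by
  simp [circleMap]

theorem circleMap_mem_ball {t : ℝ} (ht : t ∈ Set.Ico 0 1) (θ : ℝ) :
    circleMap 0 t θ ∈ ball (0 : ℂ) 1 := by
  rw [mem_ball_zero_iff, norm_circleMap_zero, abs_of_nonneg ht.1]
  exact ht.2

theorem RadiallyDominated.of_mul_le_mul {h k h' k' : ℂ → ℂ} (H : RadiallyDominated h k)
    (hle : ∀ z ∈ ball (0 : ℂ) 1, k z ≠ 0 ∧ ‖h' z‖ * ‖k z‖ ≤ ‖h z‖ * ‖k' z‖) :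
    RadiallyDominated h' k' := by
  filter_upwards [H] with θ hθ M hM
  filter_upwards [hθ M hM, Ico_mem_nhdsLT zero_lt_one] with t ht ht1
  obtain ⟨hk, hle⟩ := hle _ (circleMap_mem_ball ht1 θ)
  refine le_of_mul_le_mul_right (hle.trans ?_) (norm_pos_iff.2 hk)
  calc _ ≤ M * ‖k (circleMap 0 t θ)‖ * ‖k' (circleMap 0 t θ)‖ := by gcongr
    _ = _ := by ring

theorem norm_le_one_of_radiallyDominated {h : ℂ → ℂ} (hd : DifferentiableOn ℂ h (ball 0 1)) {C : ℝ}
    (hC : ∀ z ∈ ball (0 : ℂ) 1, ‖h z‖ ≤ C) (hr : RadiallyDominated h 1) {z : ℂ}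
    (hz : z ∈ ball (0 : ℂ) 1) : ‖h z‖ ≤ 1 := by
  let excess (t : ℝ) (ζ : ℂ) : ℝ := max (‖h (t * ζ)‖ - 1) 0
  have hexcess {t : ℝ} (ht : t ∈ Set.Ico 0 1) : CircleIntegrable (excess t) 0 1 :=
    ((((continuousOn_closedBall (dilate hd ht)).mono sphere_subset_closedBall).norm.sub
      continuousOn_const).sup continuousOn_const).circleIntegrable zero_le_one
  have hlim : Tendsto (fun t => Real.circleAverage (fun ζ => poissonKernel 0 z ζ * excess t ζ) 0 1)
      (𝓝[<] 1) (𝓝 (Real.circleAverage (fun ζ => poissonKernel 0 z ζ * 0) 0 1)) := by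
    refine tendsto_circleAverage_of_dominated (bound := fun ζ => poissonKernel 0 z ζ * max C 0)
      ?_ ?_ (circleIntegrable_poissonKernel_mul hz (circleIntegrable_const _ 0 1)) ?_
    · filter_upwards [Ico_mem_nhdsLT zero_lt_one] with t ht
      exact circleIntegrable_poissonKernel_mul hz (hexcess ht)
    · filter_upwards [Ico_mem_nhdsLT zero_lt_one] with t ht ζ hζ
      rw [norm_mul, Real.norm_of_nonneg (poissonKernel_nonneg hz hζ),
        Real.norm_of_nonneg (le_max_right _ _)]
      refine mul_le_mul_of_nonneg_left (max_le_max_right 0 ?_) (poissonKernel_nonneg hz hζ)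
      rw [abs_one] at hζ
      linarith [hC (t * ζ) (mul_mem_ball ht (sphere_subset_closedBall hζ))]
    · filter_upwards [hr] with θ hθ
      refine (tendsto_order.2 ⟨fun ε hε => Eventually.of_forall fun t =>
        hε.trans_le (le_max_right _ _), fun ε hε => ?_⟩).const_mul _
      filter_upwards [hθ (1 + ε / 2) (by linarith)] with t ht
      rw [circleMap_zero_eq_mul, Pi.one_apply, norm_one, mul_one] at ht
      exact max_lt (by linarith) hε
  rw [circleAverage_poissonKernel_mul_const hz] at hlim
  simpa using le_of_tendsto_of_tendsto (tendsto_dilate hd hz).norm (hlim.const_add 1)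
    (eventually_of_mem (Ico_mem_nhdsLT zero_lt_one) fun t ht =>
      norm_le_one_add_circleAverage_poissonKernel_mul (dilate hd ht).2 hz)

theorem mul_norm_sub_le {t : ℝ} (ht : t ∈ Set.Ico 0 1) {z η : ℂ} (hz : ‖z‖ ≤ 1) (hη : ‖η‖ = 1) :
    t * ‖z - η‖ ≤ ‖t * z - η‖ := by
  have hre : (z * conj η).re ≤ 1 := by
    simpa [hη] using (re_le_norm (z * conj η)).trans (by simpa [hη] using hz)
  rw [← pow_le_pow_iff_left₀ (mul_nonneg ht.1 (norm_nonneg _)) (norm_nonneg _) two_ne_zero, mul_pow,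
    Complex.sq_norm, Complex.sq_norm, normSq_sub, normSq_sub, map_mul, normSq_ofReal,
    mul_assoc (t : ℂ), re_ofReal_mul, normSq_eq_norm_sq η, hη]
  nlinarith [mul_nonneg (mul_nonneg ht.1 (sub_nonneg.2 ht.2.le)) (sub_nonneg.2 hre),
    sq_nonneg (1 - t)]

theorem pow_mul_norm_eval_nodePoly_le {t : ℝ} (ht : t ∈ Set.Ico 0 1) {s : Multiset ℂ}
    (hs : ∀ η ∈ s, ‖η‖ = 1) {z : ℂ} (hz : ‖z‖ ≤ 1) :
    t ^ s.card * ‖(nodePoly s).eval z‖ ≤ ‖(nodePoly s).eval (t * z)‖ := by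
  induction s using Multiset.induction with
  | empty => simp [nodePoly]
  | cons η s ih =>
    rw [Multiset.forall_mem_cons] at hs
    simp only [nodePoly_cons, Polynomial.eval_mul, norm_mul, Multiset.card_cons, pow_succ',
      Polynomial.eval_sub, Polynomial.eval_X, Polynomial.eval_C]
    rw [mul_mul_mul_comm]
    exact mul_le_mul (mul_norm_sub_le ht hz hs.1) (ih hs.2)
      (mul_nonneg (pow_nonneg ht.1 _) (norm_nonneg _)) (norm_nonneg _)

theorem nodePoly_eval_ne_zero {s : Multiset ℂ} (hs : ∀ η ∈ s, ‖η‖ = 1) {z : ℂ}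
    (hz : z ∈ ball (0 : ℂ) 1) : (nodePoly s).eval z ≠ 0 := fun h =>
  (mem_ball_zero_iff.1 hz).ne (hs z (nodePoly_eval_eq_zero.1 h))

/-- Comparison with `p (t z) / t ^ k`, which is bounded below and dominates `p` in the disc. -/
theorem norm_le_norm_nodePoly_of_radiallyDominated {h : ℂ → ℂ}
    (hd : DifferentiableOn ℂ h (ball 0 1)) {C : ℝ} (hC : ∀ z ∈ ball (0 : ℂ) 1, ‖h z‖ ≤ C)
    {s : Multiset ℂ} (hs : ∀ η ∈ s, ‖η‖ = 1)
    (hr : RadiallyDominated h fun z => (nodePoly s).eval z) {z : ℂ} (hz : z ∈ ball (0 : ℂ) 1) :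
    ‖h z‖ ≤ ‖(nodePoly s).eval z‖ := by
  let p : ℂ → ℂ := fun z => (nodePoly s).eval z
  have hp : Continuous p := (nodePoly s).continuous
  have hbound {t : ℝ} (ht : t ∈ Set.Ico 0 1) : t ^ s.card * ‖h z‖ ≤ ‖p (t * z)‖ := by
    have hne : ∀ w ∈ closedBall (0 : ℂ) 1, p (t * w) ≠ 0 := fun w hw =>
      nodePoly_eval_ne_zero hs (mul_mem_ball ht hw)
    have hinv : ContinuousOn (fun w => (p (t * w))⁻¹) (closedBall 0 1) :=
      (by fun_prop : Continuous fun w : ℂ => p (t * w)).continuousOn.inv₀ hne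
    obtain ⟨D, hD⟩ := (isCompact_closedBall (0 : ℂ) 1).exists_bound_of_continuousOn hinv
    have hle := norm_le_one_of_radiallyDominated (h := fun w => t ^ s.card * h w / p (t * w))
      (C := C * D) ((hd.const_mul _).fun_div ?_ fun w hw => hne w (ball_subset_closedBall hw))
      (fun w hw => ?_) (hr.of_mul_le_mul fun w hw => ⟨nodePoly_eval_ne_zero hs hw, ?_⟩) hz
    · rwa [norm_div, norm_mul, norm_pow, norm_real, Real.norm_of_nonneg ht.1,
        div_le_one (norm_pos_iff.2 (hne z (ball_subset_closedBall hz)))] at hle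
    · exact ((nodePoly s).differentiable.comp (differentiable_id.const_mul _)).differentiableOn
    · rw [norm_div, norm_mul, norm_pow, norm_real, Real.norm_of_nonneg ht.1, div_eq_mul_inv,
        ← norm_inv]
      exact mul_le_mul ((mul_le_of_le_one_left (norm_nonneg _) (pow_le_one₀ ht.1 ht.2.le)).trans
        (hC w hw)) (hD w (ball_subset_closedBall hw)) (norm_nonneg _)
        ((norm_nonneg _).trans (hC w hw))
    · rw [norm_div, norm_mul, norm_pow, norm_real, Real.norm_of_nonneg ht.1, Pi.one_apply, norm_one,
        mul_one, div_mul_eq_mul_div, mul_right_comm,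
        div_le_iff₀ (norm_pos_iff.2 (hne w (ball_subset_closedBall hw))), mul_comm ‖h w‖]
      exact mul_le_mul_of_nonneg_right
        (pow_mul_norm_eval_nodePoly_le ht hs (mem_ball_zero_iff.1 hw).le) (norm_nonneg _)
  have hlim : Tendsto (fun t : ℝ => t ^ s.card * ‖h z‖) (𝓝[<] 1) (𝓝 (1 ^ s.card * ‖h z‖)) :=
    ((continuous_pow _).mul continuous_const).continuousWithinAt
  have hlim' : Tendsto (fun t : ℝ => ‖p (t * z)‖) (𝓝[<] 1) (𝓝 ‖p ((1 : ℝ) * z)‖) :=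
    (by fun_prop : Continuous fun t : ℝ => ‖p (t * z)‖).continuousWithinAt
  simpa [p] using le_of_tendsto_of_tendsto hlim hlim'
    (eventually_of_mem (Ico_mem_nhdsLT zero_lt_one) fun t ht => hbound ht)

/-- The outer function with boundary modulus `exp u`, normalized to be positive at the origin. -/
def outer (u : ℂ → ℝ) (z : ℂ) : ℂ :=
  exp (Real.circleAverage (fun ζ => (ζ + z) / (ζ - z) * (u ζ : ℂ)) 0 1)

theorem outer_eq (u : ℂ → ℝ) (z : ℂ) :
    outer u z = exp (Real.circleAverage (fun ζ => herglotzRieszKernel 0 z ζ • (u ζ : ℂ)) 0 1) := by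
  simp [outer, herglotzRieszKernel_def]

theorem differentiableOn_outer {u : ℂ → ℝ} (hu : CircleIntegrable u 0 1) :
    DifferentiableOn ℂ (outer u) (ball 0 1) := by
  have hu' : CircleIntegrable (fun ζ => (u ζ : ℂ)) 0 1 := by
    simp only [CircleIntegrable, intervalIntegrable_iff] at hu ⊢
    exact Complex.ofRealCLM.integrable_comp hu
  exact (differentiableOn_circleAverage_herglotzRieszKernel_smul hu').cexp.congr fun z _ =>
    outer_eq u z

theorem norm_outer {u : ℂ → ℝ} (hu : CircleIntegrable u 0 1) {z : ℂ} (hz : z ∈ ball (0 : ℂ) 1) :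
    ‖outer u z‖ = Real.exp (Real.circleAverage (fun ζ => poissonKernel 0 z ζ * u ζ) 0 1) := by
  rw [outer_eq, Complex.norm_exp, re_circleAverage_herglotzRieszKernel_smul hu hz,
    ← poissonKernel_eq_re_herglotzRieszKernel]
  rfl

theorem circleIntegrable_max_const {u : ℂ → ℝ} (hu : CircleIntegrable u 0 1) (c : ℝ) :
    CircleIntegrable (fun ζ => max (u ζ) c) 0 1 := by
  have hc := circleIntegrable_const c 0 1
  simp only [CircleIntegrable, intervalIntegrable_iff] at hu hc ⊢
  exact hu.sup hc

theorem tendsto_norm_outer_max {u : ℂ → ℝ} (hu : CircleIntegrable u 0 1) {z : ℂ}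
    (hz : z ∈ ball (0 : ℂ) 1) :
    Tendsto (fun n : ℕ => ‖outer (fun ζ => max (u ζ) (-n)) z‖) atTop (𝓝 ‖outer u z‖) := by
  rw [norm_outer hu hz]
  simp only [norm_outer (circleIntegrable_max_const hu _) hz]
  refine (Real.continuous_exp.tendsto _).comp (tendsto_circleAverage_of_dominated
    (bound := fun ζ => poissonKernel 0 z ζ * |u ζ|) (Eventually.of_forall fun n =>
    circleIntegrable_poissonKernel_mul hz (circleIntegrable_max_const hu _))
    (Eventually.of_forall fun n ζ hζ => ?_) (circleIntegrable_poissonKernel_mul hz hu.abs)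
    (Eventually.of_forall fun θ => ?_))
  · rw [norm_mul, Real.norm_of_nonneg (poissonKernel_nonneg hz hζ), Real.norm_eq_abs]
    refine mul_le_mul_of_nonneg_left (abs_le.2 ⟨?_, ?_⟩) (poissonKernel_nonneg hz hζ)
    · exact (neg_abs_le _).trans (le_max_left _ _)
    · exact max_le (le_abs_self _) ((neg_nonpos.2 n.cast_nonneg).trans (abs_nonneg _))
  · refine (tendsto_const_nhds.congr' ?_).const_mul _
    filter_upwards [eventually_ge_atTop ⌈-u (circleMap 0 1 θ)⌉₊] with n hn
    exact (max_eq_left (neg_le.1 (Nat.ceil_le.1 hn))).symm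

theorem norm_outer_mono {u v : ℂ → ℝ} (hu : CircleIntegrable u 0 1) (hv : CircleIntegrable v 0 1)
    (h : ∀ ζ, u ζ ≤ v ζ) {z : ℂ} (hz : z ∈ ball (0 : ℂ) 1) : ‖outer u z‖ ≤ ‖outer v z‖ := by
  rw [norm_outer hu hz, norm_outer hv hz]
  exact Real.exp_le_exp.2 (circleAverage_poissonKernel_mul_mono hz hu hv h)

theorem norm_outer_const (c : ℝ) {z : ℂ} (hz : z ∈ ball (0 : ℂ) 1) :
    ‖outer (fun _ => c) z‖ = Real.exp c := by
  rw [norm_outer (circleIntegrable_const c 0 1) hz, circleAverage_poissonKernel_mul_const hz]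

/-- Comparison with the outer functions of the truncations `max u (-n)`, which are bounded below. -/
theorem norm_le_norm_outer_of_radiallyDominated {h : ℂ → ℂ} (hd : DifferentiableOn ℂ h (ball 0 1))
    {C : ℝ} (hC : ∀ z ∈ ball (0 : ℂ) 1, ‖h z‖ ≤ C) {u : ℂ → ℝ} (hu : CircleIntegrable u 0 1)
    (hr : RadiallyDominated h (outer u)) {z : ℂ} (hz : z ∈ ball (0 : ℂ) 1) :
    ‖h z‖ ≤ ‖outer u z‖ := by
  refine ge_of_tendsto' (tendsto_norm_outer_max hu hz) fun n => ?_
  have hun := circleIntegrable_max_const hu (-n)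
  let v : ℂ → ℂ := outer fun ζ => max (u ζ) (-n)
  have hv0 (w : ℂ) : 0 < ‖v w‖ := norm_pos_iff.2 (exp_ne_zero _)
  have hlow : ∀ w ∈ ball (0 : ℂ) 1, Real.exp (-n) ≤ ‖v w‖ := fun w hw => norm_outer_const _ hw ▸
    norm_outer_mono (circleIntegrable_const _ 0 1) hun (fun ζ => le_max_right _ _) hw
  have hle := norm_le_one_of_radiallyDominated (h := fun w => h w / v w) (C := C / Real.exp (-n))
    (hd.fun_div (differentiableOn_outer hun) fun w _ => exp_ne_zero _)
    (fun w hw => ?_) (hr.of_mul_le_mul fun w hw => ⟨exp_ne_zero _, ?_⟩) hz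
  · rwa [norm_div, div_le_one (hv0 z)] at hle
  · rw [norm_div]
    exact div_le_div₀ ((norm_nonneg _).trans (hC w hw)) (hC w hw) (Real.exp_pos _) (hlow w hw)
  · rw [norm_div, Pi.one_apply, norm_one, mul_one, div_mul_eq_mul_div]
    exact (div_le_iff₀ (hv0 w)).2 (mul_le_mul_of_nonneg_left
      (norm_outer_mono hu hun (fun ζ => le_max_left _ _) hw) (norm_nonneg _))

theorem tendsto_circleMap_of_continuousOn {f : ℂ → ℂ} (hf : ContinuousOn f (closedBall 0 1))
    (θ : ℝ) : Tendsto (fun t => f (circleMap 0 t θ)) (𝓝[<] 1) (𝓝 (f (circleMap 0 1 θ))) := by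
  have hmem : circleMap 0 1 θ ∈ closedBall (0 : ℂ) 1 :=
    sphere_subset_closedBall (circleMap_mem_sphere 0 zero_le_one θ)
  have hradial := tendsto_ofReal_mul_nhdsWithin_ball (ζ := circleMap 0 1 θ) (by simp)
  simp only [← circleMap_zero_eq_mul] at hradial
  exact ((hf _ hmem).mono ball_subset_closedBall).tendsto.comp hradial

namespace IsSpectralFactor

variable {f g : ℂ → ℂ} {s : Multiset ℂ} (h : IsSpectralFactor f s g)
include h

theorem continuousOn_eval_mul_exp :
    ContinuousOn (fun z => (nodePoly s).eval z * exp (g z)) (closedBall 0 1) :=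
  (nodePoly s).continuous.continuousOn.mul h.continuousOn.cexp

theorem differentiableOn : DifferentiableOn ℂ g (ball 0 1) := fun z hz =>
  (h.analyticAt z (ball_subset_closedBall hz)).differentiableAt.differentiableWithinAt

theorem eval_mul_exp_ne_zero {z : ℂ} (hz : z ∈ ball (0 : ℂ) 1) :
    (nodePoly s).eval z * exp (g z) ≠ 0 :=
  mul_ne_zero (nodePoly_eval_ne_zero h.norm_eq_one hz) (exp_ne_zero _)

end IsSpectralFactor

theorem ae_circleMap_notMem (s : Multiset ℂ) : ∀ᵐ θ : ℝ, circleMap 0 1 θ ∉ s := by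
  classical
  have hs : {z : ℂ | z ∈ s}.Countable :=
    (s.toFinset.finite_toSet.subset fun z hz => by simpa using hz).countable
  exact (hs.preimage_circleMap 0 one_ne_zero).ae_notMem MeasureTheory.volume

namespace IsPythagoreanMate

variable {a b : SchurFunction} (h : IsPythagoreanMate a b) {f : ℂ → ℂ}
  (hf : ContinuousOn f (closedBall 0 1)) (hbf : Set.EqOn b f (ball 0 1))
include h hf hbf

theorem ae_tendsto : ∀ᵐ θ : ℝ, ∃ α : ℂ, Tendsto (fun t => a (circleMap 0 t θ)) (𝓝[<] 1) (𝓝 α) ∧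
    ‖α‖ ^ 2 = 1 - ‖f (circleMap 0 1 θ)‖ ^ 2 := by
  filter_upwards [h.2.2] with θ ⟨α, β, hα, hβ, hαβ⟩
  have hβ' : Tendsto (fun t => b (circleMap 0 t θ)) (𝓝[<] 1) (𝓝 (f (circleMap 0 1 θ))) :=
    (tendsto_circleMap_of_continuousOn hf θ).congr' <|
      eventually_of_mem (Ico_mem_nhdsLT zero_lt_one) fun t ht =>
        (hbf (circleMap_mem_ball ht θ)).symm
  exact ⟨α, hα, by rw [tendsto_nhds_unique hβ' hβ, ← hαβ, add_sub_cancel_right]⟩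

theorem exists_norm_ne_one : ∃ z : ℂ, ‖z‖ = 1 ∧ ‖f z‖ ≠ 1 := by
  by_contra! hunimod
  have ha0 : a 0 ≠ 0 := fun h0 => h.2.1.1.ne' (by rw [h0, zero_re])
  have hr : RadiallyDominated (fun z => 2 / a 0 * a z) 1 := by
    refine radiallyDominated_of_tendsto ?_
    filter_upwards [h.ae_tendsto hf hbf] with θ ⟨α, hα, hα2⟩
    refine ⟨_, 1, hα.const_mul _, tendsto_const_nhds, ?_, one_ne_zero⟩
    rw [hunimod _ (by simp), one_pow, sub_self, sq_eq_zero_iff, norm_eq_zero] at hα2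
    simp [hα2]
  have hle := norm_le_one_of_radiallyDominated (a.differentiableOn.const_mul _)
    (fun z hz => (norm_mul_le _ _).trans
      (mul_le_mul_of_nonneg_left (a.norm_le_one z hz) (norm_nonneg _)))
    hr (mem_ball_self one_pos)
  rw [div_mul_cancel₀ _ ha0] at hle
  norm_num at hle

variable {s : Multiset ℂ} {g : ℂ → ℂ} (hfg : IsSpectralFactor f s g)
include hfg

theorem ae_tendsto_norm_eq : ∀ᵐ θ : ℝ, ∃ α β : ℂ,
    Tendsto (fun t => a (circleMap 0 t θ)) (𝓝[<] 1) (𝓝 α) ∧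
    Tendsto (fun t => (nodePoly s).eval (circleMap 0 t θ) * exp (g (circleMap 0 t θ)))
      (𝓝[<] 1) (𝓝 β) ∧ ‖α‖ = ‖β‖ ∧ β ≠ 0 := by
  filter_upwards [h.ae_tendsto hf hbf, ae_circleMap_notMem s] with θ ⟨α, hα, hα2⟩ hθ
  rw [hfg.one_sub_norm_sq_eq (by simp)] at hα2
  exact ⟨α, _, hα, tendsto_circleMap_of_continuousOn hfg.continuousOn_eval_mul_exp θ,
    (sq_eq_sq₀ (norm_nonneg _) (norm_nonneg _)).1 hα2,
    mul_ne_zero (fun h0 => hθ (nodePoly_eval_eq_zero.1 h0)) (exp_ne_zero _)⟩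

theorem norm_le {z : ℂ} (hz : z ∈ ball (0 : ℂ) 1) :
    ‖a z‖ ≤ ‖(nodePoly s).eval z * exp (g z)‖ := by
  have hr : RadiallyDominated a fun z => (nodePoly s).eval z * exp (g z) := by
    refine radiallyDominated_of_tendsto ((h.ae_tendsto_norm_eq hf hbf hfg).mono ?_)
    exact fun θ ⟨α, β, hα, hβ, heq, hβ0⟩ => ⟨α, β, hα, hβ, heq.le, hβ0⟩
  obtain ⟨C, hC⟩ := (isCompact_closedBall (0 : ℂ) 1).exists_bound_of_continuousOn
    hfg.continuousOn.neg.cexp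
  have hle := norm_le_norm_nodePoly_of_radiallyDominated (h := fun z => a z * exp (-g z)) (C := C)
    (a.differentiableOn.mul hfg.differentiableOn.neg.cexp) (fun z hz => ?_) hfg.norm_eq_one
    (hr.of_mul_le_mul fun z hz => ⟨hfg.eval_mul_exp_ne_zero hz, ?_⟩) hz
  · rwa [exp_neg, ← div_eq_mul_inv, norm_div, div_le_iff₀ (norm_pos_iff.2 (exp_ne_zero _)),
      ← norm_mul] at hle
  · rw [norm_mul]
    exact (mul_le_of_le_one_left (norm_nonneg _) (a.norm_le_one z hz)).trans
      (hC z (ball_subset_closedBall hz))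
  · rw [← norm_mul, ← norm_mul, exp_neg]
    field_simp [exp_ne_zero (g z)]
    exact le_rfl

theorem le_norm {z : ℂ} (hz : z ∈ ball (0 : ℂ) 1) :
    ‖(nodePoly s).eval z * exp (g z)‖ ≤ ‖a z‖ := by
  obtain ⟨c, u, hc, hu, hau⟩ := h.1
  have hnorm : ∀ z ∈ ball (0 : ℂ) 1, ‖a z‖ = ‖outer u z‖ := fun z hz => by
    rw [hau z hz, norm_mul, hc, one_mul, outer]
  have hr : RadiallyDominated (fun z => (nodePoly s).eval z * exp (g z)) a := by
    refine radiallyDominated_of_tendsto ((h.ae_tendsto_norm_eq hf hbf hfg).mono ?_)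
    exact fun θ ⟨α, β, hα, hβ, heq, hβ0⟩ => ⟨β, α, hβ, hα, heq.ge,
      norm_ne_zero_iff.1 (heq ▸ norm_ne_zero_iff.2 hβ0)⟩
  obtain ⟨C, hC⟩ := (isCompact_closedBall (0 : ℂ) 1).exists_bound_of_continuousOn
    hfg.continuousOn_eval_mul_exp
  rw [hnorm z hz]
  refine norm_le_norm_outer_of_radiallyDominated
    ((nodePoly s).differentiable.differentiableOn.mul hfg.differentiableOn.cexp)
    (fun z hz => hC z (ball_subset_closedBall hz)) hu (hr.of_mul_le_mul fun z hz => ?_) hz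
  exact ⟨norm_ne_zero_iff.1 (hnorm z hz ▸ norm_ne_zero_iff.2 (exp_ne_zero _)),
    (congrArg _ (hnorm z hz)).le⟩

theorem exists_eqOn_eval_mul : ∃ ψ : ℂ → ℂ,
    (∀ z ∈ closedBall (0 : ℂ) 1, AnalyticAt ℂ ψ z ∧ ψ z ≠ 0) ∧
      Set.EqOn a (fun z => (nodePoly s).eval z * ψ z) (ball 0 1) := by
  let a₀ : ℂ → ℂ := fun z => (nodePoly s).eval z * exp (g z)
  have ha₀ : ∀ z ∈ ball (0 : ℂ) 1, a₀ z ≠ 0 := fun z => hfg.eval_mul_exp_ne_zero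
  have hnorm : ∀ z ∈ ball (0 : ℂ) 1, ‖a z / a₀ z‖ = 1 := fun z hz => by
    rw [norm_div, (h.norm_le hf hbf hfg hz).antisymm (h.le_norm hf hbf hfg hz),
      div_self (norm_ne_zero_iff.2 (ha₀ z hz))]
  have h0 : (0 : ℂ) ∈ ball (0 : ℂ) 1 := mem_ball_self one_pos
  have hconst := Complex.eqOn_of_isPreconnected_of_isMaxOn_norm (f := fun z => a z / a₀ z)
    (convex_ball (0 : ℂ) 1).isPreconnected isOpen_ball
    (a.differentiableOn.fun_div ((nodePoly s).differentiable.differentiableOn.mul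
      hfg.differentiableOn.cexp) ha₀) h0
    (isMaxOn_iff.2 fun z hz => (hnorm z hz).trans_le (hnorm 0 h0).ge)
  refine ⟨fun z => a 0 / a₀ 0 * exp (g z), fun z hz =>
    ⟨analyticAt_const.mul (hfg.analyticAt z hz).cexp,
      mul_ne_zero (norm_ne_zero_iff.1 (hnorm 0 h0 ▸ one_ne_zero)) (exp_ne_zero _)⟩,
    fun z hz => ?_⟩
  calc a z = a z / a₀ z * a₀ z := (div_mul_cancel₀ _ (ha₀ z hz)).symm
    _ = a 0 / a₀ 0 * a₀ z := congrArg (· * a₀ z) (hconst hz)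
    _ = (nodePoly s).eval z * (a 0 / a₀ 0 * exp (g z)) := mul_left_comm _ _ _

end IsPythagoreanMate

theorem IsContinuation.exists_isSpectralFactor {a q : SchurFunction} {f : ℂ → ℂ}
    (hf : IsContinuation q f) (ha : IsPythagoreanMate a q) : ∃ s g, IsSpectralFactor f s g :=
  hf.norm_eq_one_or.resolve_left fun hunimod =>
    let ⟨z, hz, hne⟩ := ha.exists_norm_ne_one hf.continuousOn hf.eq
    hne (hunimod z hz)

theorem IsHardyTwo.bounded_mul {F g : ℂ → ℂ} (hF : IsHardyTwo F)
    (hg : DifferentiableOn ℂ g (ball 0 1)) {C : ℝ} (hC : ∀ z ∈ ball (0 : ℂ) 1, ‖g z‖ ≤ C) :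
    IsHardyTwo (fun z => g z * F z) := by
  obtain ⟨hFd, D, hD⟩ := hF
  refine ⟨hg.mul hFd, C ^ 2 * D, fun ρ h0 h1 => ?_⟩
  calc Real.circleAverage (fun z => ‖g z * F z‖ ^ 2) 0 ρ
      ≤ Real.circleAverage (fun z => C ^ 2 • ‖F z‖ ^ 2) 0 ρ := by
        refine Real.circleAverage_mono (circleIntegrable_norm_sq (hg.mul hFd) h0 h1)
          (circleIntegrable_norm_sq hFd h0 h1).const_smul fun z hz => ?_
        rw [abs_of_nonneg h0, mem_sphere_zero_iff_norm] at hz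
        rw [norm_mul, mul_pow, smul_eq_mul]
        gcongr
        exact hC z (mem_ball_zero_iff.2 (hz.trans_lt h1))
    _ = C ^ 2 * Real.circleAverage (fun z => ‖F z‖ ^ 2) 0 ρ := by
        rw [Real.circleAverage_fun_smul, smul_eq_mul]
    _ ≤ C ^ 2 * D := mul_le_mul_of_nonneg_left (hD ρ h0 h1) (sq_nonneg C)

theorem mulHardyTwo_mul_le (φ : ℂ → ℂ) {ψ : ℂ → ℂ}
    (hψ : ∀ z ∈ closedBall (0 : ℂ) 1, AnalyticAt ℂ ψ z) :
    mulHardyTwo (fun z => φ z * ψ z) ≤ mulHardyTwo φ := by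
  obtain ⟨C, hC⟩ := (isCompact_closedBall (0 : ℂ) 1).exists_bound_of_continuousOn
    fun z hz => (hψ z hz).continuousAt.continuousWithinAt
  intro f hf
  obtain ⟨F, hF, hfF⟩ := mem_mulHardyTwo.1 hf
  exact mem_mulHardyTwo.2 ⟨_, hF.bounded_mul
    (fun z hz => (hψ z (ball_subset_closedBall hz)).differentiableAt.differentiableWithinAt)
    fun z hz => hC z (ball_subset_closedBall hz), fun z => by rw [hfF z, mul_assoc]⟩

theorem mulHardyTwo_congr {φ ψ : ℂ → ℂ} (h : Set.EqOn φ ψ (ball 0 1)) :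
    mulHardyTwo φ = mulHardyTwo ψ := by
  have heq : (fun z : 𝔻 => φ z) = fun z : 𝔻 => ψ z :=
    funext fun z => h (mem_ball_zero_iff.2 z.norm_lt_one)
  rw [mulHardyTwo, mulHardyTwo, heq]

theorem mulHardyTwo_mul_eq (φ : ℂ → ℂ) {ψ : ℂ → ℂ}
    (hψ : ∀ z ∈ closedBall (0 : ℂ) 1, AnalyticAt ℂ ψ z ∧ ψ z ≠ 0) :
    mulHardyTwo (fun z => φ z * ψ z) = mulHardyTwo φ := by
  refine (mulHardyTwo_mul_le φ fun z hz => (hψ z hz).1).antisymm ?_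
  rw [mulHardyTwo_congr (φ := φ) (ψ := fun z => φ z * ψ z * (ψ z)⁻¹) fun z hz =>
    (mul_inv_cancel_right₀ (hψ z (ball_subset_closedBall hz)).2 _).symm]
  exact mulHardyTwo_mul_le _ fun z hz => (hψ z hz).1.inv (hψ z hz).2

theorem IsAnalyticExtensionAt.hasZeroOfMultiplicity_iff {f F : ℂ → ℂ} {η : ℂ} (hη : ‖η‖ = 1)
    (hF : IsAnalyticExtensionAt f η F) {k : ℕ} :
    HasZeroOfMultiplicity f η k ↔ 0 < k ∧ analyticOrderAt F η = k :=
  and_congr_right fun _ => ⟨fun ⟨_, hG, hGk⟩ =>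
    (analyticOrderAt_congr (hF.eventuallyEq hη hG)).trans hGk, fun hk => ⟨F, hF, hk⟩⟩

theorem analyticOrderAt_eval_nodePoly_mul (s : Multiset ℂ) {ψ : ℂ → ℂ} {η : ℂ}
    (hψ : AnalyticAt ℂ ψ η) (hη : ψ η ≠ 0) :
    analyticOrderAt (fun z => (nodePoly s).eval z * ψ z) η = s.count η := by
  rw [← rootMultiplicity_nodePoly, ← analyticOrderAt_eval (nodePoly_ne_zero s)]
  exact (analyticOrderAt_mul (analyticAt_eval _ η) hψ).trans
    (by rw [hψ.analyticOrderAt_eq_zero.2 hη, add_zero])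

theorem IsCircleZeros.count_eq {a ψ : ℂ → ℂ} {s : Multiset ℂ} {n : ℕ} {ζ : Fin n → ℂ}
    {m : Fin n → ℕ}
    (hs : ∀ η ∈ s, ‖η‖ = 1) (hψ : ∀ z ∈ closedBall (0 : ℂ) 1, AnalyticAt ℂ ψ z ∧ ψ z ≠ 0)
    (ha : Set.EqOn a (fun z => (nodePoly s).eval z * ψ z) (ball 0 1)) (hζ : IsCircleZeros a ζ m) :
    (∀ j, s.count (ζ j) = m j) ∧ ∀ η ∈ s, ∃ j, ζ j = η := by
  obtain ⟨-, hnorm, hmult, hall⟩ := hζ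
  have hiff {η : ℂ} (hη : ‖η‖ = 1) (k : ℕ) :
      HasZeroOfMultiplicity a η k ↔ 0 < k ∧ s.count η = k := by
    obtain ⟨hψη, hne⟩ := hψ η (mem_closedBall_zero_iff.2 hη.le)
    have hext : IsAnalyticExtensionAt a η fun z => (nodePoly s).eval z * ψ z :=
      ⟨(analyticAt_eval _ η).mul hψη, eventually_of_mem self_mem_nhdsWithin fun z hz =>
        (ha hz).symm⟩
    rw [hext.hasZeroOfMultiplicity_iff hη, analyticOrderAt_eval_nodePoly_mul s hψη hne,
      Nat.cast_inj]
  exact ⟨fun j => ((hiff (hnorm j) _).1 (hmult j)).2, fun η hη =>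
    hall η (hs η hη) _ ((hiff (hs η hη) _).2 ⟨Multiset.count_pos.2 hη, rfl⟩)⟩

theorem nodePoly_eval_eq_prod {s : Multiset ℂ} {ι : Type*} [Fintype ι] {ζ : ι → ℂ} {m : ι → ℕ}
    (hinj : Function.Injective ζ) (hcount : ∀ j, s.count (ζ j) = m j)
    (hmem : ∀ η ∈ s, ∃ j, ζ j = η) (z : ℂ) :
    (nodePoly s).eval z = ∏ j, (z - ζ j) ^ m j := by
  have hsub : s.toFinset ⊆ Finset.univ.image ζ := fun η hη => by
    simpa using hmem η (Multiset.mem_toFinset.1 hη)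
  have hpoly : nodePoly s = ∏ j, (Polynomial.X - Polynomial.C (ζ j)) ^ m j := by
    rw [nodePoly, Finset.prod_multiset_map_count, Finset.prod_subset hsub fun η _ hη => by
      rw [Multiset.count_eq_zero.2 fun h => hη (Multiset.mem_toFinset.2 h), pow_zero],
      Finset.prod_image hinj.injOn]
    simp only [hcount]
  simp [hpoly, Polynomial.eval_prod]

end DBR

end

theorem theorem2 (q : SchurFunction) (hrat : IsRational q) (hout : IsOuter q)
    (r : ℝ) (hr : 0 < r) (L : LogBranch q) :
    -- `H(q^r) = H(q)` as sets
    (spaceFunctions (q.power L r hr) : Set (𝔻 → ℂ)) = spaceFunctions q ∧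
    ∀ a : SchurFunction, IsPythagoreanMate a q →
      ∀ (n : ℕ) (ζ : Fin n → ℂ) (m : Fin n → ℕ), IsCircleZeros a ζ m →
        -- the derivative kernels at the boundary zeros are well defined
        (∀ (j : Fin n) (ℓ : Fin (m j)),
          ∃! v : 𝔻 → ℂ, IsKernelDeriv (q.power L r hr) ℓ (ζ j) v) ∧
        -- `a H² = (∏ (z - ζ j) ^ m j) H²`, and it lies in `H(q^r)`
        mulHardyTwo a = mulHardyTwo (fun z => ∏ j, (z - ζ j) ^ m j) ∧
        mulHardyTwo a ≤ spaceFunctions (q.power L r hr) ∧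
        -- the derivative kernels belong to `H(q^r)`
        ∃ v : (j : Fin n) → Fin (m j) → Space (q.power L r hr),
          (∀ (j : Fin n) (ℓ : Fin (m j)), IsKernelDeriv (q.power L r hr) ℓ (ζ j) (v j ℓ)) ∧
          -- they are orthogonal to `a H²`
          (∀ (j : Fin n) (ℓ : Fin (m j)), ∀ f ∈ subspaceOf (q.power L r hr) (mulHardyTwo a),
            ⟪f, v j ℓ⟫_ℂ = 0) ∧
          -- `H(q^r)` is the orthogonal sum of `(∏ (z - ζ j) ^ m j) H²` and their span
          (subspaceOf (q.power L r hr) (mulHardyTwo fun z => ∏ j, (z - ζ j) ^ m j) ⟂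
            Submodule.span ℂ (Set.range fun p : (j : Fin n) × Fin (m j) => v p.1 p.2)) ∧
          subspaceOf (q.power L r hr) (mulHardyTwo fun z => ∏ j, (z - ζ j) ^ m j) ⊔
            Submodule.span ℂ (Set.range fun p : (j : Fin n) × Fin (m j) => v p.1 p.2) = ⊤ := by
  obtain ⟨f, hf⟩ := exists_isContinuation q hrat
  refine ⟨congrArg _ (hf.spaceFunctions_power_eq L hr), fun a ha n ζ m hζ => ?_⟩
  obtain ⟨s, g, hfg⟩ := hf.exists_isSpectralFactor ha
  have hw := (hf.isPower_power L hr).isBoundaryWeight hfg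
  obtain ⟨ψ, hψ, haψ⟩ := ha.exists_eqOn_eval_mul hf.continuousOn hf.eq hfg
  obtain ⟨hcount, hmem⟩ := hζ.count_eq hw.norm_eq_one hψ haψ
  have haH : mulHardyTwo a = mulHardyTwo fun z => (nodePoly s).eval z :=
    (mulHardyTwo_congr haψ).trans (mulHardyTwo_mul_eq _ hψ)
  have hprod : (fun z => (nodePoly s).eval z) = fun z => ∏ j, (z - ζ j) ^ m j :=
    funext (nodePoly_eval_eq_prod hζ.1 hcount hmem)
  obtain ⟨v, hv, horth, hperp, htop⟩ := hw.orthogonal_decomposition hcount hmem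
  rw [haH, ← hprod]
  exact ⟨fun j ℓ => ⟨v j ℓ, hv j ℓ, fun v' hv' => hv'.unique (hζ.2.1 j) (hv j ℓ)⟩, rfl,
    hw.mulHardyTwo_le_spaceFunctions, v, hv, horth, hperp, htop⟩
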